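/- Let $B$ be a smooth manifold (Hausdorff, second countable, without boundary) of dimension $n$, and let $J^1B=T^*B\times\mathbb R$ with points $(q,p,z)$, contact form $\lambda=dz-p\,dq$, Reeb vector field $R_\lambda$ (the solution of $\lambda(R_\lambda)=1$, $R_\lambda\rfloor d\lambda=0$), projection $\pi_B(q,p,z)=q$ and zero section $o_{J^1B}=\{p=0,\ z=0\}$. Let $H=H(t,y)$ be a smooth compactly supported function on $[0,1]\times J^1B$, and let $X_H$ be its contact Hamiltonian vector field, determined by $$\lambda(X_H)=-H,\qquad X_H\rfloor d\lambda=dH-R_\lambda[H]\,\lambda .$$ Let $\psi_H^t$ be the flow of $X_H$, put $\phi_H^t=\psi_H^t\circ(\psi_H^1)^{-1}$, and for a contactomorphism $\psi$ with $\psi^*\lambda=e^{g}\lambda$ write $g_\psi=g$. Fix one of two classes of paths $\gamma:[0,1]\to J^1B$: the $C^\infty$ paths, or the continuous piecewise $C^\infty$ paths. Let $\mathcal L^{\mathrm{Carnot}}_0(J^1B,H;o_{J^1B})$ be the set of paths $\gamma$ of this class with $$\lambda(\dot\gamma(t))+H(t,\gamma(t))=0\quad\text{(away from break points)}\qquad\text{and}\qquad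 \gamma(0)\in o_{J^1B},$$ let $\Pi(\gamma)=\pi_B(\gamma(1))\in B$, and let $\mathcal A_H^{CC}$ be the restriction to this space of the functional $$\gamma\mapsto -\int_0^1 e^{g_{(\phi_H^t)^{-1}}(\gamma(t))}\bigl(\lambda(\dot\gamma(t))+H(t,\gamma(t))\bigr)\,dt+z(\gamma(1)).$$ A path $\gamma\in\mathcal L^{\mathrm{Carnot}}_0(J^1B,H;o_{J^1B})$ is called a vertical critical point of $\mathcal A_H^{CC}$ if $$\frac{d}{ds}\Big|_{s=0}\mathcal A_H^{CC}(\gamma_s)=0$$ for every $\varepsilon>0$ and every smooth family $(\gamma_s)_{-\varepsilon<s<\varepsilon}$ in the fibre $\Pi^{-1}(\Pi(\gamma))\subset\mathcal L^{\mathrm{Carnot}}_0(J^1B,H;o_{J^1B})$ with $\gamma_0=\gamma$. Here a family is smooth if $(s,t)\mapsto\gamma_s(t)$ is $C^\infty$ on $(-\varepsilon,\varepsilon)\times[0,1]$ or, for the piecewise smooth class, on each $(-\varepsilon,\varepsilon)\times[t_{i-1},t_i]$ for some finite partition $0=t_0<\dots<t_k=1$ independent of $s$. Then, for either class of paths, $\gamma\in\mathcal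 L^{\mathrm{Carnot}}_0(J^1B,H;o_{J^1B})$ is a vertical critical point of $\mathcal A_H^{CC}$ if and only if it is a contact Hamiltonian chord, that is, $$\dot\gamma(t)=X_H(t,\gamma(t))\ \text{ for all } t\in[0,1],\qquad \gamma(0)\in o_{J^1B}.$$ -/

import Mathlib

open Set MeasureTheory
open scoped Manifold ContDiff Topology Bundle

noncomputable section

/-! ### The one-jet bundle `J¹B = T*B × ℝ` -/

/-- The one-jet bundle `J¹B = T*B × ℝ` of an `n`-dimensional manifold `B`. A point is
`y = (x, z) = ((q, p), z)` with `q = y.1.proj`, `p = y.1.snd : T_q B →L[ℝ] ℝ` and `z = y.2`. -/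
abbrev OneJet (n : ℕ) (B : Type*) [TopologicalSpace B]
    [ChartedSpace (EuclideanSpace ℝ (Fin n)) B] [IsManifold (𝓡 n) ∞ B] : Type _ :=
  Bundle.TotalSpace (EuclideanSpace ℝ (Fin n) →L[ℝ] ℝ)
    (fun b : B => TangentSpace (𝓡 n) b →L[ℝ] ℝ) × ℝ

/-- The model with corners of the manifold `J¹B = T*B × ℝ`. -/
abbrev jetModel (n : ℕ) :=
  ((𝓡 n).prod 𝓘(ℝ, EuclideanSpace ℝ (Fin n) →L[ℝ] ℝ)).prod 𝓘(ℝ, ℝ)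

/-- The model vector space of the manifold `J¹B`. -/
abbrev JetVec (n : ℕ) :=
  (EuclideanSpace ℝ (Fin n) × (EuclideanSpace ℝ (Fin n) →L[ℝ] ℝ)) × ℝ

namespace OneJet

variable {n : ℕ} {B : Type*} [TopologicalSpace B]
  [ChartedSpace (EuclideanSpace ℝ (Fin n)) B] [IsManifold (𝓡 n) ∞ B]

/-- The bundle projection `π_B : J¹B → B`, `(q, p, z) ↦ q`. -/
def base (y : OneJet n B) : B := y.1.proj

/-- The fibre coordinate `z : J¹B → ℝ`. -/
def height (y : OneJet n B) : ℝ := y.2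

/-- The zero section `o_{J¹B} = {(q, 0, 0)}`. -/
def zeroSection (n : ℕ) (B : Type*) [TopologicalSpace B]
    [ChartedSpace (EuclideanSpace ℝ (Fin n)) B] [IsManifold (𝓡 n) ∞ B] : Set (OneJet n B) :=
  {y | y.1.snd = 0 ∧ y.2 = 0}

/-- The standard contact form `λ = dz - p dq` : `λ_y(v) = dz(v) - p (dπ_B(v))`. -/
def contactForm (y : OneJet n B) : TangentSpace (jetModel n) y →L[ℝ] ℝ :=
  let dz : JetVec n →L[ℝ] ℝ := mfderiv (jetModel n) 𝓘(ℝ, ℝ) (height (n := n) (B := B)) y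
  let dq : JetVec n →L[ℝ] EuclideanSpace ℝ (Fin n) :=
    mfderiv (jetModel n) (𝓡 n) (base (n := n) (B := B)) y
  let p : EuclideanSpace ℝ (Fin n) →L[ℝ] ℝ := y.1.snd
  (dz - p.comp dq : JetVec n →L[ℝ] ℝ)

/-- The contact form written in the preferred chart `φ` around `y₀`, i.e. `(φ⁻¹)^* λ`, a one-form
on (the chart domain in) the model vector space. -/
def contactFormInChart (y₀ : OneJet n B) (e : JetVec n) : JetVec n →L[ℝ] ℝ :=
  (contactForm ((extChartAt (jetModel n) y₀).symm e) : JetVec n →L[ℝ] ℝ).comp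
    (mfderiv 𝓘(ℝ, JetVec n) (jetModel n) (extChartAt (jetModel n) y₀).symm e :
      JetVec n →L[ℝ] JetVec n)

/-- The two-form `dλ` at `y`, computed in the preferred chart around `y` (in which Mathlib's
tangent space at `y` is the model vector space): `dα(u, v) = (∂_u α)(v) - (∂_v α)(u)`. -/
def dContactForm (y : OneJet n B) (u v : TangentSpace (jetModel n) y) : ℝ :=
  fderiv ℝ (contactFormInChart y) (extChartAt (jetModel n) y y) u v -
    fderiv ℝ (contactFormInChart y) (extChartAt (jetModel n) y y) v u

/-- `R` is the value at `y` of the Reeb vector field: `λ(R) = 1` and `R ⌋ dλ = 0`. -/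
def IsReebVector (y : OneJet n B) (R : TangentSpace (jetModel n) y) : Prop :=
  contactForm y R = 1 ∧ ∀ v, dContactForm y R v = 0

/-- The Reeb vector field `R_λ`, the unique solution of `λ(R) = 1`, `R ⌋ dλ = 0`. -/
def reeb (y : OneJet n B) : TangentSpace (jetModel n) y :=
  Classical.epsilon (IsReebVector y)

/-! ### Contact Hamiltonian vector fields and flows

A time-dependent Hamiltonian is `H : ℝ → J¹B → ℝ`; only times `t ∈ [0, 1]` are relevant. -/

/-- `H` is smooth on `[0, 1] × J¹B`. -/
def IsSmoothHamiltonian (H : ℝ → OneJet n B → ℝ) : Prop :=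
  ContMDiffOn (𝓘(ℝ, ℝ).prod (jetModel n)) 𝓘(ℝ, ℝ) ∞
    (fun p : ℝ × OneJet n B => H p.1 p.2) (Icc 0 1 ×ˢ univ)

/-- `H` is compactly supported. -/
def IsCompactlySupportedHamiltonian (H : ℝ → OneJet n B → ℝ) : Prop :=
  ∃ K : Set (OneJet n B), IsCompact K ∧ ∀ t ∈ Icc (0 : ℝ) 1, ∀ y ∉ K, H t y = 0

/-- The differential `dH_t` at `y`. -/
def dHam (H : ℝ → OneJet n B → ℝ) (t : ℝ) (y : OneJet n B) :
    TangentSpace (jetModel n) y →L[ℝ] ℝ :=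
  (mfderiv (jetModel n) 𝓘(ℝ, ℝ) (H t) y : JetVec n →L[ℝ] ℝ)

/-- `X` is the value at `(t, y)` of the contact Hamiltonian vector field of `H`:
`λ(X) = -H` and `X ⌋ dλ = dH - R_λ[H] λ`. -/
def IsContactHamiltonianVector (H : ℝ → OneJet n B → ℝ) (t : ℝ) (y : OneJet n B)
    (X : TangentSpace (jetModel n) y) : Prop :=
  contactForm y X = -H t y ∧
    ∀ v, dContactForm y X v = dHam H t y v - dHam H t y (reeb y) * contactForm y v

/-- The contact Hamiltonian vector field `X_H`, the unique solution of
`λ(X) = -H`, `X ⌋ dλ = dH - R_λ[H] λ`. -/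
def contactHamiltonianVectorField (H : ℝ → OneJet n B → ℝ) (t : ℝ) (y : OneJet n B) :
    TangentSpace (jetModel n) y :=
  Classical.epsilon (IsContactHamiltonianVector H t y)

/-- The path `c : [0, 1] → J¹B` solves `ċ(t) = X_H(t, c(t))` for all `t ∈ [0, 1]` (one-sided
derivatives at the two end points). -/
def IsHamiltonianTrajectory (H : ℝ → OneJet n B → ℝ) (c : ℝ → OneJet n B) : Prop :=
  ∀ t ∈ Icc (0 : ℝ) 1, HasMFDerivWithinAt 𝓘(ℝ, ℝ) (jetModel n) c (Icc 0 1) t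
    (ContinuousLinearMap.toSpanSingleton ℝ
      (contactHamiltonianVectorField H t (c t) : JetVec n))

open Classical in
/-- The flow `ψ_H^t` of `X_H`, `t ∈ [0, 1]`: `t ↦ ψ_H^t(y)` is the Hamiltonian trajectory starting
at `y` (it exists and is unique for smooth compactly supported `H`). -/
def contactFlow (H : ℝ → OneJet n B → ℝ) (t : ℝ) (y : OneJet n B) : OneJet n B :=
  if h : ∃ c : ℝ → OneJet n B, IsHamiltonianTrajectory H c ∧ c 0 = y then h.choose t else y

/-- The inverse of a bijective map `J¹B → J¹B`. -/
def inverseMap (f : OneJet n B → OneJet n B) (y : OneJet n B) : OneJet n B :=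
  haveI : Nonempty (OneJet n B) := ⟨y⟩
  Function.invFun f y

/-- The isotopy `φ_H^t = ψ_H^t ∘ (ψ_H^1)⁻¹`. -/
def finalFlow (H : ℝ → OneJet n B → ℝ) (t : ℝ) (y : OneJet n B) : OneJet n B :=
  contactFlow H t (inverseMap (contactFlow H 1) y)

/-- The conformal exponent `g_ψ` of a contactomorphism `ψ`: the function with
`ψ^* λ = e^{g_ψ} λ`. -/
def conformalExponent (ψ : OneJet n B → OneJet n B) (y : OneJet n B) : ℝ :=
  Classical.epsilon fun g : ℝ => ∀ v : TangentSpace (jetModel n) y,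
    contactForm (ψ y) (mfderiv (jetModel n) (jetModel n) ψ y v) = Real.exp g * contactForm y v

/-! ### Path spaces

A path `[0, 1] → J¹B` is represented by a function `γ : ℝ → J¹B`, of which only the values on
`[0, 1]` matter. -/

end OneJet

/-- The two categories of paths: smooth paths, and continuous piecewise smooth paths. -/
inductive PathClass
  | smooth
  | piecewiseSmooth

/-- The finite sets of break points that a path of the given class may have. -/
def PathClass.AllowsBreaks : PathClass → Finset ℝ → Prop
  | .smooth, P => P = ∅
  | .piecewiseSmooth, _ => True

namespace OneJet

variable {n : ℕ} {B : Type*} [TopologicalSpace B]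
  [ChartedSpace (EuclideanSpace ℝ (Fin n)) B] [IsManifold (𝓡 n) ∞ B]

/-- `γ : [0, 1] → J¹B` is a path of the class `c`: there is a finite set `P` of break points (empty
for the class of smooth paths) such that `γ` is smooth on every closed interval `[a, b] ⊆ [0, 1]`
without break points in its interior. In particular `γ` is continuous on `[0, 1]`. -/
def IsPath (c : PathClass) (γ : ℝ → OneJet n B) : Prop :=
  ∃ P : Finset ℝ, c.AllowsBreaks P ∧ ∀ a b : ℝ, 0 ≤ a → a < b → b ≤ 1 → (∀ τ ∈ P, τ ∉ Ioo a b) →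
    ContMDiffOn 𝓘(ℝ, ℝ) (jetModel n) ∞ γ (Icc a b)

/-- The velocity `γ̇(t)` of a path on `[0, 1]` (one-sided at the end points). -/
def velocity (γ : ℝ → OneJet n B) (t : ℝ) : TangentSpace (jetModel n) (γ t) :=
  (mfderivWithin 𝓘(ℝ, ℝ) (jetModel n) γ (Icc 0 1) t : ℝ →L[ℝ] JetVec n) 1

/-- `γ^* λ + H(t, γ(t)) dt = 0`, that is `λ(γ̇(t)) + H(t, γ(t)) = 0` for every `t ∈ [0, 1]` at which
`γ` is differentiable (everywhere for a smooth path, away from the break points in general). -/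
def IsTranslatedHorizontal (H : ℝ → OneJet n B → ℝ) (γ : ℝ → OneJet n B) : Prop :=
  ∀ t ∈ Icc (0 : ℝ) 1, MDifferentiableWithinAt 𝓘(ℝ, ℝ) (jetModel n) γ (Icc 0 1) t →
    contactForm (γ t) (velocity γ t) + H t (γ t) = 0

/-- The Carnot path space `ℒ^Carnot(J¹B, H)` of `H`-translated horizontal paths. -/
def carnotPathSpace (c : PathClass) (H : ℝ → OneJet n B → ℝ) : Set (ℝ → OneJet n B) :=
  {γ | IsPath c γ ∧ IsTranslatedHorizontal H γ}

/-- `ℒ_0^Carnot(J¹B, H; o_{J¹B})`: the Carnot paths starting on the zero section. -/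
def carnotPathSpaceZero (c : PathClass) (H : ℝ → OneJet n B → ℝ) : Set (ℝ → OneJet n B) :=
  {γ | γ ∈ carnotPathSpace c H ∧ γ 0 ∈ zeroSection n B}

/-- The projection `Π(γ) = π_B(γ(1))`. -/
def endProjection (γ : ℝ → OneJet n B) : B := base (γ 1)

/-! ### Action functionals -/

/-- The perturbed action functional
`𝒜_H(γ) = ∫₀¹ e^{g_{(φ_H^t)⁻¹}(γ(t))} (λ(γ̇(t)) + H_t(γ(t))) dt`. -/
def perturbedAction (H : ℝ → OneJet n B → ℝ) (γ : ℝ → OneJet n B) : ℝ :=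
  ∫ t in (0 : ℝ)..1, Real.exp (conformalExponent (inverseMap (finalFlow H t)) (γ t)) *
    (contactForm (γ t) (velocity γ t) + H t (γ t))

/-- The effective action functional `-𝒜_H(γ) + z(γ(1))`. The functional `𝒜_H^CC` is its restriction
to the Carnot path space. -/
def effectiveAction (H : ℝ → OneJet n B → ℝ) (γ : ℝ → OneJet n B) : ℝ :=
  -perturbedAction H γ + height (γ 1)

/-! ### Vertical critical points -/

/-- `Γ = (γ_s)`, `-ε < s < ε`, is a variation through paths of the class `c`: there is a finite set
`P` of break points (empty for the class of smooth paths), independent of `s`, such that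
`(s, t) ↦ γ_s(t)` is smooth on `(-ε, ε) × [a, b]` for every `[a, b] ⊆ [0, 1]` without break points
in its interior. -/
def IsVariation (c : PathClass) (ε : ℝ) (Γ : ℝ → ℝ → OneJet n B) : Prop :=
  ∃ P : Finset ℝ, c.AllowsBreaks P ∧ ∀ a b : ℝ, 0 ≤ a → a < b → b ≤ 1 → (∀ τ ∈ P, τ ∉ Ioo a b) →
    ContMDiffOn 𝓘(ℝ, ℝ × ℝ) (jetModel n) ∞ (fun p : ℝ × ℝ => Γ p.1 p.2)
      (Ioo (-ε) ε ×ˢ Icc a b)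

/-- `Γ` is a variation of `γ` through paths of class `c` inside the fibre of
`Π : ℒ_0^Carnot(J¹B, H; o_{J¹B}) → B` through `γ`. -/
structure IsVerticalVariation (c : PathClass) (H : ℝ → OneJet n B → ℝ) (γ : ℝ → OneJet n B)
    (ε : ℝ) (Γ : ℝ → ℝ → OneJet n B) : Prop where
  pos : 0 < ε
  isVariation : IsVariation c ε Γ
  start : ∀ t ∈ Icc (0 : ℝ) 1, Γ 0 t = γ t
  mem : ∀ s ∈ Ioo (-ε) ε, Γ s ∈ carnotPathSpaceZero c H
  vertical : ∀ s ∈ Ioo (-ε) ε, endProjection (Γ s) = endProjection γ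

/-- `γ` is a vertical critical point of `𝒜_H^CC` for the fibration `Π`: the functional `𝒜_H^CC` is
stationary at `s = 0` along every variation of `γ` inside the fibre of `Π` through `γ`. -/
def IsVerticalCriticalPoint (c : PathClass) (H : ℝ → OneJet n B → ℝ) (γ : ℝ → OneJet n B) : Prop :=
  ∀ (ε : ℝ) (Γ : ℝ → ℝ → OneJet n B), IsVerticalVariation c H γ ε Γ →
    HasDerivAt (fun s : ℝ => effectiveAction H (Γ s)) 0 0

/-- `γ` is a contact Hamiltonian chord: `γ̇(t) = X_H(t, γ(t))` for all `t ∈ [0, 1]` and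
`γ(0) ∈ o_{J¹B}`. -/
def IsContactHamiltonianChord (H : ℝ → OneJet n B → ℝ) (γ : ℝ → OneJet n B) : Prop :=
  IsHamiltonianTrajectory H γ ∧ γ 0 ∈ zeroSection n B

end OneJet
end

/-! On the Carnot space the integrand of the action vanishes away from break points, so the
functional is just `z(γ(1))` (`effectiveAction_eq_height`); the conformal weights and the flow of
`X_H` play no role. For a variation `γ_s` with variation field `η = ∂_s γ_s` at `s = 0`, put `L(t) =
λ(η(t))`, the `variationPairing`. Differentiating the constraint `λ(γ̇_s) + H = 0` in `s` and
exchanging the order of the partial derivatives gives `L' = dλ(γ̇, η) - dH(η)`. Moreover `L(0) = 0`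
because `λ` vanishes on the zero section, and `L(1)` is the derivative of the action because the
base point of `γ_s(1)` is fixed.

Chord to critical point: if `γ̇ = X_H`, the formula becomes `L' = -R[H] L`, so `L(0) = 0` forces
`L(1) = 0`.

Critical point to chord: enough variations must be produced. In a chart the `(q, p)` part of `γ` is
moved by `sin(s) χ(t) η`, with `χ` a bump function supported inside a smooth piece, and the height
is corrected by `w(t, s)` so that the constraint persists. The correction solves a scalar
differential equation; since `H` vanishes for large `|z|`, its right hand side is bounded on `[0,
1]`, locally uniformly in `s`. It therefore has a global solution, which is smooth in the parameter
(`exists_parametric_solution`). The corrected family is a vertical variation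
(`IsDeformationDatum.isVerticalVariation`), and `L' = -R[H] L + χ · defect`, where the defect
measures the failure of `γ̇ ⌋ dλ = dH - R[H] λ` on `η`.

If `χ · defect ≥ 0`, then `L` times an integrating factor is nondecreasing and vanishes at both
ends, so `L = 0` and the defect vanishes where `χ > 0` (`eq_zero_of_hasDerivWithinAt_of_nonneg`).
Using `η` and `-η` kills the defect inside each piece, and continuity extends this to the end points
of pieces, break points included. Together with the constraint and nondegeneracy of the contact form
(`eq_of_contactForm_eq`) this gives `γ̇ = X_H` from both sides at every time, so a critical path has
no corners. -/

/-! ### Pieces between break points and piecewise smooth functions -/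

section Pieces

/-- `[a, b] ⊆ [0, 1]` is a nondegenerate interval without points of `P` in its interior. -/
structure IsPiece (P : Finset ℝ) (a b : ℝ) : Prop where
  nonneg : 0 ≤ a
  lt : a < b
  le_one : b ≤ 1
  free : ∀ τ ∈ P, τ ∉ Ioo a b

variable {P : Finset ℝ} {a b t : ℝ}

theorem IsPiece.subset (h : IsPiece P a b) : Icc a b ⊆ Icc (0 : ℝ) 1 :=
  Icc_subset_Icc h.nonneg h.le_one

theorem IsPiece.mono (h : IsPiece P a b) {a' b' : ℝ} (ha : a ≤ a') (hab : a' < b') (hb : b' ≤ b) :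
    IsPiece P a' b' :=
  ⟨h.nonneg.trans ha, hab, hb.trans h.le_one,
    fun τ hτ h' => h.free τ hτ ⟨ha.trans_lt h'.1, h'.2.trans_le hb⟩⟩

theorem exists_forall_mem_finset_abs_sub_lt (P : Finset ℝ) (t : ℝ) :
    ∃ δ > 0, ∀ τ ∈ P, |τ - t| < δ → τ = t := by
  have h : ((P.erase t : Finset ℝ) : Set ℝ)ᶜ ∈ 𝓝 t :=
    (P.erase t).finite_toSet.isClosed.isOpen_compl.mem_nhds (by simp)
  obtain ⟨δ, hδ, hb⟩ := Metric.mem_nhds_iff.1 h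
  refine ⟨δ, hδ, fun τ hτ hlt => ?_⟩
  by_contra hne
  exact hb (show τ ∈ Metric.ball t δ by simpa [Real.dist_eq] using hlt) (by simp [hτ, hne])

theorem exists_isPiece_right (P : Finset ℝ) (h0 : 0 ≤ t) (h1 : t < 1) : ∃ b, IsPiece P t b := by
  obtain ⟨δ, hδ, hP⟩ := exists_forall_mem_finset_abs_sub_lt P t
  refine ⟨min (t + δ) 1, h0, by simp [hδ, h1], min_le_right _ _, fun τ hτ h => ?_⟩
  have h2 := h.2.trans_le (min_le_left _ _)
  have := hP τ hτ (abs_lt.2 ⟨by linarith [h.1], by linarith⟩)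
  exact h.1.ne this.symm

theorem exists_isPiece_left (P : Finset ℝ) (h0 : 0 < t) (h1 : t ≤ 1) : ∃ a, IsPiece P a t := by
  obtain ⟨δ, hδ, hP⟩ := exists_forall_mem_finset_abs_sub_lt P t
  refine ⟨max (t - δ) 0, le_max_right _ _, by simp [hδ, h0], h1, fun τ hτ h => ?_⟩
  have h2 := (le_max_left _ _).trans_lt h.1
  have := hP τ hτ (abs_lt.2 ⟨by linarith, by linarith [h.2]⟩)
  exact h.2.ne this

theorem exists_isPiece_of_notMem (h0 : 0 < t) (h1 : t < 1) (ht : t ∉ P) :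
    ∃ a b, IsPiece P a b ∧ t ∈ Ioo a b := by
  obtain ⟨δ, hδ, hP⟩ := exists_forall_mem_finset_abs_sub_lt P t
  refine ⟨max (t - δ) 0, min (t + δ) 1, ⟨le_max_right _ _, ?_, min_le_right _ _,
    fun τ hτ h => ?_⟩, by simp [hδ, h0], by simp [hδ, h1]⟩
  · exact (show max (t - δ) 0 < t by simp [hδ, h0]).trans (by simp [hδ, h1])
  have h2 := h.2.trans_le (min_le_left _ _)
  have h3 := (le_max_left _ _).trans_lt h.1
  exact ht (hP τ hτ (abs_lt.2 ⟨by linarith, by linarith⟩) ▸ hτ)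

/-- A property of sets which holds for all pieces around `t` and is stable under unions holds for
some neighbourhood of `t` in `[0, 1]`. -/
theorem exists_mem_nhdsWithin_of_pieces {Q : Set ℝ → Prop} (P : Finset ℝ)
    (hU : ∀ A B, Q A → Q B → Q (A ∪ B)) (ht : t ∈ Icc (0 : ℝ) 1)
    (hQ : ∀ a b, IsPiece P a b → t ∈ Icc a b → Q (Icc a b)) :
    ∃ S ∈ 𝓝[Icc (0 : ℝ) 1] t, Q S := by
  -- At an interior time the pieces ending and starting at `t` together form a neighbourhood, even
  -- if `t` is a break point; at `0` and `1` one piece suffices.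
  rcases ht.1.eq_or_lt with h0 | h0
  · obtain ⟨b, hb⟩ := exists_isPiece_right P ht.1 (by linarith : t < 1)
    refine ⟨_, ?_, hQ t b hb ⟨le_rfl, hb.lt.le⟩⟩
    subst h0
    exact mem_nhdsWithin.2 ⟨Iio b, isOpen_Iio, hb.lt, fun x hx => ⟨hx.2.1, hx.1.le⟩⟩
  obtain ⟨a, ha⟩ := exists_isPiece_left P h0 ht.2
  rcases ht.2.eq_or_lt with h1 | h1
  · refine ⟨_, ?_, hQ a t ha ⟨ha.lt.le, le_rfl⟩⟩
    subst h1
    exact mem_nhdsWithin.2 ⟨Ioi a, isOpen_Ioi, ha.lt, fun x hx => ⟨hx.1.le, hx.2.2⟩⟩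
  obtain ⟨b, hb⟩ := exists_isPiece_right P ht.1 h1
  refine ⟨_, ?_, hU _ _ (hQ a t ha ⟨ha.lt.le, le_rfl⟩) (hQ t b hb ⟨le_rfl, hb.lt.le⟩)⟩
  rw [Icc_union_Icc_eq_Icc ha.lt.le hb.lt.le]
  exact mem_nhdsWithin_of_mem_nhds (Icc_mem_nhds ha.lt hb.lt)

variable {X F : Type*} [NormedAddCommGroup X] [NormedSpace ℝ X] [NormedAddCommGroup F]
  [NormedSpace ℝ F] {u : ℝ × X → F}

/-- `u(t, x)` is of class `C^k` on `[a, b] × X` for every piece `[a, b]` of `P`. -/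
def PiecewiseContDiff (P : Finset ℝ) (k : WithTop ℕ∞) (u : ℝ × X → F) : Prop :=
  ∀ a b, IsPiece P a b → ContDiffOn ℝ k u (Icc a b ×ˢ univ)

theorem PiecewiseContDiff.of_le {k l : WithTop ℕ∞} (h : PiecewiseContDiff P k u) (hl : l ≤ k) :
    PiecewiseContDiff P l u := fun a b hab => (h a b hab).of_le hl

theorem PiecewiseContDiff.continuousOn {k : WithTop ℕ∞} (h : PiecewiseContDiff P k u) :
    ContinuousOn u (Icc 0 1 ×ˢ univ) := by
  rintro ⟨t, x⟩ ⟨ht, -⟩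
  obtain ⟨S, hS, hQ⟩ := exists_mem_nhdsWithin_of_pieces
    (Q := fun S => ContinuousWithinAt u (S ×ˢ univ) (t, x)) P
    (fun A B hA hB => by rw [union_prod]; exact hA.union hB) ht
    (fun a b hab ht => (h a b hab).continuousOn (t, x) ⟨ht, mem_univ _⟩)
  refine hQ.mono_of_mem_nhdsWithin ?_
  rw [nhdsWithin_prod_eq]
  exact Filter.prod_mem_prod hS (by simp)

theorem uniqueDiffOn_Icc_prod_univ (hab : a < b) :
    UniqueDiffOn ℝ (Icc a b ×ˢ (univ : Set X)) :=
  (uniqueDiffOn_Icc hab).prod uniqueDiffOn_univ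

theorem ContDiffOn.hasFDerivAt_snd_of_prod_univ {I : Set ℝ} {x : X}
    {L : ℝ × X →L[ℝ] F} (h : HasFDerivWithinAt u L (I ×ˢ univ) (t, x)) (ht : t ∈ I) :
    HasFDerivAt (fun x => u (t, x)) (L.comp (ContinuousLinearMap.inr ℝ ℝ X)) x := by
  rw [← hasFDerivWithinAt_univ]
  exact h.comp x (hasFDerivAt_prodMk_right t x).hasFDerivWithinAt (fun y _ => ⟨ht, mem_univ _⟩)

/-- The partial derivative of `u(t, x)` in the direction `e` of the second variable. -/
noncomputable def partialSnd (u : ℝ × X → F) (e : X) (p : ℝ × X) : F :=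
  fderiv ℝ (fun x => u (p.1, x)) p.2 e

/-- Break points only obstruct regularity in `t`: in the second variable the function is
differentiable at every time, break times included. -/
theorem PiecewiseContDiff.hasFDerivAt {k : WithTop ℕ∞} (h : PiecewiseContDiff P k u) (hk : k ≠ 0)
    (ht : t ∈ Icc (0 : ℝ) 1) (x : X) : DifferentiableAt ℝ (fun x => u (t, x)) x := by
  obtain ⟨S, hS, hQ⟩ := exists_mem_nhdsWithin_of_pieces
    (Q := fun S => t ∈ S → DifferentiableAt ℝ (fun x => u (t, x)) x) P
    (fun A B hA hB h => h.elim hA hB) ht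
    (fun a b hab ht _ => (ContDiffOn.hasFDerivAt_snd_of_prod_univ
      ((h a b hab).differentiableOn hk (t, x) ⟨ht, mem_univ _⟩).hasFDerivWithinAt
      ht).differentiableAt)
  exact hQ (mem_of_mem_nhdsWithin ht hS)

theorem PiecewiseContDiff.partialSnd {k l : WithTop ℕ∞} (h : PiecewiseContDiff P k u)
    (hl : l + 1 ≤ k) (e : X) : PiecewiseContDiff P l (partialSnd u e) := by
  intro a b hab
  have h1 := (h a b hab).fderivWithin (uniqueDiffOn_Icc_prod_univ hab.lt) hl
  refine (h1.clm_apply contDiffOn_const (g := fun _ => ((0 : ℝ), e))).congr ?_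
  rintro ⟨t, x⟩ ⟨ht, -⟩
  have hk : k ≠ 0 := by
    rintro rfl
    simp at hl
  have h2 := ((h a b hab).differentiableOn hk (t, x) ⟨ht, mem_univ _⟩).hasFDerivWithinAt
  simp [_root_.partialSnd, (ContDiffOn.hasFDerivAt_snd_of_prod_univ h2 ht).fderiv]

/-- A function with partial derivatives of class `C^k` on `[a, b] × ℝ` is of class `C^{k+1}`. -/
theorem contDiffOn_succ_of_partial {k : ℕ} {u f g : ℝ × ℝ → F} (hab : a < b)
    (hf : ContDiffOn ℝ k f (Icc a b ×ˢ univ)) (hg : ContDiffOn ℝ k g (Icc a b ×ˢ univ))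
    (hut : ∀ t ∈ Icc a b, ∀ s, HasDerivWithinAt (fun t => u (t, s)) (f (t, s)) (Icc a b) t)
    (hus : ∀ t ∈ Icc a b, ∀ s, HasDerivAt (fun s => u (t, s)) (g (t, s)) s) :
    ContDiffOn ℝ (k + 1 : ℕ) u (Icc a b ×ˢ univ) := by
  push_cast
  rw [contDiffOn_succ_iff_hasFDerivWithinAt_of_uniqueDiffOn (uniqueDiffOn_Icc_prod_univ hab)]
  refine ⟨by simp, fun p => (ContinuousLinearMap.toSpanSingleton ℝ (f p)).coprod
    (ContinuousLinearMap.toSpanSingleton ℝ (g p)), ?_, ?_⟩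
  · have h1 : ContDiffOn ℝ k (fun p => ContinuousLinearMap.smulRightL ℝ (ℝ × ℝ) F
        (ContinuousLinearMap.fst ℝ ℝ ℝ) (f p) + ContinuousLinearMap.smulRightL ℝ (ℝ × ℝ) F
        (ContinuousLinearMap.snd ℝ ℝ ℝ) (g p)) (Icc a b ×ˢ univ) :=
      ((ContinuousLinearMap.contDiff _).comp_contDiffOn hf).add
        ((ContinuousLinearMap.contDiff _).comp_contDiffOn hg)
    refine h1.congr fun p _ => ?_
    ext <;> simp
  · rintro ⟨t, s⟩ ⟨ht, -⟩
    rw [hasFDerivWithinAt_iff_isLittleO]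
    have hc : ContinuousWithinAt g (Icc a b ×ˢ univ) (t, s) := hg.continuousOn _ ⟨ht, mem_univ _⟩
    -- The increment of `u` is split through `(p.1, s)`. The part in the second variable is
    -- uniformly small by the mean value inequality and continuity of `g`; the part in the first
    -- variable is differentiability at the single parameter `s`.
    have key : (fun p : ℝ × ℝ => u (p.1, p.2) - u (p.1, s) - (p.2 - s) • g (t, s))
        =o[𝓝[Icc a b ×ˢ univ] (t, s)] fun p => p.2 - s := by
      rw [Asymptotics.isLittleO_iff]
      intro ε hε
      obtain ⟨δ, hδ, hδε⟩ := Metric.continuousWithinAt_iff.1 hc ε hε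
      filter_upwards [eventually_mem_nhdsWithin,
        mem_nhdsWithin_of_mem_nhds (Metric.ball_mem_nhds _ hδ)] with p hp hpδ
      have hp1 : dist p.1 t < δ := (le_max_left _ _).trans_lt hpδ
      have hp2 : dist p.2 s < δ := (le_max_right _ _).trans_lt hpδ
      have := Convex.norm_image_sub_le_of_norm_hasDerivWithin_le (C := ε)
        (s := Metric.ball s δ) (f := fun x => u (p.1, x) - (x - s) • g (t, s))
        (f' := fun x => g (p.1, x) - (1 : ℝ) • g (t, s)) (x := s) (y := p.2)
        (fun x _ => ((hus _ hp.1 x).sub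
          (((hasDerivAt_id x).sub_const s).smul_const (g (t, s)))).hasDerivWithinAt)
        (fun x hx => by
          have := hδε (x := (p.1, x)) ⟨hp.1, mem_univ _⟩ (max_lt hp1 hx)
          rw [one_smul, ← dist_eq_norm]
          exact this.le)
        (convex_ball _ _) (Metric.mem_ball_self hδ) hp2
      refine le_trans (le_of_eq ?_) this
      congr 1
      simp
      abel
    have h1 := (hasFDerivWithinAt_iff_isLittleO.1 (hut t ht s).hasFDerivWithinAt).comp_tendsto
      (l' := 𝓝[Icc a b ×ˢ univ] (t, s)) (k := Prod.fst)
      (by rw [nhdsWithin_prod_eq]; exact Filter.tendsto_fst)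
    have hO1 : (fun p : ℝ × ℝ => p.2 - s) =O[𝓝[Icc a b ×ˢ univ] (t, s)] fun p => p - (t, s) :=
      Asymptotics.isBigO_of_le _ fun p => norm_snd_le (p - (t, s))
    have hO2 : (fun p : ℝ × ℝ => p.1 - t) =O[𝓝[Icc a b ×ˢ univ] (t, s)] fun p => p - (t, s) :=
      Asymptotics.isBigO_of_le _ fun p => norm_fst_le (p - (t, s))
    refine ((key.trans_isBigO hO1).add (h1.trans_isBigO hO2)).congr_left fun p => ?_
    simp
    abel

end Pieces

/-! ### Scalar differential equations with a parameter -/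

section ParametricODE

/-- The retraction of `ℝ` onto `[0, 1]`. -/
noncomputable def clamp (t : ℝ) : ℝ := max 0 (min t 1)

theorem continuous_clamp : Continuous clamp := by unfold clamp; fun_prop

theorem clamp_mem (t : ℝ) : clamp t ∈ Icc (0 : ℝ) 1 := ⟨le_max_left _ _, by simp [clamp]⟩

theorem clamp_of_mem {t : ℝ} (ht : t ∈ Icc (0 : ℝ) 1) : clamp t = t := by
  simp [clamp, ht.1, ht.2]

theorem ContinuousOn.comp_clamp {X F : Type*} [TopologicalSpace X] [TopologicalSpace F]
    {u : ℝ × X → F} (h : ContinuousOn u (Icc 0 1 ×ˢ univ)) :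
    Continuous fun p : ℝ × X => u (clamp p.1, p.2) :=
  h.comp_continuous ((continuous_clamp.comp continuous_fst).prodMk continuous_snd)
    fun _ => ⟨clamp_mem _, mem_univ _⟩

/-- The primitive `(t, s) ↦ ∫₀ᵗ u(τ, s) dτ`. -/
noncomputable def primitive (u : ℝ × ℝ → ℝ) (p : ℝ × ℝ) : ℝ :=
  ∫ τ in (0 : ℝ)..p.1, u (clamp τ, p.2)

theorem continuous_primitive {u : ℝ × ℝ → ℝ} (h : ContinuousOn u (Icc 0 1 ×ˢ univ)) :
    Continuous (primitive u) := by
  have h1 : Continuous (Function.uncurry fun (p : ℝ × ℝ) τ => u (clamp τ, p.2)) :=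
    h.comp_clamp.comp (continuous_snd.prodMk (continuous_snd.comp continuous_fst))
  exact intervalIntegral.continuous_parametric_intervalIntegral_of_continuous h1 continuous_fst

theorem hasDerivWithinAt_primitive {u : ℝ × ℝ → ℝ} (h : ContinuousOn u (Icc 0 1 ×ˢ univ))
    {S : Set ℝ} {t : ℝ} (ht : t ∈ Icc (0 : ℝ) 1) (s : ℝ) :
    HasDerivWithinAt (fun t => primitive u (t, s)) (u (t, s)) S t := by
  have hc : Continuous fun τ => u (clamp τ, s) :=
    h.comp_clamp.comp (continuous_id.prodMk continuous_const)
  have := (hc.integral_hasStrictDerivAt 0 t).hasDerivAt.hasDerivWithinAt (s := S)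
  rwa [clamp_of_mem ht] at this

theorem hasDerivAt_intervalIntegral_of_continuous {f f' : ℝ × ℝ → ℝ} {a b s : ℝ}
    (hf : Continuous f) (hf' : Continuous f')
    (hd : ∀ t s, HasDerivAt (fun s => f (t, s)) (f' (t, s)) s) :
    HasDerivAt (fun s => ∫ t in a..b, f (t, s)) (∫ t in a..b, f' (t, s)) s := by
  obtain ⟨C, hC⟩ := ((isCompact_uIcc (a := a) (b := b)).prod
    (isCompact_closedBall s 1)).exists_bound_of_continuousOn hf'.continuousOn
  refine (intervalIntegral.hasDerivAt_integral_of_dominated_loc_of_deriv_le (bound := fun _ => C)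
    (F := fun s t => f (t, s)) (F' := fun s t => f' (t, s))
    (Metric.closedBall_mem_nhds s one_pos) ?_ ?_ ?_ ?_ ?_ ?_).2
  · exact .of_forall fun x => (hf.comp (by fun_prop : Continuous fun t : ℝ => (t, x))).aestronglyMeasurable
  · exact (hf.comp (by fun_prop : Continuous fun t : ℝ => (t, s))).intervalIntegrable _ _
  · exact (hf'.comp (by fun_prop : Continuous fun t : ℝ => (t, s))).aestronglyMeasurable
  · exact .of_forall fun t ht x hx => hC (t, x) ⟨uIoc_subset_uIcc ht, hx⟩
  · exact intervalIntegrable_const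
  · exact .of_forall fun t _ x _ => hd t x

/-- Induction on `k`: the `t`-derivative of the primitive is `u` itself, and its `s`-derivative is
the primitive of `∂_s u`, which has one derivative less and is covered by the induction hypothesis.
-/
theorem PiecewiseContDiff.primitive {P : Finset ℝ} {k : ℕ} {u : ℝ × ℝ → ℝ}
    (h : PiecewiseContDiff P k u) : PiecewiseContDiff P k (primitive u) := by
  induction k generalizing u with
  | zero => exact fun a b _ => contDiffOn_zero.2 (continuous_primitive h.continuousOn).continuousOn
  | succ k ih =>
    intro a b hab
    have h1 : PiecewiseContDiff P k (_root_.partialSnd u (1 : ℝ)) :=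
      h.partialSnd (by push_cast; exact le_rfl) 1
    refine contDiffOn_succ_of_partial hab.lt ((h.of_le (by simp)) a b hab) (ih h1 a b hab)
      (fun t ht s => hasDerivWithinAt_primitive h.continuousOn (hab.subset ht) s)
      (fun t ht s => ?_)
    exact hasDerivAt_intervalIntegral_of_continuous (f := fun p => u (clamp p.1, p.2))
      (f' := fun p => _root_.partialSnd u (1 : ℝ) (clamp p.1, p.2)) h.continuousOn.comp_clamp
      h1.continuousOn.comp_clamp
      fun t s => (h.hasFDerivAt (by simp) (clamp_mem t) s).hasFDerivAt.hasDerivAt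

/-- Variation of constants for a scalar linear equation. -/
theorem eq_exp_mul_integral_of_hasDerivWithinAt {a b d : ℝ → ℝ} (ha : Continuous a)
    (hb : Continuous b) (h0 : d 0 = 0)
    (hd : ∀ t ∈ Icc (0 : ℝ) 1, HasDerivWithinAt d (a t * d t + b t) (Icc 0 1) t) :
    ∀ t ∈ Icc (0 : ℝ) 1, d t = Real.exp (∫ τ in (0 : ℝ)..t, a τ) *
      ∫ τ in (0 : ℝ)..t, Real.exp (-∫ σ in (0 : ℝ)..τ, a σ) * b τ := by
  have hA : ∀ t, HasDerivAt (fun t => ∫ τ in (0 : ℝ)..t, a τ) (a t) t :=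
    fun t => (ha.integral_hasStrictDerivAt 0 t).hasDerivAt
  have hAc : Continuous fun t => ∫ τ in (0 : ℝ)..t, a τ :=
    continuous_iff_continuousAt.2 fun t => (hA t).continuousAt
  have hB : ∀ t, HasDerivAt (fun t => ∫ τ in (0 : ℝ)..t, Real.exp (-∫ σ in (0 : ℝ)..τ, a σ) * b τ)
      (Real.exp (-∫ σ in (0 : ℝ)..t, a σ) * b t) t :=
    fun t => ((Continuous.integral_hasStrictDerivAt (by fun_prop) 0 t)).hasDerivAt
  -- With the integrating factor `exp (-∫ a)`, the quantity that should be constant has zero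
  -- derivative.
  have hy : ∀ t ∈ Icc (0 : ℝ) 1, HasDerivWithinAt (fun t => Real.exp (-∫ σ in (0 : ℝ)..t, a σ) * d t -
      ∫ τ in (0 : ℝ)..t, Real.exp (-∫ σ in (0 : ℝ)..τ, a σ) * b τ) 0 (Icc 0 1) t := by
    intro t ht
    convert! (((hA t).neg.exp.hasDerivWithinAt).mul (hd t ht)).sub (hB t).hasDerivWithinAt using 1
    simp only [Pi.neg_apply]
    ring
  intro t ht
  have := constant_of_derivWithin_zero (fun t ht => (hy t ht).differentiableWithinAt)
    (fun t ht => (hy t (Ico_subset_Icc_self ht)).derivWithin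
      (uniqueDiffOn_Icc one_pos t (Ico_subset_Icc_self ht))) t ht
  simp only [intervalIntegral.integral_same, neg_zero, Real.exp_zero, h0, mul_zero, sub_zero,
    sub_eq_zero] at this
  rw [← this, ← mul_assoc, ← Real.exp_add]
  simp

/-- Hadamard's lemma for a `C¹` function of two real variables. -/
theorem sub_eq_integral_partial {g : ℝ × ℝ → ℝ} (hg : ∀ x, DifferentiableAt ℝ g x)
    (h1 : Continuous fun x => fderiv ℝ g x (1, 0)) (h2 : Continuous fun x => fderiv ℝ g x (0, 1))
    (s s' w w' : ℝ) :
    g (s', w') - g (s, w) =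
      (w' - w) * (∫ θ in (0 : ℝ)..1, fderiv ℝ g (s + θ * (s' - s), w + θ * (w' - w)) (0, 1)) +
      (s' - s) * ∫ θ in (0 : ℝ)..1, fderiv ℝ g (s + θ * (s' - s), w + θ * (w' - w)) (1, 0) := by
  have hc : Continuous fun θ : ℝ => (s + θ * (s' - s), w + θ * (w' - w)) := by fun_prop
  have hd : ∀ θ : ℝ, HasDerivAt (fun θ : ℝ => g (s + θ * (s' - s), w + θ * (w' - w)))
      ((w' - w) * fderiv ℝ g (s + θ * (s' - s), w + θ * (w' - w)) (0, 1) +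
      (s' - s) * fderiv ℝ g (s + θ * (s' - s), w + θ * (w' - w)) (1, 0)) θ := by
    intro θ
    have hl : HasDerivAt (fun θ : ℝ => (s + θ * (s' - s), w + θ * (w' - w))) (s' - s, w' - w) θ := by
      have e1 := ((hasDerivAt_id θ).mul_const (s' - s)).const_add s
      have e2 := ((hasDerivAt_id θ).mul_const (w' - w)).const_add w
      simpa using e1.prodMk e2
    convert! (hg _).hasFDerivAt.comp_hasDerivAt θ hl using 1
    have : ((s' - s, w' - w) : ℝ × ℝ) = (w' - w) • (0, 1) + (s' - s) • (1, 0) := by simp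
    rw [this, map_add, map_smul, map_smul]
    simp
  have hi1 : IntervalIntegrable (fun θ : ℝ => fderiv ℝ g (s + θ * (s' - s), w + θ * (w' - w)) (1, 0))
    volume 0 1 := (h1.comp hc).intervalIntegrable 0 1
  have hi2 : IntervalIntegrable (fun θ : ℝ => fderiv ℝ g (s + θ * (s' - s), w + θ * (w' - w)) (0, 1))
    volume 0 1 := (h2.comp hc).intervalIntegrable 0 1
  have := intervalIntegral.integral_eq_sub_of_hasDerivAt (a := 0) (b := 1) (fun θ _ => hd θ)
    ((hi2.const_mul _).add (hi1.const_mul _))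
  rw [intervalIntegral.integral_add (hi2.const_mul _) (hi1.const_mul _),
    intervalIntegral.integral_const_mul, intervalIntegral.integral_const_mul] at this
  simpa using this.symm

end ParametricODE

section ParametricODE

/-- Global solvability on `[0, 1]` of a scalar equation with bounded, Lipschitz right hand side. -/
theorem exists_solution_of_bounded {f : ℝ → ℝ → ℝ} {K : ℝ}
    (hc : ∀ w, ContinuousOn (fun t => f t w) (Icc 0 1))
    (hd : ∀ t ∈ Icc (0 : ℝ) 1, ∀ w, DifferentiableAt ℝ (f t) w)
    (hK : ∀ t ∈ Icc (0 : ℝ) 1, ∀ w, |f t w| ≤ K ∧ |deriv (f t) w| ≤ K) :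
    ∃ w : ℝ → ℝ, w 0 = 0 ∧
      ∀ t ∈ Icc (0 : ℝ) 1, HasDerivWithinAt w (f t (w t)) (Icc 0 1) t := by
  have hK0 : 0 ≤ K := (abs_nonneg _).trans (hK 0 (by simp) 0).1
  lift K to NNReal using hK0
  -- Speed at most `K` during unit time keeps the solution in the ball of radius `K` around `0`, so
  -- a single Picard–Lindelöf step covers all of `[0, 1]`. The same `K` is the Lipschitz constant.
  have : IsPicardLindelof f (tmin := 0) (tmax := 1) ⟨0, by simp⟩ 0 K 0 K K :=
    { lipschitzOnWith := fun t ht => (lipschitzWith_of_nnnorm_deriv_le (hd t ht)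
        fun w => (hK t ht w).2).lipschitzOnWith
      continuousOn := fun w _ => hc w
      norm_le := fun t ht w _ => (hK t ht w).1
      mul_max_le := by simp }
  exact this.exists_eq_forall_mem_Icc_hasDerivWithinAt₀

variable {P : Finset ℝ} {G : ℝ × ℝ × ℝ → ℝ}

/-- The averaged partial derivative in Hadamard's lemma, along the curves `W s` and `W s'`. -/
noncomputable def averagedPartial (g : ℝ × ℝ × ℝ → ℝ) (W : ℝ → ℝ → ℝ) (s s' t : ℝ) : ℝ :=
  ∫ θ in (0 : ℝ)..1, g (clamp t, s + θ * (s' - s),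
    W s (clamp t) + θ * (W s' (clamp t) - W s (clamp t)))

/-- The difference quotient of a family of solutions, as given by variation of constants. -/
noncomputable def solutionSlope (a b : ℝ → ℝ → ℝ → ℝ) (s s' t : ℝ) : ℝ :=
  Real.exp (∫ τ in (0 : ℝ)..t, a s s' τ) *
    ∫ τ in (0 : ℝ)..t, Real.exp (-∫ σ in (0 : ℝ)..τ, a s s' σ) * b s s' τ

theorem continuous_averagedPartial {g : ℝ × ℝ × ℝ → ℝ} (hg : ContinuousOn g (Icc 0 1 ×ˢ univ))
    {W : ℝ → ℝ → ℝ} (s s' : ℝ) (hs : ContinuousOn (W s) (Icc 0 1))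
    (hs' : ContinuousOn (W s') (Icc 0 1)) : Continuous (averagedPartial g W s s') := by
  have h1 : Continuous fun t => W s (clamp t) := hs.comp_continuous continuous_clamp clamp_mem
  have h2 : Continuous fun t => W s' (clamp t) := hs'.comp_continuous continuous_clamp clamp_mem
  have h3 : Continuous (Function.uncurry fun t θ : ℝ => g (clamp t, s + θ * (s' - s),
      W s (clamp t) + θ * (W s' (clamp t) - W s (clamp t)))) :=
    hg.comp_clamp.comp (continuous_fst.prodMk ((by fun_prop : Continuous fun p : ℝ × ℝ =>
      s + p.2 * (s' - s)).prodMk ((h1.comp continuous_fst).add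
        (continuous_snd.mul ((h2.comp continuous_fst).sub (h1.comp continuous_fst))))))
  exact intervalIntegral.continuous_parametric_intervalIntegral_of_continuous' h3 0 1

theorem continuous_averagedPartial_uncurry {g : ℝ × ℝ × ℝ → ℝ}
    (hg : ContinuousOn g (Icc 0 1 ×ˢ univ)) {W : ℝ → ℝ → ℝ}
    (hW : Continuous fun p : ℝ × ℝ => W p.1 (clamp p.2)) :
    Continuous fun p : ℝ × ℝ × ℝ => averagedPartial g W p.1 p.2.1 p.2.2 := by
  have h1 : Continuous fun p : (ℝ × ℝ × ℝ) × ℝ => W p.1.1 (clamp p.1.2.2) :=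
    hW.comp (by fun_prop : Continuous fun p : (ℝ × ℝ × ℝ) × ℝ => (p.1.1, p.1.2.2))
  have h2 : Continuous fun p : (ℝ × ℝ × ℝ) × ℝ => W p.1.2.1 (clamp p.1.2.2) :=
    hW.comp (by fun_prop : Continuous fun p : (ℝ × ℝ × ℝ) × ℝ => (p.1.2.1, p.1.2.2))
  have h3 : Continuous (Function.uncurry fun (q : ℝ × ℝ × ℝ) (θ : ℝ) =>
      g (clamp q.2.2, q.1 + θ * (q.2.1 - q.1),
        W q.1 (clamp q.2.2) + θ * (W q.2.1 (clamp q.2.2) - W q.1 (clamp q.2.2)))) :=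
    hg.comp_clamp.comp ((by fun_prop : Continuous fun p : (ℝ × ℝ × ℝ) × ℝ => p.1.2.2).prodMk
      ((by fun_prop : Continuous fun p : (ℝ × ℝ × ℝ) × ℝ =>
        p.1.1 + p.2 * (p.1.2.1 - p.1.1)).prodMk (h1.add (continuous_snd.mul (h2.sub h1)))))
  exact intervalIntegral.continuous_parametric_intervalIntegral_of_continuous' h3 0 1

/-- Continuity up to the diagonal `s = s'` is the point: it makes the difference quotients converge
to the diagonal value, which is then the derivative in the parameter. -/
theorem continuous_solutionSlope {a b : ℝ → ℝ → ℝ → ℝ}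
    (ha : Continuous fun p : ℝ × ℝ × ℝ => a p.1 p.2.1 p.2.2)
    (hb : Continuous fun p : ℝ × ℝ × ℝ => b p.1 p.2.1 p.2.2) :
    Continuous fun p : ℝ × ℝ × ℝ => solutionSlope a b p.1 p.2.1 p.2.2 := by
  have hA : Continuous fun p : ℝ × ℝ × ℝ => ∫ σ in (0 : ℝ)..p.2.2, a p.1 p.2.1 σ :=
    intervalIntegral.continuous_parametric_intervalIntegral_of_continuous
      (f := fun (p : ℝ × ℝ × ℝ) σ => a p.1 p.2.1 σ)
      (ha.comp (by fun_prop : Continuous fun p : (ℝ × ℝ × ℝ) × ℝ => (p.1.1, p.1.2.1, p.2)))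
      (continuous_snd.comp continuous_snd)
  have hB : Continuous fun p : ℝ × ℝ × ℝ =>
      Real.exp (-∫ σ in (0 : ℝ)..p.2.2, a p.1 p.2.1 σ) * b p.1 p.2.1 p.2.2 := by fun_prop
  refine (Real.continuous_exp.comp hA).mul ?_
  exact intervalIntegral.continuous_parametric_intervalIntegral_of_continuous
      (f := fun (p : ℝ × ℝ × ℝ) τ => Real.exp (-∫ σ in (0 : ℝ)..τ, a p.1 p.2.1 σ) * b p.1 p.2.1 τ)
      (hB.comp (by fun_prop : Continuous fun p : (ℝ × ℝ × ℝ) × ℝ => (p.1.1, p.1.2.1, p.2)))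
      (continuous_snd.comp continuous_snd)

theorem abs_integral_le_of_abs_le {f : ℝ → ℝ} {K t : ℝ} (ht : t ∈ Icc (0 : ℝ) 1)
    (hf : ∀ τ ∈ Icc (0 : ℝ) 1, |f τ| ≤ K) : |∫ τ in (0 : ℝ)..t, f τ| ≤ K := by
  have hK : 0 ≤ K := (abs_nonneg _).trans (hf 0 (by simp))
  have := intervalIntegral.norm_integral_le_of_norm_le_const (a := 0) (b := t) (f := f) (C := K)
    fun τ hτ => hf τ (by rw [uIoc_of_le ht.1] at hτ; exact ⟨hτ.1.le, hτ.2.trans ht.2⟩)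
  rw [Real.norm_eq_abs, sub_zero, abs_of_nonneg ht.1] at this
  exact this.trans (mul_le_of_le_one_right hK ht.2)

/-- This bound needs no joint continuity of the coefficients, so it can be used to prove that the
solutions depend continuously on the parameter in the first place. -/
theorem abs_solutionSlope_le {a b : ℝ → ℝ → ℝ → ℝ} {K s s' t : ℝ} (ht : t ∈ Icc (0 : ℝ) 1)
    (ha : ∀ τ ∈ Icc (0 : ℝ) 1, |a s s' τ| ≤ K) (hb : ∀ τ ∈ Icc (0 : ℝ) 1, |b s s' τ| ≤ K) :
    |solutionSlope a b s s' t| ≤ Real.exp K * (Real.exp K * K) := by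
  unfold solutionSlope
  rw [abs_mul, Real.abs_exp]
  refine mul_le_mul (Real.exp_le_exp.2 ((le_abs_self _).trans (abs_integral_le_of_abs_le ht ha)))
    (abs_integral_le_of_abs_le ht fun τ hτ => ?_) (abs_nonneg _) (Real.exp_pos _).le
  rw [abs_mul, Real.abs_exp]
  exact mul_le_mul (Real.exp_le_exp.2 ((neg_le_abs _).trans (abs_integral_le_of_abs_le hτ ha)))
    (hb τ hτ) (abs_nonneg _) (Real.exp_pos _).le

/-- The difference of two solutions. -/
theorem solution_sub_eq (hG : PiecewiseContDiff P ∞ G) {W : ℝ → ℝ → ℝ} (h0 : ∀ s, W s 0 = 0)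
    (hW : ∀ s, ∀ t ∈ Icc (0 : ℝ) 1, HasDerivWithinAt (W s) (G (t, s, W s t)) (Icc 0 1) t)
    (s s' : ℝ) {t : ℝ} (ht : t ∈ Icc (0 : ℝ) 1) :
    W s' t - W s t = (s' - s) * solutionSlope (averagedPartial (partialSnd G (0, 1)) W)
      (averagedPartial (partialSnd G (1, 0)) W) s s' t := by
  have hGs := (hG.partialSnd (l := 0) (by simp) (1, 0)).continuousOn
  have hGw := (hG.partialSnd (l := 0) (by simp) (0, 1)).continuousOn
  have hWc : ∀ s, ContinuousOn (W s) (Icc 0 1) := fun s t ht => (hW s t ht).continuousWithinAt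
  have ha := continuous_averagedPartial hGw s s' (hWc s) (hWc s')
  have hb := continuous_averagedPartial hGs s s' (hWc s) (hWc s')
  -- By Hadamard's lemma the difference of two solutions solves a linear equation `d' = a d + (s' -
  -- s) b`, with `a` and `b` the averaged partial derivatives.
  have := eq_exp_mul_integral_of_hasDerivWithinAt (d := fun t => W s' t - W s t) ha
    (hb.const_mul (s' - s)) (by simp [h0]) (fun t ht => by
      convert! (hW s' t ht).sub (hW s t ht) using 1
      have hslice : ∀ e : ℝ × ℝ, Continuous fun x => partialSnd G e (t, x) := fun e =>
        ((hG.partialSnd (l := 0) (by simp) e).continuousOn).comp_continuous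
          (continuous_const.prodMk continuous_id) fun x => ⟨ht, mem_univ _⟩
      rw [sub_eq_integral_partial (g := fun x => G (t, x))
        (fun x => hG.hasFDerivAt (by simp) ht x) (hslice (1, 0)) (hslice (0, 1))]
      simp only [averagedPartial, clamp_of_mem ht, partialSnd]
      ring) t ht
  rw [this]
  simp only [solutionSlope]
  simp only [mul_left_comm _ (s' - s)]
  rw [intervalIntegral.integral_const_mul, mul_left_comm]

/-- Smooth dependence of the solutions of a scalar differential equation on a parameter. -/
theorem exists_parametric_solution (hG : PiecewiseContDiff P ∞ G)
    (hb : ∀ R, ∃ K, ∀ t ∈ Icc (0 : ℝ) 1, ∀ s w, |s| ≤ R → |G (t, s, w)| ≤ K ∧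
      |partialSnd G (1, 0) (t, s, w)| ≤ K ∧ |partialSnd G (0, 1) (t, s, w)| ≤ K) :
    ∃ w : ℝ × ℝ → ℝ, PiecewiseContDiff P ∞ w ∧ (∀ s, w (0, s) = 0) ∧
      ∀ t ∈ Icc (0 : ℝ) 1, ∀ s,
        HasDerivWithinAt (fun t => w (t, s)) (G (t, s, w (t, s))) (Icc 0 1) t := by
  have hGc : ∀ s w, ContinuousOn (fun t => G (t, s, w)) (Icc 0 1) := fun s w =>
    hG.continuousOn.comp (f := fun t : ℝ => (t, s, w)) (by fun_prop) fun t ht => ⟨ht, mem_univ _⟩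
  have hGd : ∀ t ∈ Icc (0 : ℝ) 1, ∀ s w,
      HasDerivAt (fun w => G (t, s, w)) (partialSnd G (0, 1) (t, s, w)) w := fun t ht s w =>
    (hG.hasFDerivAt (by simp) ht (s, w)).hasFDerivAt.comp_hasDerivAt w
      ((hasDerivAt_const w s).prodMk (hasDerivAt_id w))
  have hex : ∀ s, ∃ w : ℝ → ℝ, w 0 = 0 ∧
      ∀ t ∈ Icc (0 : ℝ) 1, HasDerivWithinAt w (G (t, s, w t)) (Icc 0 1) t := by
    intro s
    obtain ⟨K, hK⟩ := hb |s|
    refine exists_solution_of_bounded (f := fun t w => G (t, s, w)) (K := K) (hGc s)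
      (fun t ht w => (hGd t ht s w).differentiableAt) fun t ht w => ⟨(hK t ht s w le_rfl).1, ?_⟩
    rw [(hGd t ht s w).deriv]
    exact (hK t ht s w le_rfl).2.2
  choose W h0 hW using hex
  have hWc : ∀ s, ContinuousOn (W s) (Icc 0 1) := fun s t ht => (hW s t ht).continuousWithinAt
  set a := averagedPartial (partialSnd G (0, 1)) W with ha_def
  set b := averagedPartial (partialSnd G (1, 0)) W with hb_def
  have hsub : ∀ s s' t, t ∈ Icc (0 : ℝ) 1 → W s' t - W s t = (s' - s) * solutionSlope a b s s' t :=
    fun s s' t ht => solution_sub_eq hG h0 hW s s' ht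
  -- Joint continuity: Lipschitz dependence on `s` near `s₀`, uniform in `t` by the a priori bound
  -- on the slope, combined with continuity in `t` of the single solution `W s₀`.
  have hWcont : Continuous fun p : ℝ × ℝ => W p.1 (clamp p.2) := by
    rw [continuous_iff_continuousAt]
    rintro ⟨s₀, t₀⟩
    obtain ⟨K, hK⟩ := hb (|s₀| + 1)
    have hbound : ∀ e : ℝ × ℝ, (∀ t ∈ Icc (0 : ℝ) 1, ∀ s w, |s| ≤ |s₀| + 1 →
        |partialSnd G e (t, s, w)| ≤ K) → ∀ s, |s - s₀| < 1 → ∀ τ ∈ Icc (0 : ℝ) 1,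
        |averagedPartial (partialSnd G e) W s₀ s τ| ≤ K := by
      intro e he s hs τ hτ
      refine abs_integral_le_of_abs_le (by simp) fun θ hθ => he _ (clamp_mem τ) _ _ ?_
      calc |s₀ + θ * (s - s₀)| ≤ |s₀| + |θ * (s - s₀)| := abs_add_le _ _
        _ ≤ |s₀| + 1 := by
          rw [abs_mul, abs_of_nonneg hθ.1]
          gcongr
          exact mul_le_one₀ hθ.2 (abs_nonneg _) hs.le
    have hlip : ∀ s t, |s - s₀| < 1 → t ∈ Icc (0 : ℝ) 1 →
        |W s t - W s₀ t| ≤ |s - s₀| * (Real.exp K * (Real.exp K * K)) := by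
      intro s t hs ht
      rw [hsub s₀ s t ht, abs_mul]
      gcongr
      exact abs_solutionSlope_le ht (hbound _ (fun t ht s w h => (hK t ht s w h).2.2) s hs)
        (hbound _ (fun t ht s w h => (hK t ht s w h).2.1) s hs)
    have h1 : Filter.Tendsto (fun p : ℝ × ℝ => W p.1 (clamp p.2) - W s₀ (clamp p.2))
        (𝓝 (s₀, t₀)) (𝓝 0) := by
      have hg : Filter.Tendsto (fun p : ℝ × ℝ => |p.1 - s₀| * (Real.exp K * (Real.exp K * K)))
          (𝓝 (s₀, t₀)) (𝓝 0) := by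
        have : Continuous fun p : ℝ × ℝ => |p.1 - s₀| * (Real.exp K * (Real.exp K * K)) := by
          fun_prop
        simpa using this.tendsto (s₀, t₀)
      refine squeeze_zero_norm' ?_ hg
      have : ∀ᶠ p : ℝ × ℝ in 𝓝 (s₀, t₀), |p.1 - s₀| < 1 := by
        have hc : Continuous fun p : ℝ × ℝ => |p.1 - s₀| := by fun_prop
        exact hc.continuousAt.eventually_lt continuousAt_const (by simp)
      filter_upwards [this] with p hp
      exact hlip _ _ hp (clamp_mem _)
    have h2 : Filter.Tendsto (fun p : ℝ × ℝ => W s₀ (clamp p.2)) (𝓝 (s₀, t₀))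
        (𝓝 (W s₀ (clamp t₀))) :=
      (((hWc s₀).comp_continuous continuous_clamp clamp_mem).comp continuous_snd).tendsto _
    simpa [ContinuousAt] using h1.add h2
  have hGs := hG.partialSnd (l := ∞) (by simp) (1, 0)
  have hGw := hG.partialSnd (l := ∞) (by simp) (0, 1)
  have hV := continuous_solutionSlope (continuous_averagedPartial_uncurry hGw.continuousOn hWcont)
    (continuous_averagedPartial_uncurry hGs.continuousOn hWcont)
  set w : ℝ × ℝ → ℝ := fun p => W p.2 p.1 with hw_def
  set A : ℝ × ℝ → ℝ := fun p => partialSnd G (0, 1) (p.1, p.2, w p) with hA_def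
  set B : ℝ × ℝ → ℝ := fun p => partialSnd G (1, 0) (p.1, p.2, w p) with hB_def
  set v : ℝ × ℝ → ℝ := fun p => Real.exp (primitive A p) *
    primitive (fun q => Real.exp (-primitive A q) * B q) p with hv_def
  -- On the diagonal the averages over `θ` have constant integrands and collapse to the partial
  -- derivatives of `G` along the solution.
  have hslope : ∀ t ∈ Icc (0 : ℝ) 1, ∀ s, solutionSlope a b s s t = v (t, s) := by
    intro t ht s
    simp only [hv_def, solutionSlope, primitive, hA_def, hB_def, ha_def, hb_def, averagedPartial,
      hw_def]
    simp only [sub_self, mul_zero, add_zero, intervalIntegral.integral_const, sub_zero, one_smul]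
    congr 1
    refine intervalIntegral.integral_congr fun τ hτ => ?_
    rw [uIcc_of_le ht.1] at hτ
    simp only [clamp_of_mem ⟨hτ.1, hτ.2.trans ht.2⟩]
  have hws : ∀ t ∈ Icc (0 : ℝ) 1, ∀ s, HasDerivAt (fun s => w (t, s)) (v (t, s)) s := by
    intro t ht s
    rw [hasDerivAt_iff_tendsto_slope, ← hslope t ht s]
    have h1 : Filter.Tendsto (fun s' => solutionSlope a b s s' t) (𝓝[≠] s)
        (𝓝 (solutionSlope a b s s t)) :=
      ((hV.comp (by fun_prop : Continuous fun s' : ℝ => (s, s', t))).tendsto s).mono_left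
        nhdsWithin_le_nhds
    refine h1.congr' ?_
    filter_upwards [self_mem_nhdsWithin] with s' hs'
    have hne : s' - s ≠ 0 := sub_ne_zero.2 hs'
    rw [slope_def_field]
    simp only [hw_def]
    rw [hsub s s' t ht]
    field_simp
  have hwt : ∀ t ∈ Icc (0 : ℝ) 1, ∀ s,
      HasDerivWithinAt (fun t => w (t, s)) (G (t, s, w (t, s))) (Icc 0 1) t :=
    fun t ht s => hW s t ht
  have hcomp : ∀ k : ℕ, ∀ g : ℝ × ℝ × ℝ → ℝ, PiecewiseContDiff P ∞ g → PiecewiseContDiff P k w →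
      PiecewiseContDiff P k fun p : ℝ × ℝ => g (p.1, p.2, w p) := by
    intro k g hg hk c d hcd
    exact ((hg c d hcd).of_le (by exact_mod_cast le_top)).comp
      (contDiffOn_fst.prodMk (contDiffOn_snd.prodMk (hk c d hcd)))
      fun p hp => ⟨hp.1, mem_univ _⟩
  have hvk : ∀ k : ℕ, PiecewiseContDiff P k w → PiecewiseContDiff P k v := by
    intro k hk
    have hA := (hcomp k _ hGw hk).primitive
    have hB : PiecewiseContDiff P k fun q => Real.exp (-primitive A q) * B q := fun c d hcd =>
      ((hA c d hcd).neg.exp).mul (hcomp k _ hGs hk c d hcd)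
    exact fun c d hcd => ((hA c d hcd).exp).mul (hB.primitive c d hcd)
  -- Bootstrap: if `w` is `C^k`, so are its `t`-derivative `G(t, s, w)` and its `s`-derivative `v`,
  -- an expression in primitives of functions of `w`; hence `w` is `C^{k+1}`.
  have hwk : ∀ k : ℕ, PiecewiseContDiff P k w := by
    intro k
    induction k with
    | zero =>
      intro c d hcd
      refine contDiffOn_zero.2 (ContinuousOn.congr (f := fun p : ℝ × ℝ => W p.2 (clamp p.1))
        (hWcont.comp continuous_swap).continuousOn fun p hp => ?_)
      simp only [hw_def, clamp_of_mem (hcd.subset hp.1)]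
    | succ k ih =>
      intro c d hcd
      exact contDiffOn_succ_of_partial hcd.lt (hcomp k G hG ih c d hcd) (hvk k ih c d hcd)
        (fun t ht s => (hwt t (hcd.subset ht) s).mono hcd.subset)
        fun t ht s => hws t (hcd.subset ht) s
  exact ⟨w, fun c d hcd => contDiffOn_infty.2 fun k => hwk k c d hcd, h0, hwt⟩

end ParametricODE

/-! ### Charts of the one-jet bundle and the contact form in them -/

namespace OneJet

variable {n : ℕ} {B : Type*} [TopologicalSpace B]
  [ChartedSpace (EuclideanSpace ℝ (Fin n)) B] [IsManifold (𝓡 n) ∞ B]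

theorem extChartAt_eq (y₀ : OneJet n B) : extChartAt (jetModel n) y₀ =
    (((trivializationAt (EuclideanSpace ℝ (Fin n) →L[ℝ] ℝ)
    (fun b : B => TangentSpace (𝓡 n) b →L[ℝ] ℝ) y₀.1.proj).toPartialEquiv ≫
        (extChartAt (𝓡 n) y₀.1.proj).prod (PartialEquiv.refl _))).prod (PartialEquiv.refl ℝ) := by
  rw [extChartAt_prod, FiberBundle.extChartAt, extChartAt_model_space_eq_id]

/-- The momentum coordinate is the covector composed with the inverse tangent trivialization; this
transposition is what makes `p dq` keep its form in every chart. -/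
theorem extChartAt_apply (y₀ y : OneJet n B) :
    extChartAt (jetModel n) y₀ y = ((extChartAt (𝓡 n) y₀.1.proj y.1.proj,
      (y.1.snd : EuclideanSpace ℝ (Fin n) →L[ℝ] ℝ).comp
        ((trivializationAt (EuclideanSpace ℝ (Fin n)) (TangentSpace (𝓡 n)) y₀.1.proj).symmL ℝ
          y.1.proj)), y.2) := by
  rw [extChartAt_eq]
  refine Prod.ext (Prod.ext rfl ?_) rfl
  show ContinuousLinearMap.inCoordinates _ _ _ _ _ _ _ _ _ = _
  rw [ContinuousLinearMap.inCoordinates]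
  ext v
  simp

/-- Chart domains are full preimages under `π_B`, so changing `p` or `z` never leaves them; the
height correction relies on this. -/
theorem mem_extChartAt_source_iff (y₀ y : OneJet n B) :
    y ∈ (extChartAt (jetModel n) y₀).source ↔ y.1.proj ∈ (extChartAt (𝓡 n) y₀.1.proj).source := by
  rw [extChartAt_source, extChartAt_source, prodChartedSpace_chartAt]
  simp only [OpenPartialHomeomorph.prod_source, mem_prod, FiberBundle.chartedSpace_chartAt]
  simp only [OpenPartialHomeomorph.trans_source, Bundle.Trivialization.source_eq, mem_inter_iff,
    mem_preimage, chartAt_self_eq, OpenPartialHomeomorph.refl_source, mem_univ, and_true,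
    OpenPartialHomeomorph.prod_source, mem_prod]
  exact ⟨fun h => h.2, fun h => ⟨⟨h, mem_univ _⟩, h⟩⟩

theorem extChartAt_target_eq (y₀ : OneJet n B) :
    (extChartAt (jetModel n) y₀).target =
      ((extChartAt (𝓡 n) y₀.1.proj).target ×ˢ univ) ×ˢ univ := by
  have : (extChartAt (𝓡 n) y₀.1.proj).target ∩ (extChartAt (𝓡 n) y₀.1.proj).symm ⁻¹'
      (trivializationAt (EuclideanSpace ℝ (Fin n) →L[ℝ] ℝ)
        (fun b : B => TangentSpace (𝓡 n) b →L[ℝ] ℝ) y₀.1.proj).baseSet =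
      (extChartAt (𝓡 n) y₀.1.proj).target := by
    refine inter_eq_left.2 fun e he => ?_
    have := (extChartAt (𝓡 n) y₀.1.proj).map_target he
    simpa [extChartAt_source] using this
  rw [← this, ← FiberBundle.extChartAt_target, extChartAt_prod, PartialEquiv.prod_target,
    extChartAt_model_space_eq_id]
  rfl

theorem extChartAt_symm_base (y₀ : OneJet n B) {e : JetVec n}
    (he : e ∈ (extChartAt (jetModel n) y₀).target) :
    base ((extChartAt (jetModel n) y₀).symm e) = (extChartAt (𝓡 n) y₀.1.proj).symm e.1.1 := by
  have h := extChartAt_apply y₀ ((extChartAt (jetModel n) y₀).symm e)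
  rw [(extChartAt (jetModel n) y₀).right_inv he] at h
  have hs := (mem_extChartAt_source_iff y₀ _).1 ((extChartAt (jetModel n) y₀).map_target he)
  rw [congrArg (fun e : JetVec n => e.1.1) h]
  exact ((extChartAt (𝓡 n) y₀.1.proj).left_inv hs).symm

theorem extChartAt_symm_height (y₀ : OneJet n B) {e : JetVec n}
    (he : e ∈ (extChartAt (jetModel n) y₀).target) :
    height ((extChartAt (jetModel n) y₀).symm e) = e.2 := by
  have h := extChartAt_apply y₀ ((extChartAt (jetModel n) y₀).symm e)
  rw [(extChartAt (jetModel n) y₀).right_inv he] at h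
  exact (congrArg (fun e : JetVec n => e.2) h).symm

theorem contMDiff_base : ContMDiff (jetModel n) (𝓡 n) ∞ (base (n := n) (B := B)) :=
  (Bundle.contMDiff_proj (fun b : B => TangentSpace (𝓡 n) b →L[ℝ] ℝ)).comp contMDiff_fst

theorem contMDiff_height : ContMDiff (jetModel n) 𝓘(ℝ, ℝ) ∞ (height (n := n) (B := B)) :=
  contMDiff_snd

theorem contactForm_eq {y : OneJet n B} {dz : JetVec n →L[ℝ] ℝ}
    {dq : JetVec n →L[ℝ] EuclideanSpace ℝ (Fin n)}
    (hz : HasMFDerivAt (jetModel n) 𝓘(ℝ, ℝ) (height (n := n) (B := B)) y dz)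
    (hq : HasMFDerivAt (jetModel n) (𝓡 n) (base (n := n) (B := B)) y dq) (v : JetVec n) :
    contactForm y v = dz v - (y.1.snd : EuclideanSpace ℝ (Fin n) →L[ℝ] ℝ) (dq v) := by
  unfold contactForm
  rw [hz.mfderiv, hq.mfderiv]
  rfl

/-- In every chart of `J¹B` the contact form is `dz - p dq`. -/
theorem contactFormInChart_apply (y₀ : OneJet n B) {e : JetVec n}
    (he : e ∈ (extChartAt (jetModel n) y₀).target) (v : JetVec n) :
    contactFormInChart y₀ e v = v.2 - e.1.2 v.1.1 := by
  set φ := extChartAt (jetModel n) y₀ with hφ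
  have hnhds : φ.target ∈ 𝓝 e := (isOpen_extChartAt_target y₀).mem_nhds he
  have hφs : MDifferentiableAt 𝓘(ℝ, JetVec n) (jetModel n) φ.symm e :=
    ((contMDiffOn_extChartAt_symm (n := ∞) y₀).contMDiffAt hnhds).mdifferentiableAt (by simp)
  have hb := (contMDiff_base (n := n) (B := B)).mdifferentiable (by simp) (φ.symm e)
  have hh := (contMDiff_height (n := n) (B := B)).mdifferentiable (by simp) (φ.symm e)
  obtain ⟨A, hA⟩ : ∃ A : JetVec n →L[ℝ] JetVec n,
    HasMFDerivAt 𝓘(ℝ, JetVec n) (jetModel n) φ.symm e A := ⟨_, hφs.hasMFDerivAt⟩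
  obtain ⟨dz, hz⟩ : ∃ dz : JetVec n →L[ℝ] ℝ,
    HasMFDerivAt (jetModel n) 𝓘(ℝ, ℝ) (height (n := n) (B := B)) (φ.symm e) dz :=
      ⟨_, hh.hasMFDerivAt⟩
  obtain ⟨dq, hq⟩ : ∃ dq : JetVec n →L[ℝ] EuclideanSpace ℝ (Fin n),
    HasMFDerivAt (jetModel n) (𝓡 n) (base (n := n) (B := B)) (φ.symm e) dq :=
      ⟨_, hb.hasMFDerivAt⟩
  have he1 : e.1.1 ∈ (extChartAt (𝓡 n) y₀.1.proj).target := by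
    rw [hφ, extChartAt_target_eq] at he
    exact he.1.1
  have hnhds1 : (extChartAt (𝓡 n) y₀.1.proj).target ∈ 𝓝 e.1.1 :=
    (isOpen_extChartAt_target y₀.1.proj).mem_nhds he1
  have hψ : MDifferentiableAt 𝓘(ℝ, EuclideanSpace ℝ (Fin n)) (𝓡 n)
      (extChartAt (𝓡 n) y₀.1.proj).symm e.1.1 :=
    ((contMDiffOn_extChartAt_symm (n := ∞) y₀.1.proj).contMDiffAt hnhds1).mdifferentiableAt
      (by simp)
  obtain ⟨S, hS⟩ : ∃ S : EuclideanSpace ℝ (Fin n) →L[ℝ] EuclideanSpace ℝ (Fin n),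
    HasMFDerivAt 𝓘(ℝ, EuclideanSpace ℝ (Fin n)) (𝓡 n) (extChartAt (𝓡 n) y₀.1.proj).symm e.1.1 S :=
      ⟨_, hψ.hasMFDerivAt⟩
  -- The chart intertwines height and base projection with the coordinates, so the chain rule
  -- computes `dz` and `dq` on the image of the inverse chart's derivative `A`.
  have h1 : dz.comp A = ContinuousLinearMap.snd ℝ _ _ := by
    refine hasMFDerivAt_unique (hz.comp e hA) ?_
    exact (hasFDerivAt_snd (p := e)).hasMFDerivAt.congr_of_eventuallyEq
      (Filter.eventually_of_mem hnhds fun x hx => extChartAt_symm_height y₀ hx)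
  have h2 : dq.comp A = S.comp ((ContinuousLinearMap.fst ℝ _ _).comp
      (ContinuousLinearMap.fst ℝ _ _)) := by
    refine hasMFDerivAt_unique (hq.comp e hA) ?_
    have hf : HasFDerivAt (fun e : JetVec n => e.1.1) ((ContinuousLinearMap.fst ℝ _ _).comp
      (ContinuousLinearMap.fst ℝ _ _)) e := hasFDerivAt_fst.comp e hasFDerivAt_fst
    exact (HasMFDerivAt.comp e hS hf.hasMFDerivAt).congr_of_eventuallyEq
      (Filter.eventually_of_mem hnhds fun x hx => extChartAt_symm_base y₀ hx)
  have h := extChartAt_apply y₀ (φ.symm e)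
  rw [φ.right_inv he] at h
  have hs := (mem_extChartAt_source_iff y₀ _).1 (φ.map_target he)
  -- The inverse tangent trivialization is the derivative `S` of the inverse base chart. The
  -- momentum coordinate is therefore `p ∘ S`, and `p (dq (A v))` becomes that coordinate applied to
  -- `v.1.1`.
  have h3 : (trivializationAt (EuclideanSpace ℝ (Fin n)) (TangentSpace (𝓡 n)) y₀.1.proj).symmL ℝ
      (φ.symm e).1.proj = S := by
    rw [TangentBundle.symmL_trivializationAt (by rwa [← extChartAt_source (𝓡 n)])]
    have h4 : extChartAt (𝓡 n) y₀.1.proj (φ.symm e).1.proj = e.1.1 :=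
      (congrArg (fun e : JetVec n => e.1.1) h).symm
    rw [h4, ModelWithCorners.range_eq_univ, mfderivWithin_univ, hS.mfderiv]
  have h5 : e.1.2 = (φ.symm e).1.snd.comp S := by
    rw [← h3]
    exact congrArg (fun e : JetVec n => e.1.2) h
  have h6 : contactFormInChart y₀ e v = contactForm (φ.symm e) (A v) := by
    unfold contactFormInChart
    rw [hA.mfderiv]
    rfl
  rw [h6, contactForm_eq hz hq, h5]
  have e1 := DFunLike.congr_fun h1 v
  have e2 := DFunLike.congr_fun h2 v
  simp only [ContinuousLinearMap.comp_apply, ContinuousLinearMap.coe_snd'] at e1 e2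
  rw [e1, e2]
  rfl

end OneJet

/-! ### The two-form `dλ`, nondegeneracy and the contact Hamiltonian vector field -/

section Model

theorem fderiv_eq_of_eventuallyEq_add_const {V W : Type*} [NormedAddCommGroup V] [NormedSpace ℝ V]
    [NormedAddCommGroup W] [NormedSpace ℝ W] {f : V → W} {e : V} {L : V →L[ℝ] W} {c : W}
    (h : f =ᶠ[𝓝 e] fun e => L e + c) : fderiv ℝ f e = L := by
  rw [h.fderiv_eq]
  exact (L.hasFDerivAt.add_const c).fderiv

variable {E : Type*} [NormedAddCommGroup E] [NormedSpace ℝ E]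

/-- The one-form `-p dq` on `E × E* × ℝ`, as a linear function of the base point. -/
noncomputable def modelContactForm (E : Type*) [NormedAddCommGroup E] [NormedSpace ℝ E] :
    (E × (E →L[ℝ] ℝ)) × ℝ →L[ℝ] (E × (E →L[ℝ] ℝ)) × ℝ →L[ℝ] ℝ :=
  -((ContinuousLinearMap.compL ℝ ((E × (E →L[ℝ] ℝ)) × ℝ) E ℝ).flip
    ((ContinuousLinearMap.fst ℝ _ _).comp (ContinuousLinearMap.fst ℝ _ _))).comp
      ((ContinuousLinearMap.snd ℝ _ _).comp (ContinuousLinearMap.fst ℝ _ _))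

theorem fderiv_eq_modelContactForm {f : (E × (E →L[ℝ] ℝ)) × ℝ → (E × (E →L[ℝ] ℝ)) × ℝ →L[ℝ] ℝ}
    {e : (E × (E →L[ℝ] ℝ)) × ℝ} {c : (E × (E →L[ℝ] ℝ)) × ℝ →L[ℝ] ℝ}
    (h : f =ᶠ[𝓝 e] fun e => modelContactForm E e + c) (u v : (E × (E →L[ℝ] ℝ)) × ℝ) :
    fderiv ℝ f e u v = -u.1.2 v.1.1 := by
  have h1 := fderiv_eq_of_eventuallyEq_add_const (V := (E × (E →L[ℝ] ℝ)) × ℝ)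
    (W := (E × (E →L[ℝ] ℝ)) × ℝ →L[ℝ] ℝ) h
  exact congrArg (fun L : (E × (E →L[ℝ] ℝ)) × ℝ →L[ℝ] (E × (E →L[ℝ] ℝ)) × ℝ →L[ℝ] ℝ => L u v) h1

end Model

namespace OneJet

variable {n : ℕ} {B : Type*} [TopologicalSpace B]
  [ChartedSpace (EuclideanSpace ℝ (Fin n)) B] [IsManifold (𝓡 n) ∞ B]

/-- In the chart `λ = dz - p dq` is an affine function of the base point, so its derivative is the
constant linear part and only `dq ∧ dp` remains. -/
theorem dContactForm_apply (y : OneJet n B) (u v : JetVec n) :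
    dContactForm y u v = v.1.2 u.1.1 - u.1.2 v.1.1 := by
  have h : contactFormInChart y =ᶠ[𝓝 (extChartAt (jetModel n) y y)] fun e =>
      modelContactForm (EuclideanSpace ℝ (Fin n)) e + ContinuousLinearMap.snd ℝ _ _ := by
    filter_upwards [(isOpen_extChartAt_target y).mem_nhds (mem_extChartAt_target y)] with e he
    refine ContinuousLinearMap.ext fun v => ?_
    rw [contactFormInChart_apply y he]
    exact (neg_add_eq_sub _ _).symm
  have h2 : ∀ u v : JetVec n, fderiv ℝ (contactFormInChart y) (extChartAt (jetModel n) y y) u v =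
      -u.1.2 v.1.1 := fderiv_eq_modelContactForm h
  exact (congrArg₂ _ (h2 u v) (h2 v u)).trans (neg_sub_neg _ _)

theorem exists_hasMFDerivAt_extChartAt_symm {y₀ : OneJet n B} {e : JetVec n}
    (he : e ∈ (extChartAt (jetModel n) y₀).target) : ∃ A : JetVec n →L[ℝ] JetVec n,
    HasMFDerivAt 𝓘(ℝ, JetVec n) (jetModel n) (extChartAt (jetModel n) y₀).symm e A :=
  ⟨_, (((contMDiffOn_extChartAt_symm (n := ∞) y₀).contMDiffAt
    ((isOpen_extChartAt_target y₀).mem_nhds he)).mdifferentiableAt (by simp)).hasMFDerivAt⟩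

/-- A path with velocity `u` in a chart, as a path in `J¹B`. -/
theorem hasMFDerivWithinAt_of_chart {y₀ : OneJet n B} {c : ℝ → OneJet n B} {S : Set ℝ} {t : ℝ}
    {u : JetVec n} {A : JetVec n →L[ℝ] JetVec n} (hc : ContinuousWithinAt c S t)
    (hs : c t ∈ (extChartAt (jetModel n) y₀).source)
    (hA : HasMFDerivAt 𝓘(ℝ, JetVec n) (jetModel n) (extChartAt (jetModel n) y₀).symm
      (extChartAt (jetModel n) y₀ (c t)) A)
    (hu : HasDerivWithinAt (fun τ => extChartAt (jetModel n) y₀ (c τ)) u S t) :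
    HasMFDerivWithinAt 𝓘(ℝ, ℝ) (jetModel n) c S t
      (ContinuousLinearMap.toSpanSingleton ℝ (A u)) := by
  have h1 := hA.comp_hasMFDerivWithinAt t hu.hasFDerivWithinAt.hasMFDerivWithinAt
  have h2 : ∀ᶠ τ in 𝓝[S] t, c τ = ((extChartAt (jetModel n) y₀).symm ∘
      fun τ => extChartAt (jetModel n) y₀ (c τ)) τ := by
    filter_upwards [hc.eventually (extChartAt_source_mem_nhds' hs)] with τ hτ
    exact ((extChartAt (jetModel n) y₀).left_inv hτ).symm
  exact (congrArg (fun L : ℝ →L[ℝ] JetVec n => HasMFDerivWithinAt 𝓘(ℝ, ℝ) (jetModel n) c S t L)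
    (ContinuousLinearMap.comp_toSpanSingleton A u)).mp
    (h1.congr_of_eventuallyEq h2 ((extChartAt (jetModel n) y₀).left_inv hs).symm)

/-- The chart need not be the preferred one at `c t`, so a whole arc of a path can be treated in one
chart around `y₀`. -/
theorem contactForm_mfderivWithin {y₀ : OneJet n B} {c : ℝ → OneJet n B} {S : Set ℝ} {t : ℝ}
    {u : JetVec n} (hS : UniqueDiffWithinAt ℝ S t) (hc : ContinuousWithinAt c S t)
    (hs : c t ∈ (extChartAt (jetModel n) y₀).source)
    (hu : HasDerivWithinAt (fun τ => extChartAt (jetModel n) y₀ (c τ)) u S t) :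
    contactForm (c t) ((mfderivWithin 𝓘(ℝ, ℝ) (jetModel n) c S t : ℝ →L[ℝ] JetVec n) 1) =
      u.2 - (extChartAt (jetModel n) y₀ (c t)).1.2 u.1.1 := by
  obtain ⟨A, hA⟩ := exists_hasMFDerivAt_extChartAt_symm
    ((extChartAt (jetModel n) y₀).map_source hs)
  rw [(hasMFDerivWithinAt_of_chart hc hs hA hu).mfderivWithin hS.uniqueMDiffWithinAt]
  rw [← contactFormInChart_apply y₀ ((extChartAt (jetModel n) y₀).map_source hs)]
  unfold contactFormInChart
  rw [hA.mfderiv, (extChartAt (jetModel n) y₀).left_inv hs]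
  exact congrArg (contactForm (c t) : JetVec n →L[ℝ] ℝ) (one_smul ℝ _)

/-- The inverse of the preferred chart at `y` has the identity as derivative at the image of `y`, so
no transition map appears. -/
theorem contactForm_apply (y : OneJet n B) (v : JetVec n) :
    contactForm y v = v.2 - (extChartAt (jetModel n) y y).1.2 v.1.1 := by
  rw [← contactFormInChart_apply y (mem_extChartAt_target y)]
  unfold contactFormInChart
  have h := mfderivWithin_range_extChartAt_symm (I := jetModel n) (x := y)
  rw [ModelWithCorners.range_eq_univ, mfderivWithin_univ] at h
  rw [h, (extChartAt (jetModel n) y).left_inv (mem_extChartAt_source y)]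
  rfl

/-- The Hamiltonian in the chart around `y₀`. -/
noncomputable def hamInChart (H : ℝ → OneJet n B → ℝ) (y₀ : OneJet n B) (p : ℝ × JetVec n) : ℝ :=
  H p.1 ((extChartAt (jetModel n) y₀).symm p.2)

theorem contDiffOn_hamInChart {H : ℝ → OneJet n B → ℝ} (hH : IsSmoothHamiltonian H)
    (y₀ : OneJet n B) :
    ContDiffOn ℝ ∞ (hamInChart H y₀) (Icc 0 1 ×ˢ (extChartAt (jetModel n) y₀).target) := by
  rw [← contMDiffOn_iff_contDiffOn]
  have h1 : ContMDiffOn 𝓘(ℝ, ℝ × JetVec n) (𝓘(ℝ, ℝ).prod (jetModel n)) ∞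
      (fun p : ℝ × JetVec n => (p.1, (extChartAt (jetModel n) y₀).symm p.2))
      (Icc 0 1 ×ˢ (extChartAt (jetModel n) y₀).target) :=
    ContMDiffOn.prodMk contDiff_fst.contMDiff.contMDiffOn
      ((contMDiffOn_extChartAt_symm y₀).comp contDiff_snd.contMDiff.contMDiffOn fun p hp => hp.2)
  exact hH.comp h1 fun p hp => ⟨hp.1, mem_univ _⟩

theorem IsSmoothHamiltonian.contMDiff {H : ℝ → OneJet n B → ℝ} (hH : IsSmoothHamiltonian H)
    {t : ℝ} (ht : t ∈ Icc (0 : ℝ) 1) : ContMDiff (jetModel n) 𝓘(ℝ, ℝ) ∞ (H t) := by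
  rw [← contMDiffOn_univ]
  exact hH.comp (contMDiff_const.prodMk contMDiff_id).contMDiffOn fun y _ => ⟨ht, mem_univ _⟩

theorem dHam_eq_fderiv {H : ℝ → OneJet n B → ℝ} (hH : IsSmoothHamiltonian H)
    {t : ℝ} (ht : t ∈ Icc (0 : ℝ) 1) (y : OneJet n B) (v : JetVec n) :
    dHam H t y v = partialSnd (hamInChart H y) v (t, extChartAt (jetModel n) y y) := by
  have h := ((hH.contMDiff ht).mdifferentiable (by simp) y).mfderiv
  unfold dHam partialSnd
  rw [h, ModelWithCorners.range_eq_univ, fderivWithin_univ]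
  rfl

theorem eq_zero_of_forall_apply_eq_zero {a : EuclideanSpace ℝ (Fin n)}
    (h : ∀ p : EuclideanSpace ℝ (Fin n) →L[ℝ] ℝ, p a = 0) : a = 0 := by
  simpa using h (innerSL ℝ a)

/-- Reflexivity in finite dimension. It turns the momentum derivative of `H` into a base velocity.
-/
theorem exists_eval_eq (D : (EuclideanSpace ℝ (Fin n) →L[ℝ] ℝ) →L[ℝ] ℝ) :
    ∃ a : EuclideanSpace ℝ (Fin n), ∀ p, p a = D p := by
  let b := EuclideanSpace.basisFun (Fin n) ℝ
  refine ⟨∑ i, D (EuclideanSpace.proj i) • b i, fun p => ?_⟩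
  have hp : p = ∑ i, p (b i) • (EuclideanSpace.proj i : EuclideanSpace ℝ (Fin n) →L[ℝ] ℝ) := by
    ext q
    conv_lhs => rw [← b.sum_repr q, map_sum]
    simp [b, mul_comm]
  conv_rhs => rw [hp, map_sum]
  simp [mul_comm]

/-- Nondegeneracy of the contact form. -/
theorem eq_of_contactForm_eq {y : OneJet n B} {u v : JetVec n}
    (h1 : contactForm y u = contactForm y v)
    (h2 : ∀ w : JetVec n, dContactForm y u w = dContactForm y v w) : u = v := by
  have hq : u.1.1 = v.1.1 := by
    refine sub_eq_zero.1 (eq_zero_of_forall_apply_eq_zero fun p => ?_)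
    have := h2 ((0, p), 0)
    rw [dContactForm_apply, dContactForm_apply] at this
    simpa [sub_eq_zero] using this
  have hp : u.1.2 = v.1.2 := by
    ext1 q
    have := h2 ((q, 0), 0)
    rw [dContactForm_apply, dContactForm_apply] at this
    simpa using this
  rw [contactForm_apply, contactForm_apply, hq] at h1
  exact Prod.ext (Prod.ext hq hp) (by linarith)

theorem reeb_eq (y : OneJet n B) : reeb y = (((0, 0), 1) : JetVec n) := by
  have h0 : IsReebVector y (((0, 0), 1) : JetVec n) := by
    refine ⟨(contactForm_apply y _).trans (by simp), fun v => (dContactForm_apply y _ v).trans ?_⟩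
    simp
  have h : IsReebVector y (reeb y) := Classical.epsilon_spec ⟨_, h0⟩
  exact eq_of_contactForm_eq (h.1.trans h0.1.symm) fun w => (h.2 w).trans (h0.2 w).symm

theorem isContactHamiltonianVector_iff {H : ℝ → OneJet n B → ℝ} {t : ℝ} {y : OneJet n B}
    {D : JetVec n →L[ℝ] ℝ} (hD : dHam H t y = D) {u : JetVec n} :
    IsContactHamiltonianVector H t y u ↔
      u.2 - (extChartAt (jetModel n) y y).1.2 u.1.1 = -H t y ∧ ∀ v : JetVec n,
        v.1.2 u.1.1 - u.1.2 v.1.1 =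
          D v - D ((0, 0), 1) * (v.2 - (extChartAt (jetModel n) y y).1.2 v.1.1) := by
  unfold IsContactHamiltonianVector
  rw [hD, reeb_eq]
  refine and_congr ?_ (forall_congr' fun v => ?_)
  · rw [← contactForm_apply y u]
  · rw [← dContactForm_apply y u v, ← contactForm_apply y v]
    exact Iff.rfl

theorem isContactHamiltonianVector_contactHamiltonianVectorField (H : ℝ → OneJet n B → ℝ) (t : ℝ)
    (y : OneJet n B) :
    IsContactHamiltonianVector H t y (contactHamiltonianVectorField H t y) := by
  refine Classical.epsilon_spec (p := IsContactHamiltonianVector H t y) ?_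
  obtain ⟨D, hD⟩ : ∃ D : JetVec n →L[ℝ] ℝ, dHam H t y = D := ⟨_, rfl⟩
  -- The classical formula supplies the witness: `q̇ = ∂_p H`, `ṗ = -∂_q H - p ∂_z H`, `ż = p ∂_p H
  -- - H`, with `a = ∂_p H`.
  obtain ⟨a, ha⟩ := exists_eval_eq (D.comp ((ContinuousLinearMap.inl ℝ _ _).comp
    (ContinuousLinearMap.inr ℝ _ _)))
  set p := (extChartAt (jetModel n) y y).1.2 with hp
  refine ⟨((a, -(D.comp ((ContinuousLinearMap.inl ℝ _ _).comp (ContinuousLinearMap.inl ℝ _ _)) +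
    D ((0, 0), 1) • p)), p a - H t y), (isContactHamiltonianVector_iff hD).2 ⟨?_, fun v => ?_⟩⟩
  · simp [hp]
  · rw [← hp]
    obtain ⟨⟨q, r⟩, z⟩ := v
    have : D ((q, r), z) = D ((q, 0), 0) + D ((0, r), 0) + z * D ((0, 0), 1) := by
      rw [← smul_eq_mul, ← map_smul, ← map_add, ← map_add]
      simp
    rw [this]
    simp only [ha, ContinuousLinearMap.comp_apply, ContinuousLinearMap.inl_apply,
      ContinuousLinearMap.inr_apply, neg_apply, add_apply,
      smul_apply, smul_eq_mul]
    ring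

theorem IsContactHamiltonianVector.eq {H : ℝ → OneJet n B → ℝ} {t : ℝ} {y : OneJet n B}
    {u v : JetVec n} (hu : IsContactHamiltonianVector H t y u)
    (hv : IsContactHamiltonianVector H t y v) : u = v :=
  eq_of_contactForm_eq (hu.1.trans hv.1.symm) fun w => (hu.2 w).trans (hv.2 w).symm

end OneJet

/-! ### First variation of the horizontality constraint -/

section Model

variable {V : Type*} [NormedAddCommGroup V] [NormedSpace ℝ V]

theorem uniqueDiffOn_Ioo_prod_Icc {ε a b : ℝ} (hab : a < b) :
    UniqueDiffOn ℝ (Ioo (-ε) ε ×ˢ Icc a b) :=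
  isOpen_Ioo.uniqueDiffOn.prod (uniqueDiffOn_Icc hab)

theorem HasFDerivWithinAt.hasDerivAt_fst {f : ℝ × ℝ → V} {L : ℝ × ℝ →L[ℝ] V} {ε a b s t : ℝ}
    (h : HasFDerivWithinAt f L (Ioo (-ε) ε ×ˢ Icc a b) (s, t)) (hs : s ∈ Ioo (-ε) ε)
    (ht : t ∈ Icc a b) : HasDerivAt (fun s => f (s, t)) (L (1, 0)) s := by
  have h1 : HasDerivWithinAt (fun s => (s, t)) ((1 : ℝ), (0 : ℝ)) (Ioo (-ε) ε) s :=
    ((hasDerivAt_id s).prodMk (hasDerivAt_const s t)).hasDerivWithinAt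
  have hm : MapsTo (fun s => (s, t)) (Ioo (-ε) ε) (Ioo (-ε) ε ×ˢ Icc a b) := fun x hx => ⟨hx, ht⟩
  exact (h.comp_hasDerivWithinAt s h1 hm).hasDerivAt (isOpen_Ioo.mem_nhds hs)

theorem HasFDerivWithinAt.hasDerivWithinAt_snd {f : ℝ × ℝ → V} {L : ℝ × ℝ →L[ℝ] V} {ε a b s t : ℝ}
    (h : HasFDerivWithinAt f L (Ioo (-ε) ε ×ˢ Icc a b) (s, t)) (hs : s ∈ Ioo (-ε) ε) :
    HasDerivWithinAt (fun t => f (s, t)) (L (0, 1)) (Icc a b) t := by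
  have h1 : HasDerivWithinAt (fun t => (s, t)) ((0 : ℝ), (1 : ℝ)) (Icc a b) t :=
    ((hasDerivAt_const t s).prodMk (hasDerivAt_id t)).hasDerivWithinAt
  have hm : MapsTo (fun t => (s, t)) (Icc a b) (Ioo (-ε) ε ×ˢ Icc a b) := fun x hx => ⟨hs, hx⟩
  exact h.comp_hasDerivWithinAt t h1 hm

/-- Equality of mixed partial derivatives, up to the boundary. -/
theorem exists_mixed_partial {u : ℝ × ℝ → V} {ε a b t : ℝ} (hε : 0 < ε) (hab : a < b)
    (ht : t ∈ Icc a b) (hu : ContDiffOn ℝ ∞ u (Ioo (-ε) ε ×ˢ Icc a b)) :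
    ∃ M, HasDerivWithinAt (fun t => fderivWithin ℝ u (Ioo (-ε) ε ×ˢ Icc a b) (0, t) (1, 0)) M
        (Icc a b) t ∧
      HasDerivAt (fun s => fderivWithin ℝ u (Ioo (-ε) ε ×ˢ Icc a b) (s, t) (0, 1)) M 0 := by
  set D := Ioo (-ε) ε ×ˢ Icc a b with hD
  have h0 : (0 : ℝ) ∈ Ioo (-ε) ε := ⟨by linarith, hε⟩
  have hp : ((0 : ℝ), t) ∈ D := ⟨h0, ht⟩
  have hUD := uniqueDiffOn_Ioo_prod_Icc (ε := ε) hab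
  have h1 : ContDiffOn ℝ ∞ (fderivWithin ℝ u D) D := hu.fderivWithin hUD (by simp)
  have h2 := (h1.differentiableOn (by simp) _ hp).hasFDerivWithinAt
  -- Symmetry of the second derivative within `D` needs only a point in the closure of the interior,
  -- so it also holds at the end times `a` and `b`.
  have hcl : ((0 : ℝ), t) ∈ closure (interior D) := by
    rw [hD, interior_prod_eq, closure_prod_eq, interior_Icc, isOpen_Ioo.interior_eq,
      closure_Ioo hab.ne]
    exact ⟨subset_closure h0, ht⟩
  have hsymm : IsSymmSndFDerivWithinAt ℝ u D (0, t) :=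
    (hu _ hp).isSymmSndFDerivWithinAt (n := ∞) (by
      simp only [minSmoothness_of_isRCLikeNormedField]
      exact WithTop.coe_le_coe.2 (le_top (a := (2 : ℕ∞)))) hUD hcl hp
  refine ⟨fderivWithin ℝ (fderivWithin ℝ u D) D (0, t) (0, 1) (1, 0), ?_, ?_⟩
  · exact (h2.clm_apply (hasFDerivWithinAt_const ((1 : ℝ), (0 : ℝ)) _ D)).hasDerivWithinAt_snd h0
      |>.congr_deriv (by simp)
  · refine (h2.clm_apply (hasFDerivWithinAt_const ((0 : ℝ), (1 : ℝ)) _ D)).hasDerivAt_fst h0 ht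
      |>.congr_deriv ?_
    simpa using hsymm (1, 0) (0, 1)

variable {E : Type*} [NormedAddCommGroup E] [NormedSpace ℝ E]

theorem HasDerivWithinAt.model_contact {e v : ℝ → (E × (E →L[ℝ] ℝ)) × ℝ}
    {e' v' : (E × (E →L[ℝ] ℝ)) × ℝ} {S : Set ℝ} {t : ℝ} (he : HasDerivWithinAt e e' S t)
    (hv : HasDerivWithinAt v v' S t) :
    HasDerivWithinAt (fun t => (v t).2 - (e t).1.2 (v t).1.1)
      (v'.2 - (e'.1.2 (v t).1.1 + (e t).1.2 v'.1.1)) S t := by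
  have h1 : HasDerivWithinAt (fun t => (v t).2) v'.2 S t := hv.snd
  have h2 : HasDerivWithinAt (fun t => (v t).1.1) v'.1.1 S t := hv.fst.fst
  have h3 : HasDerivWithinAt (fun t => (e t).1.2) e'.1.2 S t := he.fst.snd
  exact h1.sub (h3.clm_apply h2)

/-- The first variation of the constraint `λ(u̇) + K(t, u) = 0` on the model space. -/
theorem hasDerivWithinAt_firstVariation {u : ℝ × ℝ → (E × (E →L[ℝ] ℝ)) × ℝ} {ε a b t : ℝ}
    (hε : 0 < ε) (hab : a < b) (ht : t ∈ Icc a b)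
    (hu : ContDiffOn ℝ ∞ u (Ioo (-ε) ε ×ˢ Icc a b)) {K : (E × (E →L[ℝ] ℝ)) × ℝ → ℝ}
    {dK : (E × (E →L[ℝ] ℝ)) × ℝ →L[ℝ] ℝ} (hK : HasFDerivAt K dK (u (0, t)))
    (hc : ∀ s ∈ Ioo (-ε) ε, (fderivWithin ℝ u (Ioo (-ε) ε ×ˢ Icc a b) (s, t) (0, 1)).2 -
      (u (s, t)).1.2 (fderivWithin ℝ u (Ioo (-ε) ε ×ˢ Icc a b) (s, t) (0, 1)).1.1 +
      K (u (s, t)) = 0)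
    {η τ : (E × (E →L[ℝ] ℝ)) × ℝ}
    (hη : fderivWithin ℝ u (Ioo (-ε) ε ×ˢ Icc a b) (0, t) (1, 0) = η)
    (hτ : fderivWithin ℝ u (Ioo (-ε) ε ×ˢ Icc a b) (0, t) (0, 1) = τ) :
    HasDerivWithinAt (fun t => (fderivWithin ℝ u (Ioo (-ε) ε ×ˢ Icc a b) (0, t) (1, 0)).2 -
      (u (0, t)).1.2 (fderivWithin ℝ u (Ioo (-ε) ε ×ˢ Icc a b) (0, t) (1, 0)).1.1)
      (η.1.2 τ.1.1 - τ.1.2 η.1.1 - dK η) (Icc a b) t := by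
  obtain ⟨M, hM1, hM2⟩ := exists_mixed_partial hε hab ht hu
  have h0 : (0 : ℝ) ∈ Ioo (-ε) ε := ⟨by linarith, hε⟩
  have hd := (hu.differentiableOn (by simp) (0, t) ⟨h0, ht⟩).hasFDerivWithinAt
  have hs := hd.hasDerivAt_fst h0 ht
  have ht' := hd.hasDerivWithinAt_snd h0
  rw [hη] at hs
  rw [hτ] at ht'
  -- The `t`-derivative of the pairing and the `s`-derivative of the constraint contain the mixed
  -- partial `M` through the same expression `dz M - p (dq M)`. Eliminating it leaves first-order
  -- terms only.
  have h1 := ht'.model_contact hM1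
  have h2 := ((hs.hasDerivWithinAt (s := univ)).model_contact
    (hM2.hasDerivWithinAt (s := univ))).add
    ((hK.comp_hasDerivAt (0 : ℝ) hs).hasDerivWithinAt (s := univ))
  rw [hasDerivWithinAt_univ] at h2
  have h3 : HasDerivAt (fun _ : ℝ => (0 : ℝ)) 0 0 := hasDerivAt_const _ _
  have h4 := h2.unique (h3.congr_of_eventuallyEq
    (Filter.eventually_of_mem (isOpen_Ioo.mem_nhds h0) hc))
  refine h1.congr_deriv ?_
  rw [hη]
  rw [hτ] at h4
  linarith

/-- A neighbourhood of `(0, t)` in `(-ε, ε) × [a, b]` contains a smaller box. -/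
theorem exists_box_subset {ε a b t : ℝ} (hε : 0 < ε) (hab : a < b) (ht : t ∈ Icc a b)
    {O : Set (ℝ × ℝ)} (hO : O ∈ 𝓝[Ioo (-ε) ε ×ˢ Icc a b] (0, t)) :
    ∃ ε' a' b', 0 < ε' ∧ ε' ≤ ε ∧ a ≤ a' ∧ a' < b' ∧ b' ≤ b ∧ t ∈ Icc a' b' ∧
      Ioo (-ε') ε' ×ˢ Icc a' b' ⊆ O ∧ Icc a' b' ∈ 𝓝[Icc a b] t := by
  obtain ⟨δ, hδ, hsub⟩ := Metric.mem_nhdsWithin_iff.1 hO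
  refine ⟨min ε δ, max a (t - δ / 2), min b (t + δ / 2), lt_min hε hδ, min_le_left _ _,
    le_max_left _ _, ?_, min_le_left _ _, ⟨max_le ht.1 (by linarith), le_min ht.2 (by linarith)⟩,
    ?_, ?_⟩
  · rcases ht.1.eq_or_lt with h | h
    · subst h
      exact max_lt (lt_min hab (by linarith)) (lt_min (by linarith) (by linarith))
    · exact max_lt (lt_min hab (by linarith)) (lt_min (by linarith [ht.2]) (by linarith))
  · rintro ⟨s, x⟩ ⟨hs, hx⟩
    have h1 := (le_max_left _ _).trans hx.1
    have h2 := (le_max_right _ _).trans hx.1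
    have h3 := hx.2.trans (min_le_left _ _)
    have h4 := hx.2.trans (min_le_right _ _)
    have h5 := hs.2.trans_le (min_le_left _ _)
    have h6 := hs.2.trans_le (min_le_right _ _)
    simp only at h1 h2 h3 h4 h5 h6
    refine hsub ⟨?_, ⟨by linarith [hs.1, min_le_left ε δ], h5⟩, h1, h3⟩
    rw [Metric.mem_ball, Prod.dist_eq, Real.dist_eq, Real.dist_eq]
    exact max_lt (abs_lt.2 ⟨by linarith [hs.1, min_le_right ε δ], by simpa using h6⟩)
      (abs_lt.2 ⟨by simp only; linarith, by simp only; linarith⟩)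
  · refine mem_nhdsWithin.2 ⟨Ioo (t - δ / 2) (t + δ / 2), isOpen_Ioo,
      ⟨by linarith, by linarith⟩, fun x hx => ?_⟩
    exact ⟨max_le hx.2.1 hx.1.1.le, le_min hx.2.2 hx.1.2.le⟩

end Model

namespace OneJet

variable {n : ℕ} {B : Type*} [TopologicalSpace B]
  [ChartedSpace (EuclideanSpace ℝ (Fin n)) B] [IsManifold (𝓡 n) ∞ B]

theorem contDiffOn_extChartAt_comp {V : Type*} [NormedAddCommGroup V] [NormedSpace ℝ V]
    {f : V → OneJet n B} {S : Set V} {y₀ : OneJet n B}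
    (hf : ContMDiffOn 𝓘(ℝ, V) (jetModel n) ∞ f S)
    (hS : MapsTo f S (extChartAt (jetModel n) y₀).source) :
    ContDiffOn ℝ ∞ (fun x => extChartAt (jetModel n) y₀ (f x)) S := by
  rw [← contMDiffOn_iff_contDiffOn]
  refine (contMDiffOn_extChartAt (x := y₀)).comp hf fun x hx => ?_
  rw [← extChartAt_source (jetModel n)]
  exact hS hx

theorem hamInChart_extChartAt (H : ℝ → OneJet n B → ℝ) {y₀ y : OneJet n B} (t : ℝ)
    (hy : y ∈ (extChartAt (jetModel n) y₀).source) :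
    hamInChart H y₀ (t, extChartAt (jetModel n) y₀ y) = H t y := by
  unfold hamInChart
  rw [(extChartAt (jetModel n) y₀).left_inv hy]

theorem hasFDerivAt_hamInChart {H : ℝ → OneJet n B → ℝ} (hH : IsSmoothHamiltonian H) {t : ℝ}
    (ht : t ∈ Icc (0 : ℝ) 1) (y₀ : OneJet n B) {e : JetVec n}
    (he : e ∈ (extChartAt (jetModel n) y₀).target) :
    HasFDerivAt (fun e => hamInChart H y₀ (t, e)) (fderiv ℝ (fun e => hamInChart H y₀ (t, e)) e)
      e := by
  have h1 : ContDiffOn ℝ ∞ (fun e => hamInChart H y₀ (t, e))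
      (extChartAt (jetModel n) y₀).target :=
    (contDiffOn_hamInChart hH y₀).comp (contDiff_const.prodMk contDiff_id).contDiffOn
      fun x hx => ⟨ht, hx⟩
  exact ((h1.contDiffAt ((isOpen_extChartAt_target y₀).mem_nhds he)).differentiableAt
    (by simp)).hasFDerivAt

/-- The horizontality constraint in a chart, up to the boundary of a piece. -/
theorem horizontal_in_chart {H : ℝ → OneJet n B → ℝ} (hH : IsSmoothHamiltonian H)
    {Γ : ℝ → ℝ → OneJet n B} {y₀ : OneJet n B} {ε a b : ℝ} (h0a : 0 ≤ a) (hab : a < b)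
    (hb1 : b ≤ 1) (hΓ : ContMDiffOn 𝓘(ℝ, ℝ × ℝ) (jetModel n) ∞ (fun p : ℝ × ℝ => Γ p.1 p.2)
      (Ioo (-ε) ε ×ˢ Icc a b))
    (hs : MapsTo (fun p : ℝ × ℝ => Γ p.1 p.2) (Ioo (-ε) ε ×ˢ Icc a b)
      (extChartAt (jetModel n) y₀).source)
    (hhor : ∀ s ∈ Ioo (-ε) ε, IsTranslatedHorizontal H (Γ s))
    {u : ℝ × ℝ → JetVec n} (hu : u = fun p => extChartAt (jetModel n) y₀ (Γ p.1 p.2))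
    {s t : ℝ} (hsε : s ∈ Ioo (-ε) ε) (ht : t ∈ Icc a b) :
    (fderivWithin ℝ u (Ioo (-ε) ε ×ˢ Icc a b) (s, t) (0, 1)).2 -
      (u (s, t)).1.2 (fderivWithin ℝ u (Ioo (-ε) ε ×ˢ Icc a b) (s, t) (0, 1)).1.1 +
      hamInChart H y₀ (t, u (s, t)) = 0 := by
  have huD : ContDiffOn ℝ ∞ u (Ioo (-ε) ε ×ˢ Icc a b) := hu ▸ contDiffOn_extChartAt_comp hΓ hs
  have hUD := uniqueDiffOn_Ioo_prod_Icc (ε := ε) hab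
  have hI : Icc a b ⊆ Icc (0 : ℝ) 1 := Icc_subset_Icc h0a hb1
  have hdu : ContDiffOn ℝ ∞ (fun t => fderivWithin ℝ u (Ioo (-ε) ε ×ˢ Icc a b) (s, t) (0, 1))
      (Icc a b) :=
    ((huD.fderivWithin (m := ∞) hUD (by simp)).clm_apply contDiffOn_const).comp
      (contDiff_const.prodMk contDiff_id).contDiffOn fun x hx => ⟨hsε, hx⟩
  have hut : ContDiffOn ℝ ∞ (fun t => u (s, t)) (Icc a b) :=
    huD.comp (contDiff_const.prodMk contDiff_id).contDiffOn fun x hx => ⟨hsε, hx⟩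
  have htar : ∀ t ∈ Icc a b, u (s, t) ∈ (extChartAt (jetModel n) y₀).target := fun t ht => by
    rw [hu]
    exact (extChartAt (jetModel n) y₀).map_source (hs (x := (s, t)) ⟨hsε, ht⟩)
  have hcont : ContinuousOn (fun t => (fderivWithin ℝ u (Ioo (-ε) ε ×ˢ Icc a b) (s, t) (0, 1)).2 -
      (u (s, t)).1.2 (fderivWithin ℝ u (Ioo (-ε) ε ×ˢ Icc a b) (s, t) (0, 1)).1.1 +
      hamInChart H y₀ (t, u (s, t))) (Icc a b) := by
    have h1 : ContinuousOn (fun t => hamInChart H y₀ (t, u (s, t))) (Icc a b) :=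
      (contDiffOn_hamInChart hH y₀).continuousOn.comp (continuousOn_id.prodMk hut.continuousOn)
        fun x hx => ⟨hI hx, htar x hx⟩
    have h2 := hdu.continuousOn
    have h3 := hut.continuousOn
    exact (h2.snd.sub (h3.fst.snd.clm_apply h2.fst.fst)).add h1
  -- The constraint is assumed only where the path is differentiable within `[0, 1]`. It is read off
  -- inside the piece and carried to the end points, which may be break points, by continuity.
  have hzero : EqOn (fun t => (fderivWithin ℝ u (Ioo (-ε) ε ×ˢ Icc a b) (s, t) (0, 1)).2 -
      (u (s, t)).1.2 (fderivWithin ℝ u (Ioo (-ε) ε ×ˢ Icc a b) (s, t) (0, 1)).1.1 +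
      hamInChart H y₀ (t, u (s, t))) (fun _ => 0) (Ioo a b) := by
    intro t ht
    have htI := Ioo_subset_Icc_self ht
    have hd := ((huD.differentiableOn (by simp) (s, t) ⟨hsε, htI⟩).hasFDerivWithinAt
      ).hasDerivWithinAt_snd hsε
    have hd1 : HasDerivWithinAt (fun t => extChartAt (jetModel n) y₀ (Γ s t))
        (fderivWithin ℝ u (Ioo (-ε) ε ×ˢ Icc a b) (s, t) (0, 1)) (Icc 0 1) t := by
      rw [hu] at hd ⊢
      exact (hd.hasDerivAt (Icc_mem_nhds ht.1 ht.2)).hasDerivWithinAt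
    have hc : ContinuousWithinAt (Γ s) (Icc 0 1) t := by
      have h1 : ContinuousWithinAt (Γ s) (Icc a b) t :=
        ContinuousWithinAt.comp (f := fun t => (s, t)) (g := fun p : ℝ × ℝ => Γ p.1 p.2)
          (hΓ.continuousOn (s, t) ⟨hsε, htI⟩) (by fun_prop) fun x hx => ⟨hsε, hx⟩
      exact (h1.continuousAt (Icc_mem_nhds ht.1 ht.2)).continuousWithinAt
    have hsrc := hs (x := (s, t)) ⟨hsε, htI⟩
    obtain ⟨A, hA⟩ := exists_hasMFDerivAt_extChartAt_symm
      ((extChartAt (jetModel n) y₀).map_source hsrc)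
    have h1 := hhor s hsε t (hI htI) (hasMFDerivWithinAt_of_chart hc hsrc hA hd1
      ).mdifferentiableWithinAt
    have h2 := contactForm_mfderivWithin (uniqueDiffOn_Icc one_pos t (hI htI)) hc hsrc hd1
    have h3 : hamInChart H y₀ (t, u (s, t)) = H t (Γ s t) := by
      rw [hu]
      exact hamInChart_extChartAt H t hsrc
    have h4 : u (s, t) = extChartAt (jetModel n) y₀ (Γ s t) := by rw [hu]
    simp only
    rw [h3, h4, ← h2]
    exact h1
  exact hzero.of_subset_closure hcont continuousOn_const Ioo_subset_Icc_self
    (by rw [closure_Ioo hab.ne]) ht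

/-- The pairing of the contact form with the variation field of `Γ` along `Γ 0`. -/
noncomputable def variationPairing (Γ : ℝ → ℝ → OneJet n B) (t : ℝ) : ℝ :=
  contactForm (Γ 0 t) ((mfderivWithin 𝓘(ℝ, ℝ) (jetModel n) (fun s => Γ s t) univ 0 :
    ℝ →L[ℝ] JetVec n) 1)

/-- The first variation formula. -/
theorem hasDerivWithinAt_variationPairing {H : ℝ → OneJet n B → ℝ} (hH : IsSmoothHamiltonian H)
    {Γ : ℝ → ℝ → OneJet n B} {y₀ : OneJet n B} {ε a b t : ℝ} (hε : 0 < ε) (h0a : 0 ≤ a) (hab : a < b)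
    (hb1 : b ≤ 1) (hΓ : ContMDiffOn 𝓘(ℝ, ℝ × ℝ) (jetModel n) ∞ (fun p : ℝ × ℝ => Γ p.1 p.2)
      (Ioo (-ε) ε ×ˢ Icc a b))
    (hhor : ∀ s ∈ Ioo (-ε) ε, IsTranslatedHorizontal H (Γ s)) (ht : t ∈ Icc a b)
    (hy : Γ 0 t ∈ (extChartAt (jetModel n) y₀).source)
    {τ : JetVec n} (hτ : HasDerivWithinAt (fun t' => extChartAt (jetModel n) y₀ (Γ 0 t')) τ
      (Icc a b) t) :
    ∃ η : JetVec n, HasDerivAt (fun s => extChartAt (jetModel n) y₀ (Γ s t)) η 0 ∧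
      variationPairing Γ t = η.2 - (extChartAt (jetModel n) y₀ (Γ 0 t)).1.2 η.1.1 ∧
      HasDerivWithinAt (variationPairing Γ) (η.1.2 τ.1.1 - τ.1.2 η.1.1 -
        fderiv ℝ (fun e => hamInChart H y₀ (t, e)) (extChartAt (jetModel n) y₀ (Γ 0 t)) η)
        (Icc a b) t := by
  set φ := extChartAt (jetModel n) y₀ with hφ
  have h0 : (0 : ℝ) ∈ Ioo (-ε) ε := ⟨by linarith, hε⟩
  -- The box is shrunk until the whole family stays in the chart around `y₀`; the derivative at `t`
  -- within `[a, b]` depends only on times near `t`.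
  obtain ⟨ε', a', b', hε', hεε', haa', hab', hbb', ht', hsub, hnhds⟩ :=
    exists_box_subset hε hab ht (O := (fun p : ℝ × ℝ => Γ p.1 p.2) ⁻¹' φ.source)
      ((hΓ.continuousOn (0, t) ⟨h0, ht⟩).preimage_mem_nhdsWithin (extChartAt_source_mem_nhds' hy))
  have h0' : (0 : ℝ) ∈ Ioo (-ε') ε' := ⟨by linarith, hε'⟩
  have hII : Ioo (-ε') ε' ⊆ Ioo (-ε) ε := Ioo_subset_Ioo (by linarith) hεε'
  have hΓ' := hΓ.mono (prod_mono hII (Icc_subset_Icc haa' hbb'))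
  obtain ⟨u, hu⟩ : ∃ u : ℝ × ℝ → JetVec n, u = fun p => φ (Γ p.1 p.2) := ⟨_, rfl⟩
  have huD : ContDiffOn ℝ ∞ u (Ioo (-ε') ε' ×ˢ Icc a' b') :=
    hu ▸ contDiffOn_extChartAt_comp hΓ' hsub
  have h01 : t ∈ Icc (0 : ℝ) 1 := ⟨h0a.trans ht.1, ht.2.trans hb1⟩
  have hu0 : u (0, t) = φ (Γ 0 t) := by rw [hu]
  have hpair : ∀ x ∈ Icc a' b', variationPairing Γ x =
      (fderivWithin ℝ u (Ioo (-ε') ε' ×ˢ Icc a' b') (0, x) (1, 0)).2 -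
      (u (0, x)).1.2 (fderivWithin ℝ u (Ioo (-ε') ε' ×ˢ Icc a' b') (0, x) (1, 0)).1.1 := by
    intro x hx
    have hd := ((huD.differentiableOn (by simp) (0, x) ⟨h0', hx⟩).hasFDerivWithinAt
      ).hasDerivAt_fst h0' hx
    have hc : ContinuousWithinAt (fun s => Γ s x) univ 0 := by
      have h1 : ContinuousWithinAt (fun s => Γ s x) (Ioo (-ε') ε') 0 :=
        ContinuousWithinAt.comp (f := fun s => (s, x)) (g := fun p : ℝ × ℝ => Γ p.1 p.2)
          (hΓ'.continuousOn (0, x) ⟨h0', hx⟩) (by fun_prop) fun s hs => ⟨hs, hx⟩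
      exact (h1.continuousAt (isOpen_Ioo.mem_nhds h0')).continuousWithinAt
    have hd1 : HasDerivWithinAt (fun s => φ (Γ s x))
        (fderivWithin ℝ u (Ioo (-ε') ε' ×ˢ Icc a' b') (0, x) (1, 0)) univ 0 := by
      rw [hu] at hd ⊢
      exact hd.hasDerivWithinAt
    have h4 : u (0, x) = φ (Γ 0 x) := by rw [hu]
    rw [h4]
    exact contactForm_mfderivWithin (c := fun s => Γ s x) uniqueDiffWithinAt_univ hc
      (hsub (a := ((0 : ℝ), x)) ⟨h0', hx⟩) hd1
  have hτ' : fderivWithin ℝ u (Ioo (-ε') ε' ×ˢ Icc a' b') (0, t) (0, 1) = τ := by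
    have hd := ((huD.differentiableOn (by simp) (0, t) ⟨h0', ht'⟩).hasFDerivWithinAt
      ).hasDerivWithinAt_snd h0'
    rw [hu] at hd ⊢
    exact (uniqueDiffOn_Icc hab' t ht').eq_deriv _ hd (hτ.mono (Icc_subset_Icc haa' hbb'))
  have hK := hasFDerivAt_hamInChart hH h01 y₀ (e := u (0, t))
    (hu0 ▸ φ.map_source hy)
  refine ⟨fderivWithin ℝ u (Ioo (-ε') ε' ×ˢ Icc a' b') (0, t) (1, 0), ?_, ?_, ?_⟩
  · have hd := ((huD.differentiableOn (by simp) (0, t) ⟨h0', ht'⟩).hasFDerivWithinAt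
      ).hasDerivAt_fst h0' ht'
    rw [hu] at hd ⊢
    exact hd
  · rw [hpair t ht', hu0]
  · have h1 := hasDerivWithinAt_firstVariation hε' hab' ht' huD hK
      (fun s hs => horizontal_in_chart hH (h0a.trans haa') hab' (hbb'.trans hb1) hΓ' hsub
        (fun s hs => hhor s (hII hs)) hu hs ht') rfl hτ'
    have h2 := (h1.congr (fun x hx => hpair x hx) (hpair t ht')).mono_of_mem_nhdsWithin hnhds
    refine h2.congr_deriv ?_
    rw [hu0]

end OneJet

/-! ### Action, boundary values of the pairing, and chords as critical points -/

namespace OneJet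

variable {n : ℕ} {B : Type*} [TopologicalSpace B]
  [ChartedSpace (EuclideanSpace ℝ (Fin n)) B] [IsManifold (𝓡 n) ∞ B]

/-- The coefficient `R[H]` is the same intrinsic `z`-derivative in every chart, so one linear
equation for the pairing holds along the whole path although charts change. -/
theorem fderiv_hamInChart_vertical {H : ℝ → OneJet n B → ℝ} (hH : IsSmoothHamiltonian H) {t : ℝ}
    (ht : t ∈ Icc (0 : ℝ) 1) {y₀ y : OneJet n B} (hy : y ∈ (extChartAt (jetModel n) y₀).source) :
    fderiv ℝ (fun e => hamInChart H y₀ (t, e)) (extChartAt (jetModel n) y₀ y) ((0, 0), 1) =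
      deriv (fun r => H t (y.1, r)) y.2 := by
  set φ := extChartAt (jetModel n) y₀ with hφ
  have h1 : ∀ r, φ (y.1, r) = ((φ y).1, r) := fun r => by
    rw [hφ, extChartAt_apply, extChartAt_apply]
  have h2 : (fun r => H t (y.1, r)) = fun r => hamInChart H y₀ (t, ((φ y).1, r)) := by
    funext r
    rw [← h1, hφ, hamInChart_extChartAt H t ((mem_extChartAt_source_iff y₀ (y.1, r)).2
      ((mem_extChartAt_source_iff y₀ y).1 hy))]
  have h3 := hasFDerivAt_hamInChart hH ht y₀ (φ.map_source hy)
  have h4 : ((φ y).1, y.2) = φ y := (h1 y.2).symm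
  have h5 : HasDerivAt (fun r : ℝ => ((φ y).1, r))
      (((0, 0), 1) : JetVec n) y.2 := (hasDerivAt_const _ _).prodMk (hasDerivAt_id _)
  rw [← h4] at h3
  have h6 : HasDerivAt (fun r => hamInChart H y₀ (t, ((φ y).1, r))) _ y.2 :=
    h3.comp_hasDerivAt y.2 h5
  rw [h2, h6.deriv, h4]

theorem IsPath.exists_pieces {c : PathClass} {γ : ℝ → OneJet n B} (h : IsPath c γ) :
    ∃ P : Finset ℝ, c.AllowsBreaks P ∧
      ∀ a b, IsPiece P a b → ContMDiffOn 𝓘(ℝ, ℝ) (jetModel n) ∞ γ (Icc a b) := by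
  obtain ⟨P, hP, h⟩ := h
  exact ⟨P, hP, fun a b hab => h a b hab.nonneg hab.lt hab.le_one hab.free⟩

theorem continuousOn_of_pieces {X : Type*} [TopologicalSpace X] {P : Finset ℝ} {f : ℝ → X}
    (h : ∀ a b, IsPiece P a b → ContinuousOn f (Icc a b)) : ContinuousOn f (Icc 0 1) := by
  intro t ht
  obtain ⟨S, hS, hQ⟩ := exists_mem_nhdsWithin_of_pieces
    (Q := fun S => ContinuousWithinAt f S t) P (fun A B hA hB => hA.union hB) ht
    (fun a b hab ht => h a b hab t ht)
  exact hQ.mono_of_mem_nhdsWithin hS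

/-- The Hamiltonian along the vertical lines through a path. -/
theorem piecewiseContDiff_ham_vertical {H : ℝ → OneJet n B → ℝ} (hH : IsSmoothHamiltonian H)
    {γ : ℝ → OneJet n B} {P : Finset ℝ}
    (hγ : ∀ a b, IsPiece P a b → ContMDiffOn 𝓘(ℝ, ℝ) (jetModel n) ∞ γ (Icc a b)) :
    PiecewiseContDiff P ∞ fun p : ℝ × ℝ => H p.1 ((γ p.1).1, p.2) := by
  intro a b hab
  rw [← contMDiffOn_iff_contDiffOn]
  have h1 : ContMDiffOn 𝓘(ℝ, ℝ × ℝ) (jetModel n) ∞ (fun p : ℝ × ℝ => γ p.1) (Icc a b ×ˢ univ) :=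
    (hγ a b hab).comp contDiff_fst.contMDiff.contMDiffOn fun p hp => hp.1
  have h2 : ContMDiffOn 𝓘(ℝ, ℝ × ℝ) (𝓘(ℝ, ℝ).prod (jetModel n)) ∞
      (fun p : ℝ × ℝ => (p.1, ((γ p.1).1, p.2))) (Icc a b ×ˢ univ) :=
    ContMDiffOn.prodMk contDiff_fst.contMDiff.contMDiffOn
      (ContMDiffOn.prodMk (contMDiff_fst.comp_contMDiffOn h1) contDiff_snd.contMDiff.contMDiffOn)
  exact hH.comp h2 fun p hp => ⟨hab.subset hp.1, mem_univ _⟩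

theorem continuousOn_deriv_vertical {H : ℝ → OneJet n B → ℝ} (hH : IsSmoothHamiltonian H)
    {γ : ℝ → OneJet n B} {P : Finset ℝ}
    (hγ : ∀ a b, IsPiece P a b → ContMDiffOn 𝓘(ℝ, ℝ) (jetModel n) ∞ γ (Icc a b)) :
    ContinuousOn (fun t => deriv (fun r => H t ((γ t).1, r)) (γ t).2) (Icc 0 1) := by
  have h1 := ((piecewiseContDiff_ham_vertical hH hγ).partialSnd (l := 0) (by simp) 1).continuousOn
  have h2 : ContinuousOn (fun t => (γ t).2) (Icc 0 1) :=
    continuousOn_of_pieces fun a b hab => continuous_snd.comp_continuousOn (hγ a b hab).continuousOn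
  exact h1.comp (continuousOn_id.prodMk h2) fun t ht => ⟨ht, mem_univ _⟩

/-- Off the finitely many break points the bracket in the integrand is zero, so the integral
vanishes whatever the conformal weight is. -/
theorem effectiveAction_eq_height {c : PathClass} {H : ℝ → OneJet n B → ℝ} {γ : ℝ → OneJet n B}
    (hγ : γ ∈ carnotPathSpace c H) : effectiveAction H γ = height (γ 1) := by
  obtain ⟨P, -, hP⟩ := hγ.1.exists_pieces
  have h0 : perturbedAction H γ = 0 := by
    refine intervalIntegral.integral_zero_ae ?_
    have hnull : ∀ᵐ t : ℝ, t ∉ insert 1 P :=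
      (measure_eq_zero_iff_ae_notMem).1 ((insert 1 P).finite_toSet.measure_zero _)
    filter_upwards [hnull] with t ht hI
    rw [uIoc_of_le zero_le_one] at hI
    simp only [Finset.mem_insert, not_or] at ht
    obtain ⟨a, b, hab, htab⟩ := exists_isPiece_of_notMem hI.1 (lt_of_le_of_ne hI.2 ht.1) ht.2
    have hd : MDifferentiableWithinAt 𝓘(ℝ, ℝ) (jetModel n) γ (Icc 0 1) t :=
      (((hP a b hab).contMDiffAt (Icc_mem_nhds htab.1 htab.2)).mdifferentiableAt
        (by simp)).mdifferentiableWithinAt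
    rw [hγ.2 t ⟨hI.1.le, hI.2⟩ hd, mul_zero]
  rw [effectiveAction, h0, neg_zero, zero_add]

theorem IsVariation.exists_pieces {c : PathClass} {ε : ℝ} {Γ : ℝ → ℝ → OneJet n B}
    (h : IsVariation c ε Γ) : ∃ P : Finset ℝ, ∀ a b, IsPiece P a b →
      ContMDiffOn 𝓘(ℝ, ℝ × ℝ) (jetModel n) ∞ (fun p : ℝ × ℝ => Γ p.1 p.2)
        (Ioo (-ε) ε ×ˢ Icc a b) := by
  obtain ⟨P, -, h⟩ := h
  exact ⟨P, fun a b hab => h a b hab.nonneg hab.lt hab.le_one hab.free⟩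

theorem exists_hasDerivAt_chart {c : ℝ → OneJet n B} {ε : ℝ} (hε : 0 < ε)
    (hc : ContMDiffOn 𝓘(ℝ, ℝ) (jetModel n) ∞ c (Ioo (-ε) ε)) :
    ∃ u : JetVec n, HasDerivAt (fun s => extChartAt (jetModel n) (c 0) (c s)) u 0 ∧
      contactForm (c 0) ((mfderivWithin 𝓘(ℝ, ℝ) (jetModel n) c univ 0 : ℝ →L[ℝ] JetVec n) 1) =
        u.2 - (extChartAt (jetModel n) (c 0) (c 0)).1.2 u.1.1 := by
  have h0 : Ioo (-ε) ε ∈ 𝓝 (0 : ℝ) := Ioo_mem_nhds (by linarith) hε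
  have hc0 := hc.contMDiffAt h0
  have h1 : MDifferentiableAt 𝓘(ℝ, ℝ) 𝓘(ℝ, JetVec n) (extChartAt (jetModel n) (c 0) ∘ c) 0 :=
    MDifferentiableAt.comp (0 : ℝ) ((contMDiffAt_extChartAt (n := ∞)).mdifferentiableAt (by simp))
      (hc0.mdifferentiableAt (by simp))
  have h2 := h1.differentiableAt.hasDerivAt
  exact ⟨_, h2, contactForm_mfderivWithin uniqueDiffWithinAt_univ
    hc0.continuousAt.continuousWithinAt (mem_extChartAt_source _) h2.hasDerivWithinAt⟩

/-- The zero section is Legendrian: along it `p = 0` and the height is constant. -/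
theorem variationPairing_eq_zero_of_zeroSection {Γ : ℝ → ℝ → OneJet n B} {ε t : ℝ} (hε : 0 < ε)
    (hc : ContMDiffOn 𝓘(ℝ, ℝ) (jetModel n) ∞ (fun s => Γ s t) (Ioo (-ε) ε))
    (hz : ∀ s ∈ Ioo (-ε) ε, Γ s t ∈ zeroSection n B) : variationPairing Γ t = 0 := by
  obtain ⟨u, hu, hL⟩ := exists_hasDerivAt_chart hε hc
  have h0 : Ioo (-ε) ε ∈ 𝓝 (0 : ℝ) := Ioo_mem_nhds (by linarith) hε
  rw [variationPairing, hL]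
  have h1 : u.2 = 0 := by
    have h3 : HasDerivAt (fun s => (extChartAt (jetModel n) (Γ 0 t) (Γ s t)).2) u.2 0 := hu.snd
    refine h3.unique ((hasDerivAt_const (0 : ℝ) (0 : ℝ)).congr_of_eventuallyEq ?_)
    filter_upwards [h0] with s hs
    rw [extChartAt_apply]
    exact (hz s hs).2
  have h2 : (extChartAt (jetModel n) (Γ 0 t) (Γ 0 t)).1.2 = 0 := by
    rw [extChartAt_apply]
    simp only
    rw [(hz 0 (mem_of_mem_nhds h0)).1]
    rfl
  rw [h1, h2]
  simp

/-- With the base point fixed the variation field has no `dq` component, so `λ` of it is just `dz`.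
-/
theorem hasDerivAt_height_of_vertical {Γ : ℝ → ℝ → OneJet n B} {ε t : ℝ} (hε : 0 < ε)
    (hc : ContMDiffOn 𝓘(ℝ, ℝ) (jetModel n) ∞ (fun s => Γ s t) (Ioo (-ε) ε)) {q : B}
    (hz : ∀ s ∈ Ioo (-ε) ε, base (Γ s t) = q) :
    HasDerivAt (fun s => height (Γ s t)) (variationPairing Γ t) 0 := by
  obtain ⟨u, hu, hL⟩ := exists_hasDerivAt_chart hε hc
  have h0 : Ioo (-ε) ε ∈ 𝓝 (0 : ℝ) := Ioo_mem_nhds (by linarith) hε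
  have h1 : u.1.1 = 0 := by
    have h3 : HasDerivAt (fun s => (extChartAt (jetModel n) (Γ 0 t) (Γ s t)).1.1) u.1.1 0 :=
      hu.fst.fst
    refine h3.unique ((hasDerivAt_const (0 : ℝ)
      (extChartAt (𝓡 n) (Γ 0 t).1.proj q)).congr_of_eventuallyEq ?_)
    filter_upwards [h0] with s hs
    rw [extChartAt_apply, ← hz s hs]
    rfl
  have h2 : HasDerivAt (fun s => (extChartAt (jetModel n) (Γ 0 t) (Γ s t)).2) u.2 0 := hu.snd
  rw [variationPairing, hL, h1, map_zero, sub_zero]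
  refine h2.congr_of_eventuallyEq (.of_forall fun s => ?_)
  simp only
  rw [extChartAt_apply]
  rfl

/-- A path solving the Hamiltonian equation, in the preferred chart at one of its points. -/
theorem IsHamiltonianTrajectory.hasDerivWithinAt_chart {H : ℝ → OneJet n B → ℝ}
    {c : ℝ → OneJet n B} (hc : IsHamiltonianTrajectory H c) {t : ℝ} (ht : t ∈ Icc (0 : ℝ) 1) :
    HasDerivWithinAt (fun τ => extChartAt (jetModel n) (c t) (c τ))
      (contactHamiltonianVectorField H t (c t) : JetVec n) (Icc 0 1) t := by
  have h1 := (hc t ht).2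
  rw [writtenInExtChartAt, extChartAt_model_space_eq_id] at h1
  simp only [inter_univ, mfld_simps] at h1
  exact h1

/-- Contact Hamiltonian chords are vertical critical points. -/
theorem IsContactHamiltonianChord.isVerticalCriticalPoint {c : PathClass} {H : ℝ → OneJet n B → ℝ}
    (hH : IsSmoothHamiltonian H) {γ : ℝ → OneJet n B} (hγ : IsContactHamiltonianChord H γ) :
    IsVerticalCriticalPoint c H γ := by
  intro ε Γ hΓ
  obtain ⟨P, hP⟩ := hΓ.isVariation.exists_pieces
  have hε := hΓ.pos
  have h0 : (0 : ℝ) ∈ Ioo (-ε) ε := ⟨by linarith, hε⟩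
  have hcurve : ∀ t ∈ Icc (0 : ℝ) 1,
      ContMDiffOn 𝓘(ℝ, ℝ) (jetModel n) ∞ (fun s => Γ s t) (Ioo (-ε) ε) := by
    intro t ht
    obtain ⟨S, hS, hQ⟩ := exists_mem_nhdsWithin_of_pieces
      (Q := fun S => t ∈ S → ContMDiffOn 𝓘(ℝ, ℝ) (jetModel n) ∞ (fun s => Γ s t) (Ioo (-ε) ε)) P
      (fun A B hA hB h => h.elim hA hB) ht
      (fun a b hab ht _ => (hP a b hab).comp
        (contDiff_id.prodMk contDiff_const).contMDiff.contMDiffOn fun s hs => ⟨hs, ht⟩)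
    exact hQ (mem_of_mem_nhdsWithin ht hS)
  have hhor : ∀ s ∈ Ioo (-ε) ε, IsTranslatedHorizontal H (Γ s) := fun s hs => (hΓ.mem s hs).1.2
  have hγ0 : ∀ a b, IsPiece P a b → ContMDiffOn 𝓘(ℝ, ℝ) (jetModel n) ∞ (Γ 0) (Icc a b) :=
    fun a b hab => (hP a b hab).comp
        (contDiff_const.prodMk contDiff_id).contMDiff.contMDiffOn fun t ht => ⟨h0, ht⟩
  have htraj : ∀ t ∈ Icc (0 : ℝ) 1,
      HasDerivWithinAt (fun τ => extChartAt (jetModel n) (Γ 0 t) (Γ 0 τ))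
      (contactHamiltonianVectorField H t (Γ 0 t) : JetVec n) (Icc 0 1) t := by
    intro t ht
    rw [hΓ.start t ht]
    refine (hγ.1.hasDerivWithinAt_chart ht).congr (fun τ hτ => ?_) ?_
    · rw [hΓ.start τ hτ]
    · rw [hΓ.start t ht]
  -- Pairing the defining equation of `X_H` with the variation field turns the first variation
  -- formula into the homogeneous equation `L' = -R[H] L`.
  have hder : ∀ a b, IsPiece P a b → ∀ t ∈ Icc a b, HasDerivWithinAt (variationPairing Γ)
      (-deriv (fun r => H t ((Γ 0 t).1, r)) (Γ 0 t).2 * variationPairing Γ t) (Icc a b) t := by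
    intro a b hab t ht
    have ht1 := hab.subset ht
    obtain ⟨η, -, hη, hd⟩ := hasDerivWithinAt_variationPairing hH hε hab.nonneg hab.lt hab.le_one
      (hP a b hab) hhor ht (mem_extChartAt_source _) ((htraj t ht1).mono hab.subset)
    refine hd.congr_deriv ?_
    obtain ⟨D, hD⟩ : ∃ D : JetVec n →L[ℝ] ℝ, dHam H t (Γ 0 t) = D := ⟨_, rfl⟩
    obtain ⟨X, hX⟩ : ∃ X : JetVec n, contactHamiltonianVectorField H t (Γ 0 t) = X := ⟨_, rfl⟩
    have h1 := ((isContactHamiltonianVector_iff hD).1 ((congrArg _ hX).mp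
      (isContactHamiltonianVector_contactHamiltonianVectorField H t (Γ 0 t)))).2 η
    have hz : D ((0, 0), 1) = deriv (fun r => H t ((Γ 0 t).1, r)) (Γ 0 t).2 := by
      rw [← hD]
      exact (dHam_eq_fderiv hH ht1 _ _).trans
        (fderiv_hamInChart_vertical hH ht1 (mem_extChartAt_source _))
    have hDη : fderiv ℝ (fun e => hamInChart H (Γ 0 t) (t, e))
        (extChartAt (jetModel n) (Γ 0 t) (Γ 0 t)) η = D η := by
      rw [← hD]
      exact (dHam_eq_fderiv hH ht1 _ _).symm
    rw [← hη, hz] at h1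
    rw [hDη]
    have h2 : η.1.2 X.1.1 - X.1.2 η.1.1 - D η =
        -deriv (fun r => H t ((Γ 0 t).1, r)) (Γ 0 t).2 * variationPairing Γ t := by linarith
    rw [← hX] at h2
    exact h2
  have hcont : ContinuousOn (variationPairing Γ) (Icc 0 1) :=
    continuousOn_of_pieces fun a b hab t ht => (hder a b hab t ht).continuousWithinAt
  obtain ⟨K, hK⟩ :=
    isCompact_Icc.exists_bound_of_continuousOn (continuousOn_deriv_vertical hH hγ0)
  -- Grönwall's inequality uses right derivatives of a continuous function only, so break points of
  -- the variation are harmless.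
  have hzero := eq_zero_of_abs_deriv_le_mul_abs_self_of_eq_zero_right (K := K) hcont
    (f' := fun t => -deriv (fun r => H t ((Γ 0 t).1, r)) (Γ 0 t).2 * variationPairing Γ t)
    (fun t ht => by
      obtain ⟨b, hb⟩ := exists_isPiece_right P ht.1 ht.2
      exact (hder t b hb t ⟨le_rfl, hb.lt.le⟩).mono_of_mem_nhdsWithin (Icc_mem_nhdsGE hb.lt))
    (variationPairing_eq_zero_of_zeroSection hε (hcurve 0 (by simp)) fun s hs => (hΓ.mem s hs).2)
    (fun t ht => by
      rw [norm_mul, norm_neg]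
      exact mul_le_mul_of_nonneg_right (hK t (Ico_subset_Icc_self ht)) (norm_nonneg _))
    1 (by simp)
  have h1 := hasDerivAt_height_of_vertical hε (hcurve 1 (by simp)) hΓ.vertical
  rw [hzero] at h1
  exact h1.congr_of_eventuallyEq (Filter.eventually_of_mem (isOpen_Ioo.mem_nhds h0)
    fun s hs => effectiveAction_eq_height (hΓ.mem s hs).1)

end OneJet

/-! ### Scalar comparison, bounds and gluing -/

section Model

/-- A subsolution of a linear scalar equation which vanishes at both ends vanishes. -/
theorem eq_zero_of_hasDerivWithinAt_of_nonneg {P : Finset ℝ} {L h f : ℝ → ℝ}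
    (hh : ContinuousOn h (Icc 0 1)) (hf : ∀ t ∈ Icc (0 : ℝ) 1, 0 ≤ f t)
    (hL : ∀ a b, IsPiece P a b → ∀ t ∈ Icc a b,
      HasDerivWithinAt L (-h t * L t + f t) (Icc a b) t)
    (h0 : L 0 = 0) (h1 : L 1 = 0) {t : ℝ} (ht : t ∈ Icc (0 : ℝ) 1) : L t = 0 := by
  have hhc : Continuous fun t => h (clamp t) :=
    hh.comp_continuous continuous_clamp clamp_mem
  set I : ℝ → ℝ := fun t => ∫ x in (0 : ℝ)..t, h (clamp x) with hI
  have hId : ∀ t ∈ Icc (0 : ℝ) 1, HasDerivAt I (h t) t := fun t ht => by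
    have := hhc.integral_hasStrictDerivAt 0 t
    rw [clamp_of_mem ht] at this
    exact this.hasDerivAt
  -- The integrating factor removes the linear term: the derivative of `M` is `exp(I) f ≥ 0`, so `M`
  -- is squeezed between its zero end values.
  set M : ℝ → ℝ := fun t => Real.exp (I t) * L t with hM
  have hMd : ∀ a b, IsPiece P a b → ∀ t ∈ Icc a b,
      HasDerivWithinAt M (Real.exp (I t) * f t) (Icc a b) t := fun a b hab t ht => by
    refine ((hId t (hab.subset ht)).exp.hasDerivWithinAt.mul (hL a b hab t ht)).congr_deriv ?_
    ring
  have hMc : ContinuousOn M (Icc 0 1) :=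
    OneJet.continuousOn_of_pieces fun a b hab t ht => (hMd a b hab t ht).continuousWithinAt
  -- Monotonicity from continuity and nonnegative right derivatives, which exist at break points
  -- too.
  have hmono : ∀ x ∈ Icc (0 : ℝ) 1, ∀ y ∈ Icc x 1, M x ≤ M y := fun x hx y hy => by
    have := image_le_of_deriv_right_le_deriv_boundary (f := fun t => -M t) (a := x) (b := 1)
      (f' := fun t => -(Real.exp (I t) * f t)) (B := fun _ => -M x) (B' := fun _ => 0)
      (hMc.mono (Icc_subset_Icc_left hx.1)).neg
      (fun t ht => by
        obtain ⟨b, hb⟩ := exists_isPiece_right P (hx.1.trans ht.1) ht.2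
        exact ((hMd t b hb t ⟨le_rfl, hb.lt.le⟩).mono_of_mem_nhdsWithin
          (Icc_mem_nhdsGE hb.lt)).neg)
      le_rfl continuousOn_const (fun _ _ => hasDerivWithinAt_const _ _ _)
      (fun t ht => neg_nonpos.2 (mul_nonneg (Real.exp_pos _).le
        (hf t ⟨hx.1.trans ht.1, ht.2.le⟩))) hy
    simpa using this
  have h2 := hmono 0 (by simp) t ht
  have h3 := hmono t ht 1 ⟨ht.2, le_rfl⟩
  have h4 : M t = 0 := le_antisymm (h3.trans_eq (by simp [hM, h1])) (le_trans (by simp [hM, h0]) h2)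
  exact (mul_eq_zero.1 h4).resolve_left (Real.exp_ne_zero _)

/-- Near `(s, w)` the function coincides with its translate by `(0, w' - w)`, as both arguments stay
in the open region `M < |w|`. -/
theorem fderiv_eq_of_eq_const {f : ℝ × ℝ → ℝ} {M : ℝ}
    (h : ∀ s w w', M < |w| → M < |w'| → f (s, w) = f (s, w')) {s w w' : ℝ} (hw : M < |w|)
    (hw' : M < |w'|) : fderiv ℝ f (s, w) = fderiv ℝ f (s, w') := by
  have h1 : f =ᶠ[𝓝 (s, w)] fun x => f (x + (0, w' - w)) := by
    have hO : IsOpen {r : ℝ | M < |r|} := isOpen_lt continuous_const continuous_abs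
    have hc : Continuous fun x : ℝ × ℝ => x.2 + (w' - w) := by fun_prop
    filter_upwards [continuous_snd.continuousAt.preimage_mem_nhds (hO.mem_nhds hw),
      hc.continuousAt.preimage_mem_nhds (hO.mem_nhds (x := w + (w' - w)) (by simpa using hw'))]
      with x hx hx'
    obtain ⟨x1, x2⟩ := x
    simpa using h x1 _ _ hx hx'
  rw [h1.fderiv_eq, fderiv_comp_add_right]
  simp

/-- For `|w|` beyond `|M| + 1` the function and its partial derivatives take their values at `w =
|M| + 1`, so maxima over a compact box bound them everywhere. -/
theorem exists_bound_of_eq_const {P : Finset ℝ} {G : ℝ × ℝ × ℝ → ℝ} (hG : PiecewiseContDiff P ∞ G)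
    {M : ℝ} (h : ∀ t ∈ Icc (0 : ℝ) 1, ∀ s w w', M < |w| → M < |w'| → G (t, s, w) = G (t, s, w'))
    (R : ℝ) : ∃ K, ∀ t ∈ Icc (0 : ℝ) 1, ∀ s w, |s| ≤ R → |G (t, s, w)| ≤ K ∧
      |partialSnd G (1, 0) (t, s, w)| ≤ K ∧ |partialSnd G (0, 1) (t, s, w)| ≤ K := by
  have hC : IsCompact (Icc (0 : ℝ) 1 ×ˢ (Icc (-R) R ×ˢ Icc (-(|M| + 1)) (|M| + 1))) :=
    isCompact_Icc.prod (isCompact_Icc.prod isCompact_Icc)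
  have hsub : Icc (0 : ℝ) 1 ×ˢ (Icc (-R) R ×ˢ Icc (-(|M| + 1)) (|M| + 1)) ⊆
      Icc (0 : ℝ) 1 ×ˢ univ := prod_mono_right (subset_univ _)
  obtain ⟨K0, hK0⟩ := hC.exists_bound_of_continuousOn (hG.continuousOn.mono hsub)
  obtain ⟨K1, hK1⟩ := hC.exists_bound_of_continuousOn
    ((hG.partialSnd (l := 0) (by simp) (1, 0)).continuousOn.mono hsub)
  obtain ⟨K2, hK2⟩ := hC.exists_bound_of_continuousOn
    ((hG.partialSnd (l := 0) (by simp) (0, 1)).continuousOn.mono hsub)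
  have hbd : ∀ t ∈ Icc (0 : ℝ) 1, ∀ s w, |s| ≤ R → |w| ≤ |M| + 1 → |G (t, s, w)| ≤ K0 ∧
      |partialSnd G (1, 0) (t, s, w)| ≤ K1 ∧ |partialSnd G (0, 1) (t, s, w)| ≤ K2 :=
    fun t ht s w hs hw => have hp := And.intro ht (And.intro (abs_le.1 hs) (abs_le.1 hw))
      ⟨hK0 (t, s, w) hp, hK1 (t, s, w) hp, hK2 (t, s, w) hp⟩
  refine ⟨max K0 (max K1 K2), fun t ht s w hs => ?_⟩
  obtain ⟨w', hw', h0, h1⟩ : ∃ w', |w'| ≤ |M| + 1 ∧ G (t, s, w) = G (t, s, w') ∧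
      ∀ e, partialSnd G e (t, s, w) = partialSnd G e (t, s, w') := by
    rcases le_or_gt |w| (|M| + 1) with hw | hw
    · exact ⟨w, hw, rfl, fun _ => rfl⟩
    · have h2 : M < |w| := by linarith [le_abs_self M]
      have h4 : |(|M| + 1)| = |M| + 1 := abs_of_nonneg (by positivity)
      have h3 : M < |(|M| + 1)| := by linarith [le_abs_self M]
      refine ⟨|M| + 1, h4.le, h t ht s _ _ h2 h3, fun e => ?_⟩
      unfold partialSnd
      simp only
      rw [fderiv_eq_of_eq_const (f := fun x => G (t, x)) (M := M) (fun s => h t ht s) h2 h3]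
  obtain ⟨e0, e1, e2⟩ := hbd t ht s w' hs hw'
  rw [h0, h1, h1]
  exact ⟨e0.trans (le_max_left _ _), e1.trans ((le_max_left _ _).trans (le_max_right _ _)),
    e2.trans ((le_max_right _ _).trans (le_max_right _ _))⟩

/-- The trivial solution, by uniqueness. -/
theorem eq_zero_of_hasDerivWithinAt_of_apply_zero {f : ℝ → ℝ → ℝ} {K : ℝ} {w : ℝ → ℝ}
    (hd : ∀ t ∈ Icc (0 : ℝ) 1, ∀ x, DifferentiableAt ℝ (f t) x)
    (hK : ∀ t ∈ Icc (0 : ℝ) 1, ∀ x, |deriv (f t) x| ≤ K) (hf : ∀ t ∈ Icc (0 : ℝ) 1, f t 0 = 0)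
    (hw : ∀ t ∈ Icc (0 : ℝ) 1, HasDerivWithinAt w (f t (w t)) (Icc 0 1) t) (h0 : w 0 = 0)
    {t : ℝ} (ht : t ∈ Icc (0 : ℝ) 1) : w t = 0 := by
  refine eq_zero_of_abs_deriv_le_mul_abs_self_of_eq_zero_right (K := K)
    (f' := fun t => f t (w t)) (fun t ht => (hw t ht).continuousWithinAt)
    (fun t ht => (hw t (Ico_subset_Icc_self ht)).mono_of_mem_nhdsWithin
      (Icc_mem_nhdsGE_of_mem ht)) h0 (fun t ht => ?_) t ht
  have ht' := Ico_subset_Icc_self ht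
  have := (convex_univ).norm_image_sub_le_of_norm_deriv_le (f := f t) (C := K) (x := 0) (y := w t)
    (fun x _ => hd t ht' x) (fun x _ => hK t ht' x) (mem_univ _) (mem_univ _)
  rwa [hf t ht', sub_zero, sub_zero] at this

variable {E M X : Type*} [NormedAddCommGroup E] [NormedSpace ℝ E] [TopologicalSpace M]
  {E' : Type*} [NormedAddCommGroup E'] [NormedSpace ℝ E'] {HM : Type*} [TopologicalSpace HM]
  {I : ModelWithCorners ℝ E' HM} [ChartedSpace HM M]

/-- Smoothness on `[a', b'] × E` can be tested on an open strip and off a closed subset of it. -/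
theorem contMDiffOn_of_strip {F : ℝ × E → M} {a b a' b' : ℝ} {K : Set ℝ} (hK : IsClosed K)
    (hKab : K ⊆ Ioo a b) (h1 : ContMDiffOn 𝓘(ℝ, ℝ × E) I ∞ F (Ioo a b ×ˢ univ))
    (h2 : ContMDiffOn 𝓘(ℝ, ℝ × E) I ∞ F ((Icc a' b' ∩ Kᶜ) ×ˢ univ)) :
    ContMDiffOn 𝓘(ℝ, ℝ × E) I ∞ F (Icc a' b' ×ˢ univ) := by
  rintro ⟨t, x⟩ ⟨ht, -⟩
  by_cases htK : t ∈ K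
  · exact (h1.contMDiffAt ((isOpen_Ioo.prod isOpen_univ).mem_nhds
      ⟨hKab htK, mem_univ _⟩)).contMDiffWithinAt
  · refine (h2 (t, x) ⟨⟨ht, htK⟩, mem_univ _⟩).mono_of_mem_nhdsWithin ?_
    refine mem_nhdsWithin.2 ⟨Kᶜ ×ˢ univ, hK.isOpen_compl.prod isOpen_univ, ⟨htK, mem_univ _⟩, ?_⟩
    rintro ⟨t, x⟩ ⟨⟨h, -⟩, h', -⟩
    exact ⟨⟨h', h⟩, mem_univ _⟩

end Model

namespace OneJet

variable {n : ℕ} {B : Type*} [TopologicalSpace B]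
  [ChartedSpace (EuclideanSpace ℝ (Fin n)) B] [IsManifold (𝓡 n) ∞ B]

theorem IsCompactlySupportedHamiltonian.exists_height_bound {H : ℝ → OneJet n B → ℝ}
    (hH : IsCompactlySupportedHamiltonian H) :
    ∃ M, ∀ t ∈ Icc (0 : ℝ) 1, ∀ y : OneJet n B, M < |y.2| → H t y = 0 := by
  obtain ⟨K, hK, h⟩ := hH
  obtain ⟨M, hM⟩ := hK.exists_bound_of_continuousOn (continuous_snd (X :=
    Bundle.TotalSpace (EuclideanSpace ℝ (Fin n) →L[ℝ] ℝ)
    (fun b : B => TangentSpace (𝓡 n) b →L[ℝ] ℝ)) (Y := ℝ)).continuousOn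
  exact ⟨M, fun t ht y hy => h t ht y fun hyK => (hM y hyK).not_gt hy⟩

end OneJet

/-! ### Deformations of a path and their height correction -/

section Model

variable {E : Type*} [NormedAddCommGroup E] [NormedSpace ℝ E]

/-- The increment of `p(q̇)` when a path `u = (q, p, z)` with velocity `u'` is deformed to
`u + sin(s) χ η`. -/
noncomputable def deformationForcing (u u' : ℝ → (E × (E →L[ℝ] ℝ)) × ℝ) (χ : ℝ → ℝ)
    (η : (E × (E →L[ℝ] ℝ)) × ℝ) (p : ℝ × ℝ) : ℝ :=
  (u p.1 + (Real.sin p.2 * χ p.1) • η).1.2 (u' p.1 + (Real.sin p.2 * deriv χ p.1) • η).1.1 -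
    (u p.1).1.2 (u' p.1).1.1

theorem deriv_eq_zero_of_notMem_tsupport {χ : ℝ → ℝ} {t : ℝ} (ht : t ∉ tsupport χ) :
    deriv χ t = 0 :=
  image_eq_zero_of_notMem_tsupport fun ht' => ht (tsupport_deriv_subset ht')

theorem contDiffOn_deformationForcing {u u' : ℝ → (E × (E →L[ℝ] ℝ)) × ℝ} {χ : ℝ → ℝ}
    (η : (E × (E →L[ℝ] ℝ)) × ℝ) {S : Set ℝ} (hu : ContDiffOn ℝ ∞ u S) (hu' : ContDiffOn ℝ ∞ u' S)
    (hχ : ContDiff ℝ ∞ χ) : ContDiffOn ℝ ∞ (deformationForcing u u' χ η) (S ×ˢ univ) := by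
  have hm : MapsTo (Prod.fst : ℝ × ℝ → ℝ) (S ×ˢ univ) S := fun p hp => hp.1
  have h1 := hu.comp contDiff_fst.contDiffOn hm
  have h2 := hu'.comp contDiff_fst.contDiffOn hm
  have hχ' : ContDiff ℝ ∞ (deriv χ) := (contDiff_infty_iff_deriv.1 hχ).2
  have hs : ContDiff ℝ ∞ fun p : ℝ × ℝ => Real.sin p.2 := Real.contDiff_sin.comp contDiff_snd
  have h3 : ContDiffOn ℝ ∞ (fun p : ℝ × ℝ => u p.1 + (Real.sin p.2 * χ p.1) • η) (S ×ˢ univ) :=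
    h1.add ((hs.mul (hχ.comp contDiff_fst)).smul contDiff_const).contDiffOn
  have h4 : ContDiffOn ℝ ∞ (fun p : ℝ × ℝ => u' p.1 + (Real.sin p.2 * deriv χ p.1) • η)
      (S ×ˢ univ) :=
    h2.add ((hs.mul (hχ'.comp contDiff_fst)).smul contDiff_const).contDiffOn
  exact (h3.fst.snd.clm_apply h4.fst.fst).sub (h1.fst.snd.clm_apply h2.fst.fst)

end Model

namespace OneJet

variable {n : ℕ} {B : Type*} [TopologicalSpace B]
  [ChartedSpace (EuclideanSpace ℝ (Fin n)) B] [IsManifold (𝓡 n) ∞ B]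

theorem extChartAt_mk_height (y₀ y : OneJet n B) (r : ℝ) :
    extChartAt (jetModel n) y₀ (y.1, r) = ((extChartAt (jetModel n) y₀ y).1, r) := by
  rw [extChartAt_apply, extChartAt_apply]

theorem extChartAt_height (y₀ y : OneJet n B) : (extChartAt (jetModel n) y₀ y).2 = y.2 := by
  rw [extChartAt_apply]

/-- The data of a deformation, supported in the interior of `[a, b]`, of a path which stays in the
chart around `y₀`: the path is moved by `sin(s) χ(t) η` in the chart. -/
structure IsDeformationDatum (γ : ℝ → OneJet n B) (y₀ : OneJet n B) (a b : ℝ) (χ : ℝ → ℝ)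
    (η : JetVec n) : Prop where
  smooth : ContMDiffOn 𝓘(ℝ, ℝ) (jetModel n) ∞ γ (Icc a b)
  maps : MapsTo γ (Icc a b) (extChartAt (jetModel n) y₀).source
  bump_smooth : ContDiff ℝ ∞ χ
  bump_support : tsupport χ ⊆ Ioo a b
  -- Since `sin` is bounded, one smallness condition keeps the deformation in the chart for every
  -- real `s`, as the parametric equation requires; since `cos 0 = 1`, the derivative at `s = 0` is
  -- still `χ η`.
  target : ∀ t ∈ Ioo a b, ∀ s,
    extChartAt (jetModel n) y₀ (γ t) + (Real.sin s * χ t) • η ∈ (extChartAt (jetModel n) y₀).target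

/-- The deformation of `γ`, before correcting the height. -/
noncomputable def deformation (γ : ℝ → OneJet n B) (y₀ : OneJet n B) (a b : ℝ) (χ : ℝ → ℝ)
    (η : JetVec n) (p : ℝ × ℝ) : OneJet n B :=
  open Classical in
  if p.1 ∈ Ioo a b then (extChartAt (jetModel n) y₀).symm
    (extChartAt (jetModel n) y₀ (γ p.1) + (Real.sin p.2 * χ p.1) • η) else γ p.1

/-- The speed of the height correction of a deformation for the zero Hamiltonian. -/
noncomputable def deformationSpeed (γ : ℝ → OneJet n B) (y₀ : OneJet n B) (a b : ℝ) (χ : ℝ → ℝ)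
    (η : JetVec n) (p : ℝ × ℝ) : ℝ :=
  open Classical in
  if p.1 ∈ Ioo a b then deformationForcing (fun t => extChartAt (jetModel n) y₀ (γ t))
    (deriv fun t => extChartAt (jetModel n) y₀ (γ t)) χ η p else 0

/-- The differential equation for the height correction of a deformation. -/
noncomputable def heightSpeed (H : ℝ → OneJet n B → ℝ) (γ : ℝ → OneJet n B) (y₀ : OneJet n B)
    (a b : ℝ) (χ : ℝ → ℝ) (η : JetVec n) (p : ℝ × ℝ × ℝ) : ℝ :=
  -- This is the only possible `ẇ`: subtract `λ(γ̇) + H = 0` from the same equation for the deformed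
  -- `(q, p)` with height `z + w`.
  deformationSpeed γ y₀ a b χ η (p.1, p.2.1) + H p.1 (γ p.1) -
    H p.1 ((deformation γ y₀ a b χ η (p.1, p.2.1)).1, (γ p.1).2 + p.2.2)

namespace IsDeformationDatum

variable {γ : ℝ → OneJet n B} {y₀ : OneJet n B} {a b : ℝ} {χ : ℝ → ℝ} {η : JetVec n} {t : ℝ}

theorem deformation_of_eq_zero (h : IsDeformationDatum γ y₀ a b χ η) (s : ℝ)
    (h0 : Real.sin s * χ t = 0) :
    deformation γ y₀ a b χ η (t, s) = γ t := by
  unfold deformation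
  split_ifs with ht
  · simp only
    rw [h0, zero_smul, add_zero]
    exact (extChartAt (jetModel n) y₀).left_inv (h.maps (Ioo_subset_Icc_self ht))
  · rfl

theorem bump_eq_zero (h : IsDeformationDatum γ y₀ a b χ η) (ht : t ∉ Ioo a b) : χ t = 0 :=
  image_eq_zero_of_notMem_tsupport fun ht' => ht (h.bump_support ht')

theorem extChartAt_deformation (h : IsDeformationDatum γ y₀ a b χ η) (ht : t ∈ Ioo a b) (s : ℝ) :
    extChartAt (jetModel n) y₀ (deformation γ y₀ a b χ η (t, s)) =
      extChartAt (jetModel n) y₀ (γ t) + (Real.sin s * χ t) • η := by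
  unfold deformation
  rw [if_pos ht]
  exact (extChartAt (jetModel n) y₀).right_inv (h.target t ht s)

theorem deformation_mem_source (h : IsDeformationDatum γ y₀ a b χ η) (ht : t ∈ Ioo a b) (s : ℝ) :
    deformation γ y₀ a b χ η (t, s) ∈ (extChartAt (jetModel n) y₀).source := by
  unfold deformation
  rw [if_pos ht]
  exact (extChartAt (jetModel n) y₀).map_target (h.target t ht s)

theorem contDiffOn_chart (h : IsDeformationDatum γ y₀ a b χ η) :
    ContDiffOn ℝ ∞ (fun t => extChartAt (jetModel n) y₀ (γ t)) (Ioo a b) :=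
  (contDiffOn_extChartAt_comp h.smooth h.maps).mono Ioo_subset_Icc_self

/-- The case distinction at `a` and `b` is invisible: off the support of `χ` both branches equal
`γ`, and the support is a closed subset of the open strip. -/
theorem contMDiffOn_deformation (h : IsDeformationDatum γ y₀ a b χ η) {a' b' : ℝ}
    (hγ : ContMDiffOn 𝓘(ℝ, ℝ) (jetModel n) ∞ γ (Icc a' b')) :
    ContMDiffOn 𝓘(ℝ, ℝ × ℝ) (jetModel n) ∞ (deformation γ y₀ a b χ η) (Icc a' b' ×ˢ univ) := by
  refine contMDiffOn_of_strip (isClosed_tsupport χ) h.bump_support ?_ ?_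
  · have h1 : ContDiffOn ℝ ∞ (fun p : ℝ × ℝ => extChartAt (jetModel n) y₀ (γ p.1) +
        (Real.sin p.2 * χ p.1) • η) (Ioo a b ×ˢ univ) := by
      have hs : ContDiff ℝ ∞ fun p : ℝ × ℝ => Real.sin p.2 := Real.contDiff_sin.comp contDiff_snd
      exact (h.contDiffOn_chart.comp (s := Ioo a b ×ˢ (univ : Set ℝ)) contDiff_fst.contDiffOn
        (fun p hp => hp.1)).add
        ((hs.mul (h.bump_smooth.comp contDiff_fst)).smul contDiff_const).contDiffOn
    refine ((contMDiffOn_extChartAt_symm y₀).comp h1.contMDiffOn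
      fun p hp => h.target p.1 hp.1 p.2).congr fun p hp => ?_
    unfold deformation
    rw [if_pos hp.1]
    rfl
  · refine (hγ.comp (t := Icc a' b') contDiff_fst.contMDiff.contMDiffOn
      fun p hp => hp.1.1).congr fun p hp => ?_
    exact h.deformation_of_eq_zero p.2 (by
      rw [image_eq_zero_of_notMem_tsupport hp.1.2, mul_zero])

theorem deformationSpeed_of_notMem (ht : t ∉ tsupport χ) (s : ℝ) :
    deformationSpeed γ y₀ a b χ η (t, s) = 0 := by
  unfold deformationSpeed
  split_ifs
  · simp [deformationForcing, image_eq_zero_of_notMem_tsupport ht,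
      deriv_eq_zero_of_notMem_tsupport ht]
  · rfl

theorem deformationSpeed_zero (t : ℝ) : deformationSpeed γ y₀ a b χ η (t, 0) = 0 := by
  unfold deformationSpeed
  split_ifs
  · simp [deformationForcing]
  · rfl

/-- No break points enter: the function is zero off the support of `χ`, and over the strip `γ` is
smooth. -/
theorem contDiffOn_deformationSpeed (h : IsDeformationDatum γ y₀ a b χ η) (a' b' : ℝ) :
    ContDiffOn ℝ ∞ (deformationSpeed γ y₀ a b χ η) (Icc a' b' ×ˢ univ) := by
  rw [← contMDiffOn_iff_contDiffOn]
  refine contMDiffOn_of_strip (isClosed_tsupport χ) h.bump_support ?_ ?_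
  · refine ContDiffOn.contMDiffOn ((contDiffOn_deformationForcing η h.contDiffOn_chart
      (h.contDiffOn_chart.deriv_of_isOpen isOpen_Ioo (by simp)) h.bump_smooth).congr
      fun p hp => ?_)
    unfold deformationSpeed
    rw [if_pos hp.1]
  · exact contMDiffOn_const.congr fun p hp => deformationSpeed_of_notMem hp.1.2 p.2

theorem piecewiseContDiff_heightSpeed (h : IsDeformationDatum γ y₀ a b χ η)
    {H : ℝ → OneJet n B → ℝ} (hH : IsSmoothHamiltonian H)
    {P : Finset ℝ}
    (hγ : ∀ a b, IsPiece P a b → ContMDiffOn 𝓘(ℝ, ℝ) (jetModel n) ∞ γ (Icc a b)) :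
    PiecewiseContDiff P ∞ (heightSpeed H γ y₀ a b χ η) := by
  intro a' b' hab
  have hpr : ContDiff ℝ ∞ fun p : ℝ × ℝ × ℝ => (p.1, p.2.1) :=
    contDiff_fst.prodMk (contDiff_fst.comp contDiff_snd)
  have h1 := (h.contDiffOn_deformationSpeed a' b').comp
    (s := Icc a' b' ×ˢ (univ : Set (ℝ × ℝ))) hpr.contDiffOn fun p hp => ⟨hp.1, mem_univ _⟩
  have h2 := (h.contMDiffOn_deformation (hγ a' b' hab)).comp
    (s := Icc a' b' ×ˢ (univ : Set (ℝ × ℝ))) hpr.contMDiff.contMDiffOn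
    fun p hp => ⟨hp.1, mem_univ _⟩
  have h3 : ContMDiffOn 𝓘(ℝ, ℝ × ℝ × ℝ) (jetModel n) ∞ (fun p : ℝ × ℝ × ℝ => γ p.1)
    (Icc a' b' ×ˢ univ) :=
    (hγ a' b' hab).comp contDiff_fst.contMDiff.contMDiffOn fun p hp => hp.1
  have h4 : ContMDiffOn 𝓘(ℝ, ℝ × ℝ × ℝ) (jetModel n) ∞ (fun p : ℝ × ℝ × ℝ =>
      ((deformation γ y₀ a b χ η (p.1, p.2.1)).1, (γ p.1).2 + p.2.2)) (Icc a' b' ×ˢ univ) :=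
    ContMDiffOn.prodMk (contMDiff_fst.comp_contMDiffOn h2)
      ((contMDiff_snd.comp_contMDiffOn h3).add
        (contDiff_snd.comp contDiff_snd).contMDiff.contMDiffOn)
  have hHc : ∀ {f : ℝ × ℝ × ℝ → OneJet n B},
      ContMDiffOn 𝓘(ℝ, ℝ × ℝ × ℝ) (jetModel n) ∞ f (Icc a' b' ×ˢ univ) →
      ContDiffOn ℝ ∞ (fun p => H p.1 (f p)) (Icc a' b' ×ˢ univ) := fun hf => by
    rw [← contMDiffOn_iff_contDiffOn]
    exact hH.comp (ContMDiffOn.prodMk contDiff_fst.contMDiff.contMDiffOn hf)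
      fun p hp => ⟨hab.subset hp.1, mem_univ _⟩
  exact (h1.add (hHc h3)).sub (hHc h4)

theorem heightSpeed_zero (h : IsDeformationDatum γ y₀ a b χ η) (H : ℝ → OneJet n B → ℝ) (t : ℝ) :
    heightSpeed H γ y₀ a b χ η (t, 0, 0) = 0 := by
  unfold heightSpeed
  simp only
  rw [deformationSpeed_zero, h.deformation_of_eq_zero 0 (by simp)]
  simp

/-- The height correction of a deformation. -/
theorem exists_heightCorrection (h : IsDeformationDatum γ y₀ a b χ η)
    {H : ℝ → OneJet n B → ℝ} (hH : IsSmoothHamiltonian H)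
    (hHc : IsCompactlySupportedHamiltonian H) {P : Finset ℝ}
    (hγ : ∀ a b, IsPiece P a b → ContMDiffOn 𝓘(ℝ, ℝ) (jetModel n) ∞ γ (Icc a b)) :
    ∃ w : ℝ × ℝ → ℝ, PiecewiseContDiff P ∞ w ∧ (∀ s, w (0, s) = 0) ∧
      (∀ t ∈ Icc (0 : ℝ) 1, w (t, 0) = 0) ∧
      ∀ t ∈ Icc (0 : ℝ) 1, ∀ s, HasDerivWithinAt (fun t => w (t, s))
        (heightSpeed H γ y₀ a b χ η (t, s, w (t, s))) (Icc 0 1) t := by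
  have hG := h.piecewiseContDiff_heightSpeed hH hγ
  obtain ⟨M, hM⟩ := hHc.exists_height_bound
  obtain ⟨Z, hZ⟩ := isCompact_Icc.exists_bound_of_continuousOn (s := Icc (0 : ℝ) 1)
    (f := fun t => (γ t).2)
    (continuousOn_of_pieces fun a b hab =>
      continuous_snd.comp_continuousOn (hγ a b hab).continuousOn)
  -- Here `M` bounds `|z|` on the support of `H` and `Z` bounds it along `γ`. For `|w| > M + Z` the
  -- corrected height lies outside the support and the equation no longer depends on `w`.
  have hb := exists_bound_of_eq_const hG (M := M + Z) (fun t ht s w w' hw hw' => by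
    have key : ∀ w : ℝ, M + Z < |w| → ∀ x, H t (x, (γ t).2 + w) = 0 := fun w hw x => by
      refine hM t ht _ ?_
      have h1 := abs_sub_abs_le_abs_sub w (-(γ t).2)
      have h2 : |(γ t).2| ≤ Z := hZ t ht
      rw [abs_neg, sub_neg_eq_add, add_comm w] at h1
      show M < |(γ t).2 + w|
      linarith
    simp only [heightSpeed, key w hw, key w' hw'])
  obtain ⟨w, hw, hw0, hwt⟩ := exists_parametric_solution hG hb
  refine ⟨w, hw, hw0, fun t ht => ?_, hwt⟩
  -- At `s = 0` the zero function solves the equation, so `w(·, 0) = 0` by uniqueness and the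
  -- variation starts at `γ`.
  obtain ⟨K, hK⟩ := hb 0
  have hd : ∀ t ∈ Icc (0 : ℝ) 1, ∀ x, HasDerivAt (fun x => heightSpeed H γ y₀ a b χ η (t, 0, x))
      (partialSnd (heightSpeed H γ y₀ a b χ η) (0, 1) (t, 0, x)) x := fun t ht x =>
    (hG.hasFDerivAt (by simp) ht (0, x)).hasFDerivAt.comp_hasDerivAt x
      ((hasDerivAt_const x (0 : ℝ)).prodMk (hasDerivAt_id x))
  exact eq_zero_of_hasDerivWithinAt_of_apply_zero
    (f := fun t x => heightSpeed H γ y₀ a b χ η (t, 0, x)) (K := K)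
    (fun t ht x => (hd t ht x).differentiableAt)
    (fun t ht x => by
      rw [(hd t ht x).deriv]
      exact (hK t ht 0 x (by simp)).2.2)
    (fun t _ => h.heightSpeed_zero H t) (fun t ht => hwt t ht 0) (hw0 0) ht

end IsDeformationDatum

/-- Changing the height of a path changes `λ(γ̇)` by the derivative of the change. -/
theorem contactForm_velocity_add_height {γ c : ℝ → OneJet n B} {w : ℝ → ℝ} {w' t : ℝ}
    (ht : t ∈ Icc (0 : ℝ) 1)
    (hc : c =ᶠ[𝓝[Icc 0 1] t] fun τ => ((γ τ).1, (γ τ).2 + w τ))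
    (hw : HasDerivWithinAt w w' (Icc 0 1) t)
    (hd : MDifferentiableWithinAt 𝓘(ℝ, ℝ) (jetModel n) c (Icc 0 1) t) :
    MDifferentiableWithinAt 𝓘(ℝ, ℝ) (jetModel n) γ (Icc 0 1) t ∧
      contactForm (c t) (velocity c t) = contactForm (γ t) (velocity γ t) + w' := by
  have hct := hc.self_of_nhdsWithin ht
  -- Differentiability passes from `c` back to `γ` by subtracting `w`. This direction is needed
  -- because the constraint on `γ` is available only where `γ` is differentiable.
  have hγ : MDifferentiableWithinAt 𝓘(ℝ, ℝ) (jetModel n) γ (Icc 0 1) t := by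
    have h1 : MDifferentiableWithinAt 𝓘(ℝ, ℝ) (jetModel n) (fun τ => ((c τ).1, (c τ).2 - w τ))
        (Icc 0 1) t :=
      MDifferentiableWithinAt.prodMk (mdifferentiableAt_fst.comp_mdifferentiableWithinAt t hd)
        ((mdifferentiableAt_snd.comp_mdifferentiableWithinAt t hd).sub
          hw.differentiableWithinAt.mdifferentiableWithinAt)
    refine h1.congr_of_eventuallyEq ?_ ?_
    · filter_upwards [hc] with τ hτ
      rw [hτ]
      simp
    · rw [hct]
      simp
  refine ⟨hγ, ?_⟩
  have hdiff : MDifferentiableWithinAt 𝓘(ℝ, ℝ) 𝓘(ℝ, JetVec n) (extChartAt (jetModel n) (γ t) ∘ γ)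
      (Icc 0 1) t :=
    MDifferentiableAt.comp_mdifferentiableWithinAt t
      ((contMDiffAt_extChartAt (n := ∞)).mdifferentiableAt (by simp)) hγ
  obtain ⟨u, hu⟩ : ∃ u : JetVec n,
      HasDerivWithinAt (fun τ => extChartAt (jetModel n) (γ t) (γ τ)) u (Icc 0 1) t :=
    ⟨_, hdiff.differentiableWithinAt.hasDerivWithinAt⟩
  have hU := uniqueDiffOn_Icc (zero_lt_one' ℝ) t ht
  have h1 := contactForm_mfderivWithin hU hγ.continuousWithinAt (mem_extChartAt_source _) hu
  have hcu : HasDerivWithinAt (fun τ => extChartAt (jetModel n) (γ t) (c τ)) (u.1, u.2 + w')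
      (Icc 0 1) t := by
    have hu1 : HasDerivWithinAt (fun τ => (extChartAt (jetModel n) (γ t) (γ τ)).1) u.1
      (Icc 0 1) t := hu.fst
    have hu2 : HasDerivWithinAt (fun τ => (extChartAt (jetModel n) (γ t) (γ τ)).2) u.2
      (Icc 0 1) t := hu.snd
    refine (hu1.prodMk (hu2.add hw)).congr_of_eventuallyEq ?_ ?_
    · filter_upwards [hc] with τ hτ
      rw [hτ, extChartAt_mk_height]
      exact Prod.ext rfl (congrArg (· + w τ) (extChartAt_height _ _)).symm
    · rw [hct, extChartAt_mk_height]
      exact Prod.ext rfl (congrArg (· + w t) (extChartAt_height _ _)).symm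
  have hsrc : c t ∈ (extChartAt (jetModel n) (γ t)).source := by
    rw [mem_extChartAt_source_iff, hct]
    exact (mem_extChartAt_source_iff (γ t) (γ t)).1 (mem_extChartAt_source _)
  have h2 := contactForm_mfderivWithin hU hd.continuousWithinAt hsrc hcu
  have h3 : (extChartAt (jetModel n) (γ t) (c t)).1 = (extChartAt (jetModel n) (γ t) (γ t)).1 := by
    rw [hct, extChartAt_mk_height]
  unfold velocity
  rw [h1, h2, h3]
  simp only
  ring

end OneJet

/-! ### The contact defect and the pairing along a deformation -/

section Model

variable {E : Type*} [NormedAddCommGroup E] [NormedSpace ℝ E]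

/-- The defect of the equation `τ ⌋ dλ = dH - R[H] λ`, evaluated at `η - dz(η) R`, for a vector `τ`
at a point with momentum `p` and with `D` the differential of `H`. -/
noncomputable def contactDefect (p : E →L[ℝ] ℝ) (D : (E × (E →L[ℝ] ℝ)) × ℝ →L[ℝ] ℝ)
    (τ η : (E × (E →L[ℝ] ℝ)) × ℝ) : ℝ :=
  η.1.2 τ.1.1 - τ.1.2 η.1.1 - D (η.1, 0) - D ((0, 0), 1) * p η.1.1

theorem apply_eq_add_mul (D : (E × (E →L[ℝ] ℝ)) × ℝ →L[ℝ] ℝ) (v : (E × (E →L[ℝ] ℝ)) × ℝ) :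
    D v = D (v.1, 0) + v.2 * D ((0, 0), 1) := by
  rw [← smul_eq_mul, ← map_smul, ← map_add, show ((0 : E), (0 : E →L[ℝ] ℝ)) = 0 from rfl]
  simp

/-- The `dz`-component of `v` contributes `D ((0, 0), 1) * v.2` to both terms on the right and
cancels. Testing on `(q, p)` directions is therefore enough, and the height stays free for the
correction. -/
theorem eq_iff_contactDefect_eq_zero (p : E →L[ℝ] ℝ) (D : (E × (E →L[ℝ] ℝ)) × ℝ →L[ℝ] ℝ)
    (τ v : (E × (E →L[ℝ] ℝ)) × ℝ) :
    v.1.2 τ.1.1 - τ.1.2 v.1.1 = D v - D ((0, 0), 1) * (v.2 - p v.1.1) ↔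
      contactDefect p D τ v = 0 := by
  rw [contactDefect, apply_eq_add_mul D v]
  constructor <;> intro h <;> linarith

theorem contactDefect_neg (p : E →L[ℝ] ℝ) (D : (E × (E →L[ℝ] ℝ)) × ℝ →L[ℝ] ℝ)
    (τ v : (E × (E →L[ℝ] ℝ)) × ℝ) : contactDefect p D τ (-v) = -contactDefect p D τ v := by
  have h : (((-v).1, 0) : (E × (E →L[ℝ] ℝ)) × ℝ) = -(v.1, 0) := by simp
  rw [contactDefect, contactDefect, h, map_neg]
  simp
  ring

/-- Only the `(q, p)` part of `η'` is prescribed: its height component, the unknown derivative of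
the correction `w`, is absorbed into `λ(η')`. -/
theorem firstVariation_eq_contactDefect (p : E →L[ℝ] ℝ) (D : (E × (E →L[ℝ] ℝ)) × ℝ →L[ℝ] ℝ)
    {τ η η' : (E × (E →L[ℝ] ℝ)) × ℝ} {c : ℝ} (h : η'.1 = c • η.1) :
    η'.1.2 τ.1.1 - τ.1.2 η'.1.1 - D η' =
      -D ((0, 0), 1) * (η'.2 - p η'.1.1) + c * contactDefect p D τ η := by
  have h1 : ((c • η.1, 0) : (E × (E →L[ℝ] ℝ)) × ℝ) = c • (η.1, 0) := by simp
  rw [apply_eq_add_mul D η', h, h1, contactDefect, map_smul]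
  simp
  ring

theorem contactDefect_continuousOn {X : Type*} [TopologicalSpace X] {S : Set X}
    {p : X → E →L[ℝ] ℝ} {D : X → (E × (E →L[ℝ] ℝ)) × ℝ →L[ℝ] ℝ} {τ : X → (E × (E →L[ℝ] ℝ)) × ℝ}
    (hp : ContinuousOn p S) (hD : ∀ v, ContinuousOn (fun x => D x v) S) (hτ : ContinuousOn τ S)
    (η : (E × (E →L[ℝ] ℝ)) × ℝ) : ContinuousOn (fun x => contactDefect (p x) (D x) (τ x) η) S :=
  ((((η.1.2.continuous.comp_continuousOn hτ.fst.fst).sub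
    (hτ.fst.snd.clm_apply continuousOn_const)).sub (hD _)).sub
    ((hD _).mul (hp.clm_apply continuousOn_const)))

end Model

namespace OneJet

variable {n : ℕ} {B : Type*} [TopologicalSpace B]
  [ChartedSpace (EuclideanSpace ℝ (Fin n)) B] [IsManifold (𝓡 n) ∞ B]

/-- The variation of `γ` by a deformation with height correction `w`. -/
noncomputable def deformationVariation (γ : ℝ → OneJet n B) (y₀ : OneJet n B) (a b : ℝ) (χ : ℝ → ℝ)
    (η : JetVec n) (w : ℝ × ℝ → ℝ) (s t : ℝ) : OneJet n B :=
  -- The height component of the deformation is discarded, so the `dz` part of `η` has no effect.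
  ((deformation γ y₀ a b χ η (t, s)).1, (γ t).2 + w (t, s))

namespace IsDeformationDatum

variable {γ : ℝ → OneJet n B} {y₀ : OneJet n B} {a b : ℝ} {χ : ℝ → ℝ} {η : JetVec n} {t : ℝ}
  {H : ℝ → OneJet n B → ℝ} {P : Finset ℝ} {w : ℝ × ℝ → ℝ}

theorem extChartAt_variation (h : IsDeformationDatum γ y₀ a b χ η) (ht : t ∈ Ioo a b) (s : ℝ) :
    extChartAt (jetModel n) y₀ (deformationVariation γ y₀ a b χ η w s t) =
      ((extChartAt (jetModel n) y₀ (γ t)).1 + (Real.sin s * χ t) • η.1,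
        (extChartAt (jetModel n) y₀ (γ t)).2 + w (t, s)) := by
  rw [deformationVariation, extChartAt_mk_height, h.extChartAt_deformation ht, extChartAt_height]
  rfl

theorem variation_mem_source (h : IsDeformationDatum γ y₀ a b χ η) (ht : t ∈ Ioo a b) (s : ℝ) :
    deformationVariation γ y₀ a b χ η w s t ∈ (extChartAt (jetModel n) y₀).source :=
  (mem_extChartAt_source_iff _ _).2
    ((mem_extChartAt_source_iff _ _).1 (h.deformation_mem_source ht s))

theorem variation_of_bump_eq_zero (h : IsDeformationDatum γ y₀ a b χ η) (ht : χ t = 0) (s : ℝ) :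
    deformationVariation γ y₀ a b χ η w s t = ((γ t).1, (γ t).2 + w (t, s)) := by
  rw [deformationVariation, h.deformation_of_eq_zero s (by rw [ht, mul_zero])]

theorem variation_zero (h : IsDeformationDatum γ y₀ a b χ η) (hw : w (t, 0) = 0) :
    deformationVariation γ y₀ a b χ η w 0 t = γ t := by
  rw [deformationVariation, h.deformation_of_eq_zero 0 (by simp), hw, add_zero]

theorem contMDiffOn_variation (h : IsDeformationDatum γ y₀ a b χ η)
    (hγ : ∀ a b, IsPiece P a b → ContMDiffOn 𝓘(ℝ, ℝ) (jetModel n) ∞ γ (Icc a b))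
    (hw : PiecewiseContDiff P ∞ w) {a' b' : ℝ} (hab : IsPiece P a' b') (S : Set ℝ) :
    ContMDiffOn 𝓘(ℝ, ℝ × ℝ) (jetModel n) ∞
      (fun p : ℝ × ℝ => deformationVariation γ y₀ a b χ η w p.1 p.2) (S ×ˢ Icc a' b') := by
  have h1 : ContMDiffOn 𝓘(ℝ, ℝ × ℝ) (jetModel n) ∞ (fun p : ℝ × ℝ => γ p.1)
    (Icc a' b' ×ˢ univ) :=
    (hγ a' b' hab).comp contDiff_fst.contMDiff.contMDiffOn fun p hp => hp.1
  have h2 : ContMDiffOn 𝓘(ℝ, ℝ × ℝ) (jetModel n) ∞ (fun p : ℝ × ℝ =>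
      ((deformation γ y₀ a b χ η p).1, (γ p.1).2 + w p)) (Icc a' b' ×ˢ univ) :=
    ContMDiffOn.prodMk (contMDiff_fst.comp_contMDiffOn (h.contMDiffOn_deformation (hγ a' b' hab)))
      ((contMDiff_snd.comp_contMDiffOn h1).add (hw a' b' hab).contMDiffOn)
  exact h2.comp (contDiff_snd.prodMk contDiff_fst).contMDiff.contMDiffOn
    fun p hp => ⟨hp.2, mem_univ _⟩

/-- On the support of `χ` the computation takes place in the chart around `y₀`. Off the support the
path may have left that chart, but there only the height has changed. -/
theorem isTranslatedHorizontal_variation (h : IsDeformationDatum γ y₀ a b χ η)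
    (hγ : IsTranslatedHorizontal H γ) {s : ℝ}
    (hw : ∀ t ∈ Icc (0 : ℝ) 1, HasDerivWithinAt (fun t => w (t, s))
      (heightSpeed H γ y₀ a b χ η (t, s, w (t, s))) (Icc 0 1) t) :
    IsTranslatedHorizontal H (deformationVariation γ y₀ a b χ η w s) := by
  intro t ht hd
  by_cases hts : t ∈ tsupport χ
  · have hab := h.bump_support hts
    have hU := uniqueDiffOn_Icc (zero_lt_one' ℝ) t ht
    have hIab : Ioo a b ∈ 𝓝[Icc 0 1] t := mem_nhdsWithin_of_mem_nhds (isOpen_Ioo.mem_nhds hab)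
    have hsrc := h.maps (Ioo_subset_Icc_self hab)
    obtain ⟨u, hu⟩ : ∃ u : ℝ → JetVec n, u = fun τ => extChartAt (jetModel n) y₀ (γ τ) := ⟨_, rfl⟩
    have hud : HasDerivWithinAt u (deriv u t) (Icc 0 1) t := by
      have := (h.contDiffOn_chart.contDiffAt (isOpen_Ioo.mem_nhds hab)).differentiableAt (by simp)
      rw [← hu] at this
      exact this.hasDerivAt.hasDerivWithinAt
    have hγd : MDifferentiableWithinAt 𝓘(ℝ, ℝ) (jetModel n) γ (Icc 0 1) t :=
      ((h.smooth.contMDiffAt (Icc_mem_nhds hab.1 hab.2)).mdifferentiableAt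
        (by simp)).mdifferentiableWithinAt
    have h1 := contactForm_mfderivWithin hU hγd.continuousWithinAt hsrc (u := deriv u t)
      (by have := hud; rw [hu] at this ⊢; exact this)
    have h2 := hγ t ht hγd
    unfold velocity at h2
    rw [h1] at h2
    have hc : HasDerivWithinAt (fun τ => extChartAt (jetModel n) y₀
        (deformationVariation γ y₀ a b χ η w s τ))
        ((deriv u t).1 + (Real.sin s * deriv χ t) • η.1, (deriv u t).2 +
          heightSpeed H γ y₀ a b χ η (t, s, w (t, s))) (Icc 0 1) t := by
      have e1 : HasDerivWithinAt (fun τ => (u τ).1) (deriv u t).1 (Icc 0 1) t := hud.fst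
      have e2 : HasDerivWithinAt (fun τ => (u τ).2) (deriv u t).2 (Icc 0 1) t := hud.snd
      have e3 : HasDerivWithinAt (fun τ => Real.sin s * χ τ) (Real.sin s * deriv χ t)
        (Icc 0 1) t := ((h.bump_smooth.differentiable (by simp) t).hasDerivAt.const_mul
          _).hasDerivWithinAt
      have e4 := (e1.add (e3.smul_const η.1)).prodMk (e2.add (hw t ht))
      refine e4.congr_of_eventuallyEq ?_ ?_
      · filter_upwards [hIab] with τ hτ
        rw [h.extChartAt_variation hτ, hu]
        rfl
      · rw [h.extChartAt_variation hab, hu]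
        rfl
    have h3 := contactForm_mfderivWithin hU hd.continuousWithinAt (h.variation_mem_source hab s) hc
    have hu1 : u t = extChartAt (jetModel n) y₀ (γ t) := by rw [hu]
    have hG : heightSpeed H γ y₀ a b χ η (t, s, w (t, s)) =
        (u t + (Real.sin s * χ t) • η).1.2 (deriv u t + (Real.sin s * deriv χ t) • η).1.1 -
          (u t).1.2 (deriv u t).1.1 + H t (γ t) -
          H t (deformationVariation γ y₀ a b χ η w s t) := by
      simp only [heightSpeed, deformationSpeed, deformationForcing]
      rw [if_pos hab, ← hu, hu1]
      rfl
    have h4 : (extChartAt (jetModel n) y₀ (deformationVariation γ y₀ a b χ η w s t)).1.2 =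
        (u t + (Real.sin s * χ t) • η).1.2 := by
      rw [h.extChartAt_variation hab, hu]
      rfl
    unfold velocity
    rw [h3, h4, hG]
    rw [← hu1] at h2
    show (deriv u t).2 + ((u t + (Real.sin s * χ t) • η).1.2
      (deriv u t + (Real.sin s * deriv χ t) • η).1.1 -
          (u t).1.2 (deriv u t).1.1 + H t (γ t) -
          H t (deformationVariation γ y₀ a b χ η w s t)) -
      (u t + (Real.sin s * χ t) • η).1.2 (deriv u t + (Real.sin s * deriv χ t) • η).1.1 + _ = 0
    linarith
  · have hev : deformationVariation γ y₀ a b χ η w s =ᶠ[𝓝[Icc 0 1] t]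
        fun τ => ((γ τ).1, (γ τ).2 + w (τ, s)) := by
      filter_upwards [mem_nhdsWithin_of_mem_nhds
        ((isClosed_tsupport χ).isOpen_compl.mem_nhds hts)] with τ hτ
      exact h.variation_of_bump_eq_zero (image_eq_zero_of_notMem_tsupport hτ) s
    obtain ⟨h1, h2⟩ := contactForm_velocity_add_height (w := fun τ => w (τ, s)) ht hev (hw t ht) hd
    have h3 := hγ t ht h1
    have hG : heightSpeed H γ y₀ a b χ η (t, s, w (t, s)) = H t (γ t) -
        H t (deformationVariation γ y₀ a b χ η w s t) := by
      simp only [heightSpeed]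
      rw [deformationSpeed_of_notMem hts, zero_add]
      rfl
    rw [h2, hG]
    linarith

/-- `χ` vanishes at times `0` and `1`, and `w(0, s) = 0`: the starting point does not move and the
end point moves only in height. The break points are those of `γ`, so the path class is preserved.
-/
theorem isVerticalVariation {c : PathClass} (h : IsDeformationDatum γ y₀ a b χ η)
    (ha : 0 ≤ a) (hb : b ≤ 1) (hγ : γ ∈ carnotPathSpaceZero c H) (hP : c.AllowsBreaks P)
    (hγP : ∀ a b, IsPiece P a b → ContMDiffOn 𝓘(ℝ, ℝ) (jetModel n) ∞ γ (Icc a b))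
    (hw : PiecewiseContDiff P ∞ w) (hw0 : ∀ s, w (0, s) = 0)
    (hwz : ∀ t ∈ Icc (0 : ℝ) 1, w (t, 0) = 0)
    (hwt : ∀ t ∈ Icc (0 : ℝ) 1, ∀ s, HasDerivWithinAt (fun t => w (t, s))
      (heightSpeed H γ y₀ a b χ η (t, s, w (t, s))) (Icc 0 1) t) :
    IsVerticalVariation c H γ 1 (deformationVariation γ y₀ a b χ η w) where
  pos := one_pos
  isVariation := ⟨P, hP, fun _ _ h0 hlt h1 hfree =>
    h.contMDiffOn_variation hγP hw ⟨h0, hlt, h1, hfree⟩ _⟩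
  start := fun t ht => h.variation_zero (hwz t ht)
  mem := fun s hs => by
    refine ⟨⟨⟨P, hP, fun a' b' h0 hlt h1 hfree => ?_⟩,
      h.isTranslatedHorizontal_variation hγ.1.2 fun t ht => hwt t ht s⟩, ?_⟩
    · exact (h.contMDiffOn_variation hγP hw ⟨h0, hlt, h1, hfree⟩ univ).comp
        (contDiff_const.prodMk contDiff_id).contMDiff.contMDiffOn fun t ht => ⟨mem_univ s, ht⟩
    · rw [h.variation_of_bump_eq_zero (h.bump_eq_zero fun h' => h'.1.not_ge ha), hw0, add_zero]
      exact hγ.2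
  vertical := fun s hs => by
    unfold endProjection
    rw [h.variation_of_bump_eq_zero (h.bump_eq_zero fun h' => h'.2.not_ge hb)]
    rfl

/-- The equation of the pairing of the contact form with the variation field. -/
theorem hasDerivWithinAt_variationPairing (hH : IsSmoothHamiltonian H)
    (h : IsDeformationDatum γ y₀ a b χ η)
    (hγP : ∀ a b, IsPiece P a b → ContMDiffOn 𝓘(ℝ, ℝ) (jetModel n) ∞ γ (Icc a b))
    (hw : PiecewiseContDiff P ∞ w) (hwz : ∀ t ∈ Icc (0 : ℝ) 1, w (t, 0) = 0)
    (hhor : ∀ s ∈ Ioo (-1 : ℝ) 1,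
      IsTranslatedHorizontal H (deformationVariation γ y₀ a b χ η w s))
    {a' b' : ℝ} (hab : IsPiece P a' b') (ht : t ∈ Icc a' b') :
    HasDerivWithinAt (variationPairing (deformationVariation γ y₀ a b χ η w))
      (-deriv (fun r => H t ((γ t).1, r)) (γ t).2 *
        variationPairing (deformationVariation γ y₀ a b χ η w) t +
        χ t * contactDefect (extChartAt (jetModel n) y₀ (γ t)).1.2
          (fderiv ℝ (fun e => hamInChart H y₀ (t, e)) (extChartAt (jetModel n) y₀ (γ t)))
          (deriv (fun t => extChartAt (jetModel n) y₀ (γ t)) t) η) (Icc a' b') t := by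
  have ht1 := hab.subset ht
  have hΓ0 : ∀ τ ∈ Icc a' b', deformationVariation γ y₀ a b χ η w 0 τ = γ τ :=
    fun τ hτ => h.variation_zero (hwz τ (hab.subset hτ))
  have hΓ := h.contMDiffOn_variation hγP hw hab (Ioo (-1 : ℝ) 1)
  by_cases hts : t ∈ Ioo a b
  · have hsrc := h.maps (Ioo_subset_Icc_self hts)
    have hτ : HasDerivWithinAt (fun τ => extChartAt (jetModel n) y₀
        (deformationVariation γ y₀ a b χ η w 0 τ))
        (deriv (fun t => extChartAt (jetModel n) y₀ (γ t)) t) (Icc a' b') t := by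
      refine ((h.contDiffOn_chart.contDiffAt (isOpen_Ioo.mem_nhds hts)).differentiableAt
        (by simp)).hasDerivAt.hasDerivWithinAt.congr (fun τ hτ => ?_) ?_
      · rw [hΓ0 τ hτ]
      · rw [hΓ0 t ht]
    obtain ⟨η', h1, h2, h3⟩ := OneJet.hasDerivWithinAt_variationPairing hH one_pos hab.nonneg
      hab.lt hab.le_one hΓ hhor ht (y₀ := y₀) (by rw [hΓ0 t ht]; exact hsrc) hτ
    have h4 : η'.1 = χ t • η.1 := by
      have e1 : HasDerivAt (fun s => (extChartAt (jetModel n) y₀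
        (deformationVariation γ y₀ a b χ η w s t)).1) η'.1 0 := h1.fst
      have e2 : HasDerivAt (fun s => (extChartAt (jetModel n) y₀ (γ t)).1 +
          (Real.sin s * χ t) • η.1) ((Real.cos 0 * χ t) • η.1) 0 :=
        (((Real.hasDerivAt_sin 0).mul_const _).smul_const η.1).const_add _
      rw [Real.cos_zero, one_mul] at e2
      refine e1.unique (e2.congr_of_eventuallyEq (.of_forall fun s => ?_))
      simp only
      rw [h.extChartAt_variation hts]
    refine h3.congr_deriv ?_
    rw [h2, hΓ0 t ht, ← fderiv_hamInChart_vertical hH ht1 hsrc]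
    exact firstVariation_eq_contactDefect _ _ h4
  · have hχ := h.bump_eq_zero hts
    obtain ⟨τ, hτ⟩ : ∃ τ : JetVec n, HasDerivWithinAt (fun τ => extChartAt (jetModel n) (γ t)
        (deformationVariation γ y₀ a b χ η w 0 τ)) τ (Icc a' b') t := by
      have hd : MDifferentiableWithinAt 𝓘(ℝ, ℝ) 𝓘(ℝ, JetVec n)
          (extChartAt (jetModel n) (γ t) ∘ γ) (Icc a' b') t :=
        MDifferentiableAt.comp_mdifferentiableWithinAt t
          ((contMDiffAt_extChartAt (n := ∞)).mdifferentiableAt (by simp))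
          ((hγP a' b' hab t ht).mdifferentiableWithinAt (by simp))
      refine ⟨_, hd.differentiableWithinAt.hasDerivWithinAt.congr (fun τ hτ => ?_) ?_⟩
      · rw [hΓ0 τ hτ]; rfl
      · rw [hΓ0 t ht]; rfl
    obtain ⟨η', h1, h2, h3⟩ := OneJet.hasDerivWithinAt_variationPairing hH one_pos hab.nonneg
      hab.lt hab.le_one hΓ hhor ht (y₀ := γ t)
      (by rw [hΓ0 t ht]; exact mem_extChartAt_source _) hτ
    -- At this time only the height varies with `s`, so the variation field is vertical and
    -- contributes no forcing.
    have h4 : η'.1 = (0 : ℝ) • η.1 := by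
      have e1 : HasDerivAt (fun s => (extChartAt (jetModel n) (γ t)
        (deformationVariation γ y₀ a b χ η w s t)).1) η'.1 0 := h1.fst
      rw [zero_smul]
      refine e1.unique ((hasDerivAt_const (0 : ℝ)
        (extChartAt (jetModel n) (γ t) (γ t)).1).congr_of_eventuallyEq (.of_forall fun s => ?_))
      simp only
      rw [h.variation_of_bump_eq_zero hχ, extChartAt_mk_height]
    refine h3.congr_deriv ?_
    rw [h2, hΓ0 t ht, ← fderiv_hamInChart_vertical hH ht1 (mem_extChartAt_source (γ t)), hχ,
      zero_mul]
    refine (firstVariation_eq_contactDefect (extChartAt (jetModel n) (γ t) (γ t)).1.2 _ h4).trans ?_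
    rw [zero_mul]

end IsDeformationDatum

end OneJet

/-! ### Localized deformations, and critical points as chords -/

section Model

variable {V W : Type*} [NormedAddCommGroup V] [NormedSpace ℝ V] [NormedAddCommGroup W]
  [NormedSpace ℝ W]

theorem contDiffOn_partial {u : ℝ × V → W} {U : Set V} (hU : IsOpen U)
    (h : ContDiffOn ℝ ∞ u (Icc 0 1 ×ˢ U)) (v : V) :
    ContDiffOn ℝ ∞ (fun p : ℝ × V => fderiv ℝ (fun e => u (p.1, e)) p.2 v) (Icc 0 1 ×ˢ U) := by
  have hUD : UniqueDiffOn ℝ (Icc (0 : ℝ) 1 ×ˢ U) :=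
    (uniqueDiffOn_Icc one_pos).prod hU.uniqueDiffOn
  refine ((h.fderivWithin (m := ∞) hUD (by simp)).clm_apply contDiffOn_const
    (g := fun _ => ((0 : ℝ), v))).congr ?_
  rintro ⟨t, x⟩ ⟨ht, hx⟩
  have h1 := (h.differentiableOn (by simp) (t, x) ⟨ht, hx⟩).hasFDerivWithinAt
  have hm : MapsTo (fun e => (t, e)) U (Icc 0 1 ×ˢ U) := fun e he => ⟨ht, he⟩
  have h2 := (h1.comp x (hasFDerivAt_prodMk_right t x).hasFDerivWithinAt hm).hasFDerivAt
    (hU.mem_nhds hx)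
  have h3 : fderiv ℝ (fun e => u (t, e)) x = _ := h2.fderiv
  simp [h3]

/-- A bump function around `t` which is so small that the deformation stays in an open set. -/
theorem exists_bump {u : ℝ → V} {U : Set V} {a b t : ℝ} (ht : t ∈ Ioo a b)
    (hu : ContinuousOn u (Icc a b)) (hU : IsOpen U) (huU : MapsTo u (Icc a b) U) (η : V) :
    ∃ χ : ℝ → ℝ, ContDiff ℝ ∞ χ ∧ tsupport χ ⊆ Ioo a b ∧ (∀ x, 0 ≤ χ x) ∧ 0 < χ t ∧
      ∀ x ∈ Ioo a b, ∀ s, u x + (Real.sin s * χ x) • η ∈ U := by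
  obtain ⟨r, hr, hball⟩ := Metric.isOpen_iff.1 isOpen_Ioo t ht
  -- A whole `δ`-thickening of the compact arc lies in `U`. The amplitude `δ / (‖η‖ + 1)` keeps
  -- every displacement below `δ`, and the `+ 1` covers `η = 0`.
  obtain ⟨δ, hδ, hsub⟩ := (isCompact_Icc.image_of_continuousOn hu).exists_thickening_subset_open
    hU huU.image_subset
  let f : ContDiffBump t := ⟨r / 4, r / 2, by linarith, by linarith⟩
  have hc : 0 < δ / (‖η‖ + 1) := by positivity
  refine ⟨fun x => δ / (‖η‖ + 1) * f x, contDiff_const.mul f.contDiff, ?_,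
    fun x => mul_nonneg hc.le f.nonneg, mul_pos hc (f.pos_of_mem_ball ?_), fun x hx s => hsub ?_⟩
  · refine (tsupport_mul_subset_right).trans ?_
    rw [f.tsupport_eq]
    exact (Metric.closedBall_subset_ball (show r / 2 < r by linarith)).trans hball
  · exact Metric.mem_ball_self (by show 0 < r / 2; linarith)
  · refine Metric.mem_thickening_iff.2 ⟨u x, ⟨x, Ioo_subset_Icc_self hx, rfl⟩, ?_⟩
    rw [dist_eq_norm, add_sub_cancel_left, norm_smul, norm_mul, norm_mul, Real.norm_of_nonneg hc.le,
      Real.norm_of_nonneg f.nonneg]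
    have h1 : ‖Real.sin s‖ ≤ 1 := Real.abs_sin_le_one s
    have h2 : f x ≤ 1 := f.le_one
    calc ‖Real.sin s‖ * (δ / (‖η‖ + 1) * f x) * ‖η‖
        ≤ 1 * (δ / (‖η‖ + 1) * 1) * ‖η‖ := by
          gcongr
          exact mul_nonneg hc.le f.nonneg
      _ = δ * (‖η‖ / (‖η‖ + 1)) := by ring
      _ < δ * 1 := by
          gcongr
          rw [div_lt_one (by positivity)]
          linarith
      _ = δ := mul_one δ

end Model

namespace OneJet

variable {n : ℕ} {B : Type*} [TopologicalSpace B]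
  [ChartedSpace (EuclideanSpace ℝ (Fin n)) B] [IsManifold (𝓡 n) ∞ B]
  {H : ℝ → OneJet n B → ℝ} {c : PathClass} {γ : ℝ → OneJet n B} {P : Finset ℝ}

/-- The contact defect of the velocity of a path in a chart. -/
noncomputable def pathDefect (H : ℝ → OneJet n B → ℝ) (γ : ℝ → OneJet n B) (y₀ : OneJet n B)
    (η : JetVec n) (S : Set ℝ) (t : ℝ) : ℝ :=
  contactDefect (extChartAt (jetModel n) y₀ (γ t)).1.2
    (fderiv ℝ (fun e => hamInChart H y₀ (t, e)) (extChartAt (jetModel n) y₀ (γ t)))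
    (derivWithin (fun t => extChartAt (jetModel n) y₀ (γ t)) S t) η

theorem continuousOn_pathDefect (hH : IsSmoothHamiltonian H) {y₀ : OneJet n B} {a b : ℝ}
    (hab : IsPiece P a b) (hγ : ContMDiffOn 𝓘(ℝ, ℝ) (jetModel n) ∞ γ (Icc a b))
    (hs : MapsTo γ (Icc a b) (extChartAt (jetModel n) y₀).source) (η : JetVec n) :
    ContinuousOn (pathDefect H γ y₀ η (Icc a b)) (Icc a b) := by
  have hu := contDiffOn_extChartAt_comp hγ hs
  have hD : ∀ v : JetVec n, ContinuousOn (fun t => fderiv ℝ (fun e => hamInChart H y₀ (t, e))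
      (extChartAt (jetModel n) y₀ (γ t)) v) (Icc a b) := fun v =>
    (contDiffOn_partial (isOpen_extChartAt_target y₀)
      (contDiffOn_hamInChart hH y₀) v).continuousOn.comp
      (continuousOn_id.prodMk hu.continuousOn)
      fun t ht => ⟨hab.subset ht, (extChartAt (jetModel n) y₀).map_source (hs ht)⟩
  exact contactDefect_continuousOn hu.continuousOn.fst.snd hD
    (hu.continuousOn_derivWithin (uniqueDiffOn_Icc hab.lt) (by simp)) η

/-- The velocity defect of a vertical critical point vanishes on the support of every admissible
deformation. -/
theorem IsVerticalCriticalPoint.bump_mul_defect_eq_zero (hcrit : IsVerticalCriticalPoint c H γ)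
    (hH : IsSmoothHamiltonian H) (hHc : IsCompactlySupportedHamiltonian H)
    (hγ : γ ∈ carnotPathSpaceZero c H) (hP : c.AllowsBreaks P)
    (hγP : ∀ a b, IsPiece P a b → ContMDiffOn 𝓘(ℝ, ℝ) (jetModel n) ∞ γ (Icc a b))
    {y₀ : OneJet n B} {a b : ℝ} {χ : ℝ → ℝ} {η : JetVec n} (ha : 0 ≤ a) (hb : b ≤ 1)
    (h : IsDeformationDatum γ y₀ a b χ η)
    (hpos : ∀ t ∈ Ioo a b, 0 ≤ χ t * pathDefect H γ y₀ η univ t) {t : ℝ} (ht : t ∈ Ioo a b) :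
    χ t * pathDefect H γ y₀ η univ t = 0 := by
  obtain ⟨w, hw, hw0, hwz, hwt⟩ := h.exists_heightCorrection hH hHc hγP
  have hΓ := h.isVerticalVariation ha hb hγ hP hγP hw hw0 hwz hwt
  obtain ⟨L, hL⟩ : ∃ L, L = variationPairing (deformationVariation γ y₀ a b χ η w) := ⟨_, rfl⟩
  have hode : ∀ a' b', IsPiece P a' b' → ∀ t ∈ Icc a' b', HasDerivWithinAt L
      (-deriv (fun r => H t ((γ t).1, r)) (γ t).2 * L t + χ t * pathDefect H γ y₀ η univ t)
      (Icc a' b') t := fun a' b' hab t ht => by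
    rw [hL, pathDefect, derivWithin_univ]
    exact h.hasDerivWithinAt_variationPairing hH hγP hw hwz (fun s hs => (hΓ.mem s hs).1.2) hab ht
  have hcurve : ∀ {a' b'}, IsPiece P a' b' → ∀ t ∈ Icc a' b', ContMDiffOn 𝓘(ℝ, ℝ) (jetModel n) ∞
      (fun s => deformationVariation γ y₀ a b χ η w s t) (Ioo (-1) 1) := fun hab t ht =>
    (h.contMDiffOn_variation hγP hw hab (Ioo (-1) 1)).comp
      (contDiff_id.prodMk contDiff_const).contMDiff.contMDiffOn fun s hs => ⟨hs, ht⟩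
  have hL0 : L 0 = 0 := by
    obtain ⟨b', hb'⟩ := exists_isPiece_right P le_rfl one_pos
    rw [hL]
    exact variationPairing_eq_zero_of_zeroSection one_pos
      (hcurve hb' 0 ⟨le_rfl, hb'.lt.le⟩) fun s hs => (hΓ.mem s hs).2
  -- Criticality enters only here: the action is the final height, whose derivative along the
  -- variation is `L 1`.
  have hL1 : L 1 = 0 := by
    obtain ⟨a', ha'⟩ := exists_isPiece_left P one_pos le_rfl
    have h1 := hasDerivAt_height_of_vertical one_pos (hcurve ha' 1 ⟨ha'.lt.le, le_rfl⟩) hΓ.vertical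
    rw [hL]
    refine h1.unique ((hcrit 1 _ hΓ).congr_of_eventuallyEq (Filter.eventually_of_mem
      (Ioo_mem_nhds (by norm_num : (-1 : ℝ) < 0) one_pos) fun s hs => ?_))
    exact (effectiveAction_eq_height (hΓ.mem s hs).1).symm
  have hzero : ∀ t ∈ Icc (0 : ℝ) 1, L t = 0 := fun t ht =>
    eq_zero_of_hasDerivWithinAt_of_nonneg (continuousOn_deriv_vertical hH hγP)
      (fun t _ => by
        by_cases hts : t ∈ Ioo a b
        · exact hpos t hts
        · rw [h.bump_eq_zero hts, zero_mul]) hode hL0 hL1 ht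
  have h0 : 0 ≤ t := ha.trans ht.1.le
  have h1 : t < 1 := ht.2.trans_le hb
  obtain ⟨b', hb'⟩ := exists_isPiece_right P h0 h1
  have htb : t ∈ Icc t b' := ⟨le_rfl, hb'.lt.le⟩
  -- Once `L` is identically zero, its equation leaves the forcing term equal to zero.
  have h2 := (uniqueDiffOn_Icc hb'.lt t htb).eq_deriv _ (hode t b' hb' t htb)
    ((hasDerivWithinAt_const t _ (0 : ℝ)).congr (fun x hx => hzero x (hb'.subset hx))
      (hzero t ⟨h0, h1.le⟩))
  rwa [hzero t ⟨h0, h1.le⟩, mul_zero, zero_add] at h2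

/-- A positive value persists on a small interval by continuity. A nonnegative bump supported there
then gives a nonnegative forcing, which criticality forces to vanish although it is positive at `t`.
-/
theorem IsVerticalCriticalPoint.pathDefect_nonpos (hcrit : IsVerticalCriticalPoint c H γ)
    (hH : IsSmoothHamiltonian H) (hHc : IsCompactlySupportedHamiltonian H)
    (hγ : γ ∈ carnotPathSpaceZero c H) (hP : c.AllowsBreaks P)
    (hγP : ∀ a b, IsPiece P a b → ContMDiffOn 𝓘(ℝ, ℝ) (jetModel n) ∞ γ (Icc a b))
    {y₀ : OneJet n B} {a b : ℝ} (hab : IsPiece P a b)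
    (hs : MapsTo γ (Icc a b) (extChartAt (jetModel n) y₀).source) (η : JetVec n) {t : ℝ}
    (ht : t ∈ Ioo a b) : pathDefect H γ y₀ η (Icc a b) t ≤ 0 := by
  by_contra! hpos
  have hc := ((continuousOn_pathDefect hH hab (hγP a b hab) hs η) t
    (Ioo_subset_Icc_self ht)).continuousAt (Icc_mem_nhds ht.1 ht.2)
  obtain ⟨r, hr, hball⟩ := Metric.mem_nhds_iff.1
    (Filter.inter_mem (hc.eventually (lt_mem_nhds hpos)) (isOpen_Ioo.mem_nhds ht))
  have hsub : Icc (t - r / 2) (t + r / 2) ⊆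
      {x | 0 < pathDefect H γ y₀ η (Icc a b) x} ∩ Ioo a b := by
    refine Subset.trans ?_ hball
    rw [← Real.closedBall_eq_Icc]
    exact Metric.closedBall_subset_ball (by linarith)
  have hsubI : Icc (t - r / 2) (t + r / 2) ⊆ Icc a b :=
    fun x hx => Ioo_subset_Icc_self (hsub hx).2
  have htI : t ∈ Ioo (t - r / 2) (t + r / 2) := ⟨by linarith, by linarith⟩
  have hu := (contDiffOn_extChartAt_comp (hγP a b hab) hs).continuousOn
  obtain ⟨χ, hχ, hχs, hχ0, hχt, hχU⟩ := exists_bump htI (hu.mono hsubI)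
    (isOpen_extChartAt_target y₀)
    (fun x hx => (extChartAt (jetModel n) y₀).map_source (hs (hsubI hx))) η
  have hdatum : IsDeformationDatum γ y₀ (t - r / 2) (t + r / 2) χ η :=
    ⟨(hγP a b hab).mono hsubI, hs.mono_left hsubI, hχ, hχs, hχU⟩
  have heq : ∀ x ∈ Ioo (t - r / 2) (t + r / 2),
      pathDefect H γ y₀ η univ x = pathDefect H γ y₀ η (Icc a b) x := fun x hx => by
    have hx' := (hsub (Ioo_subset_Icc_self hx)).2
    rw [pathDefect, pathDefect, derivWithin_univ,
      derivWithin_of_mem_nhds (Icc_mem_nhds hx'.1 hx'.2)]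
  have hlo := hsubI (left_mem_Icc.2 (by linarith : t - r / 2 ≤ t + r / 2))
  have hhi := hsubI (right_mem_Icc.2 (by linarith : t - r / 2 ≤ t + r / 2))
  have := hcrit.bump_mul_defect_eq_zero hH hHc hγ hP hγP (hab.nonneg.trans hlo.1)
    (hhi.2.trans hab.le_one) hdatum
    (fun x hx => mul_nonneg (hχ0 x) (by
      rw [heq x hx]
      exact (hsub (Ioo_subset_Icc_self hx)).1.le)) htI
  rw [heq t htI] at this
  exact (mul_pos hχt hpos).ne' this

/-- The defect is odd in `η`, so the one-sided inequality for `-η` is the reverse one. Continuity on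
the closed piece then includes its end points. -/
theorem IsVerticalCriticalPoint.pathDefect_eq_zero (hcrit : IsVerticalCriticalPoint c H γ)
    (hH : IsSmoothHamiltonian H) (hHc : IsCompactlySupportedHamiltonian H)
    (hγ : γ ∈ carnotPathSpaceZero c H) (hP : c.AllowsBreaks P)
    (hγP : ∀ a b, IsPiece P a b → ContMDiffOn 𝓘(ℝ, ℝ) (jetModel n) ∞ γ (Icc a b))
    {y₀ : OneJet n B} {a b : ℝ} (hab : IsPiece P a b)
    (hs : MapsTo γ (Icc a b) (extChartAt (jetModel n) y₀).source) (η : JetVec n) {t : ℝ}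
    (ht : t ∈ Icc a b) : pathDefect H γ y₀ η (Icc a b) t = 0 := by
  have h1 : EqOn (pathDefect H γ y₀ η (Icc a b)) (fun _ => 0) (Ioo a b) := fun t ht => by
    refine le_antisymm (hcrit.pathDefect_nonpos hH hHc hγ hP hγP hab hs η ht) ?_
    have h2 := hcrit.pathDefect_nonpos hH hHc hγ hP hγP hab hs (-η) ht
    rw [pathDefect, contactDefect_neg] at h2
    exact neg_nonpos.1 h2
  exact h1.of_subset_closure (continuousOn_pathDefect hH hab (hγP a b hab) hs η)
    continuousOn_const Ioo_subset_Icc_self (by rw [closure_Ioo hab.lt.ne]) ht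

/-- The velocity of a vertical critical point in the preferred chart at one of its points. -/
theorem IsVerticalCriticalPoint.hasDerivWithinAt_chart (hcrit : IsVerticalCriticalPoint c H γ)
    (hH : IsSmoothHamiltonian H) (hHc : IsCompactlySupportedHamiltonian H)
    (hγ : γ ∈ carnotPathSpaceZero c H) (hP : c.AllowsBreaks P)
    (hγP : ∀ a b, IsPiece P a b → ContMDiffOn 𝓘(ℝ, ℝ) (jetModel n) ∞ γ (Icc a b))
    {a b : ℝ} (hab : IsPiece P a b) {t : ℝ} (ht : t ∈ Icc a b) :
    HasDerivWithinAt (fun τ => extChartAt (jetModel n) (γ t) (γ τ))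
      (contactHamiltonianVectorField H t (γ t) : JetVec n) (Icc a b) t := by
  -- The box lemma is applied with a dummy parameter to find a subinterval on which the path stays
  -- in the preferred chart at `γ t`.
  obtain ⟨ε', a', b', hε', -, haa', hab', hbb', ht', hsub, hnhds⟩ :=
    exists_box_subset one_pos hab.lt ht
      (O := (fun p : ℝ × ℝ => γ p.2) ⁻¹' (extChartAt (jetModel n) (γ t)).source)
      (((((hγP a b hab).continuousOn t ht).comp (s := Ioo (-1 : ℝ) 1 ×ˢ Icc a b)
        (continuous_snd.continuousWithinAt (x := ((0 : ℝ), t)))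
        fun p hp => hp.2)).preimage_mem_nhdsWithin (extChartAt_source_mem_nhds _))
  have h0 : (0 : ℝ) ∈ Ioo (-ε') ε' := ⟨by linarith, hε'⟩
  have hab'' := hab.mono haa' hab' hbb'
  have hs : MapsTo γ (Icc a' b') (extChartAt (jetModel n) (γ t)).source :=
    fun x hx => hsub (a := ((0 : ℝ), x)) ⟨h0, hx⟩
  have hu := contDiffOn_extChartAt_comp (hγP a' b' hab'') hs
  have hd := (hu.differentiableOn (by simp) t ht').hasDerivWithinAt
  have ht1 := hab.subset ht
  obtain ⟨τ, hτ⟩ : ∃ τ : JetVec n,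
    derivWithin (fun τ => extChartAt (jetModel n) (γ t) (γ τ)) (Icc a' b') t = τ := ⟨_, rfl⟩
  rw [hτ] at hd
  have hγ2 : ContMDiffOn 𝓘(ℝ, ℝ × ℝ) (jetModel n) ∞ (fun p : ℝ × ℝ => γ p.2)
      (Ioo (-ε') ε' ×ˢ Icc a' b') :=
    (hγP a' b' hab'').comp contDiff_snd.contMDiff.contMDiffOn fun p hp => hp.2
  -- The constant family `γ` supplies `λ(τ) = -H` for the one-sided velocity `τ`, even at a break
  -- point; the vanishing defect supplies the second defining equation of `X_H`.
  have hh := horizontal_in_chart hH (Γ := fun _ => γ) hab''.nonneg hab' hab''.le_one hγ2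
    (fun p hp => hs hp.2) (fun _ _ => hγ.1.2) rfl h0 ht'
  have hfd : fderivWithin ℝ (fun p : ℝ × ℝ => extChartAt (jetModel n) (γ t) (γ p.2))
      (Ioo (-ε') ε' ×ˢ Icc a' b') (0, t) (0, 1) = τ :=
    (uniqueDiffOn_Icc hab' t ht').eq_deriv _
      ((((contDiffOn_extChartAt_comp hγ2 (fun p hp => hs hp.2)).differentiableOn (by simp) (0, t)
        ⟨h0, ht'⟩).hasFDerivWithinAt).hasDerivWithinAt_snd h0) hd
  rw [hfd, hamInChart_extChartAt H t (mem_extChartAt_source (γ t))] at hh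
  obtain ⟨D, hD⟩ : ∃ D : JetVec n →L[ℝ] ℝ, fderiv ℝ (fun e => hamInChart H (γ t) (t, e))
    (extChartAt (jetModel n) (γ t) (γ t)) = D := ⟨_, rfl⟩
  have hdH : dHam H t (γ t) = D := ContinuousLinearMap.ext fun v =>
    (dHam_eq_fderiv hH ht1 (γ t) v).trans (congrArg (fun L : JetVec n →L[ℝ] ℝ => L v) hD)
  have hX : IsContactHamiltonianVector H t (γ t) τ := by
    refine (isContactHamiltonianVector_iff hdH).2 ⟨by linarith, fun v => ?_⟩
    rw [eq_iff_contactDefect_eq_zero]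
    have := hcrit.pathDefect_eq_zero hH hHc hγ hP hγP hab'' hs v ht'
    rwa [pathDefect, hτ, hD] at this
  have hτX : τ = (contactHamiltonianVectorField H t (γ t) : JetVec n) :=
    hX.eq (isContactHamiltonianVector_contactHamiltonianVectorField H t (γ t))
  rw [← hτX]
  exact hd.mono_of_mem_nhdsWithin hnhds

/-- The velocities from the left and from the right both equal `X_H`, so at a break point they glue
to a derivative within `[0, 1]`. -/
theorem IsVerticalCriticalPoint.isContactHamiltonianChord (hcrit : IsVerticalCriticalPoint c H γ)
    (hH : IsSmoothHamiltonian H) (hHc : IsCompactlySupportedHamiltonian H)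
    (hγ : γ ∈ carnotPathSpaceZero c H) : IsContactHamiltonianChord H γ := by
  obtain ⟨P, hP, hγP⟩ := hγ.1.1.exists_pieces
  refine ⟨fun t ht => ⟨continuousOn_of_pieces (fun a b hab => (hγP a b hab).continuousOn) t ht, ?_⟩,
    hγ.2⟩
  obtain ⟨S, hS, hQ⟩ := exists_mem_nhdsWithin_of_pieces
    (Q := fun S => HasDerivWithinAt (fun τ => extChartAt (jetModel n) (γ t) (γ τ))
      (contactHamiltonianVectorField H t (γ t) : JetVec n) S t) P (fun A B hA hB => hA.union hB) ht
    fun a b hab ht => hcrit.hasDerivWithinAt_chart hH hHc hγ hP hγP hab ht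
  have h1 := hQ.mono_of_mem_nhdsWithin hS
  rw [writtenInExtChartAt, extChartAt_model_space_eq_id]
  simp only [inter_univ, mfld_simps]
  exact h1

end OneJet

theorem mainTheorem4 {n : ℕ} {B : Type*} [TopologicalSpace B] [T2Space B]
    [SecondCountableTopology B] [ChartedSpace (EuclideanSpace ℝ (Fin n)) B]
    [IsManifold (𝓡 n) ∞ B] (c : PathClass) (H : ℝ → OneJet n B → ℝ)
    (hH : OneJet.IsSmoothHamiltonian H) (hHc : OneJet.IsCompactlySupportedHamiltonian H)
    (γ : ℝ → OneJet n B) (hγ : γ ∈ OneJet.carnotPathSpaceZero c H) :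
    OneJet.IsVerticalCriticalPoint c H γ ↔ OneJet.IsContactHamiltonianChord H γ :=
  ⟨fun h => h.isContactHamiltonianChord hH hHc hγ, fun h => h.isVerticalCriticalPoint hH⟩
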